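/- Let $p$ be a prime, $S$ a nontrivial finite $p$-group, $\mathcal F$ a saturated fusion system over $S$, and $R$ a commutative ring with unity (for example $R=\mathbb F_p$). *Conventions.* A fusion system over $S$ is a category whose objects are the subgroups of $S$, whose morphisms $P\to Q$ are injective homomorphisms, which contains all maps $P \to Q$ induced by conjugation by elements of $S$, and in which every morphism is the composite of an isomorphism of the category and an inclusion. Let $P\sim_{\mathcal F}Q$ mean that $P$ and $Q$ are isomorphic in $\mathcal F$. A subgroup $P$ is fully normalized (fully centralized) if $|N_S(P)|\ge|N_S(P')|$ (resp. $|C_S(P)|\ge |C_S(P')|$) for all $P'\sim_{\mathcal F}P$; it is fully automized if $\mathrm{Aut}_S(P)$ is a Sylow $p$-subgroup of $\mathrm{Aut}_{\mathcal F}(P)$; a subgroup $Q$ is receptive if every isomorphism $\varphi:P\to Q$ in $\mathcal F$ extends to a morphism $N_\varphi\to S$ in $\mathcal F$, where $N_\varphi=\{x\in N_S(P) : \varphi c_x\varphi^{-1}\in \mathrm{Aut}_S(Q)\}$. The system $\mathcal F$ is saturated if fully normalized subgroups are fully centralized and fully automized, and fully centralized subgroups are receptive. A subgroup $P$ is $\mathcal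 F$-centric if $C_S(P')\le P'$ for all $P'\sim_{\mathcal F}P$. The centric orbit category $\mathcal O^c(\mathcal F)$ has the $\mathcal F$-centric subgroups as objects and morphism sets $\mathrm{Inn}(Q)\backslash \mathrm{Mor}_{\mathcal F}(P,Q)$. For a small category $\mathbf C$, an $R\mathbf C$-module is a contravariant functor $M$ from $\mathbf C$ to $R$-modules, and $H^n(\mathbf C;M)=\mathrm{Ext}^n_{R\mathbf C}(\underline R,M)$, with $\underline R$ the constant functor. For $E\le S$, the centralizer fusion system $C_{\mathcal F}(E)$ over $C_S(E)$ has as morphisms $P\to Q$ the $\varphi\in\mathrm{Mor}_{\mathcal F}(P,Q)$ that extend to a morphism $PE\to QE$ in $\mathcal F$ which is the identity on $E$. Let $\mathcal F^e$ be the full subcategory of $\mathcal F$ on the nontrivial elementary abelian subgroups of $S$ that are fully centralized in $\mathcal F$. For $E\in\mathcal F^e$ every $C_{\mathcal F}(E)$-centric subgroup is $\mathcal F$-centric, so an $R\mathcal O^c(\mathcal F)$-module $M$ restricts to $\mathcal O^c(C_{\mathcal F}(E))$. For each $t\geq 0$, the assignment $E\mapsto H^t(\mathcal O^c(C_{\mathcal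 F}(E));M)$ is a covariant functor on $\mathcal F^e$: the map induced by $\varphi:E\to E'$ comes from the functor $\mathcal O^c(C_{\mathcal F}(E'))\to\mathcal O^c(C_{\mathcal F}(E))$ and the isomorphisms $M(\psi(P))\cong M(P)$ determined by any morphism $\psi:C_S(E')\to C_S(E)$ in $\mathcal F$ that extends $\varphi^{-1}:\varphi(E)\to E$; it does not depend on $\psi$. **Theorem.** For every $R\mathcal O^c(\mathcal F)$-module $M$ there is a first quadrant cohomological spectral sequence $$E_2^{s,t}=\lim_{E\in\mathcal F^e}{}^{\!s}\; H^t(\mathcal O^c(C_{\mathcal F}(E));M)\ \Longrightarrow\ H^{s+t}(\mathcal O^c(\mathcal F);M),$$ where $\lim^s$ is the $s$-th right derived functor of the limit over $\mathcal F^e$. Convergence means that each $H^n(\mathcal O^c(\mathcal F);M)$ has a finite filtration by $R$-submodules whose graded pieces are the $E_\infty^{s,t}$ with $s+t=n$. -/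

import Mathlib

open CategoryTheory CategoryTheory.Abelian CategoryTheory.Limits
universe u w

/-- Functor categories into modules are Grothendieck abelian; this supplies enough injectives and
the `Ext`-groups of such categories. -/
instance functorCategory_isGrothendieckAbelian (R : Type u) [CommRing R] (J : Type u)
    [SmallCategory J] : IsGrothendieckAbelian.{u} (J ⥤ ModuleCat.{u} R) :=
  haveI : IsGrothendieckAbelian.{u} ((Jᵒᵖ)ᵒᵖ ⥤ ModuleCat.{u} R) :=
    { ab5OfSize := { ofShape := fun K _ _ => inferInstance } }
  IsGrothendieckAbelian.of_equivalence
    ((opOpEquivalence J).congrLeft (E := ModuleCat.{u} R))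

instance lim_additive (R : Type u) [CommRing R] (J : Type u) [SmallCategory J] :
    (lim : (J ⥤ ModuleCat.{u} R) ⥤ ModuleCat.{u} R).Additive where
  map_add {X Y f g} := by
    apply limit.hom_ext
    intro j
    simp [Preadditive.add_comp, Preadditive.comp_add]

section ExtLemmas
variable {A B C : Type*} [Category A] [Category B] [Category C] [Abelian A] [Abelian B] [Abelian C]

theorem ext_exists_comp_extClass [HasExt.{w} A] [EnoughInjectives A] {X Y : A} {n : ℕ}
    (e : Ext X Y (n + 1)) : ∃ (S : ShortComplex A) (hS : S.ShortExact) (h : S.X₁ = Y)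
      (x : Ext X S.X₃ n), e = h ▸ x.comp hS.extClass rfl := by
  let S : ShortComplex A := ShortComplex.mk (Injective.ι Y) (cokernel.π (Injective.ι Y)) (by simp)
  have hS : S.ShortExact :=
    { exact := ShortComplex.exact_of_g_is_cokernel _ (cokernelIsCokernel _)
      mono_f := inferInstanceAs (Mono (Injective.ι Y))
      epi_g := inferInstanceAs (Epi (cokernel.π _)) }
  obtain ⟨x, rfl⟩ := Ext.covariant_sequence_exact₁ X hS e
    (haveI : Injective S.X₂ := inferInstanceAs (Injective (Injective.under Y))
     Ext.eq_zero_of_injective _) rfl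
  exact ⟨S, hS, rfl, x, rfl⟩

theorem ext_map_natTrans [HasExt.{w} A] [HasExt.{w} B] [EnoughInjectives A]
    (P Q : A ⥤ B) [P.Additive] [Q.Additive]
    [PreservesFiniteLimits P] [PreservesFiniteColimits P]
    [PreservesFiniteLimits Q] [PreservesFiniteColimits Q] (η : P ⟶ Q) {X Y : A} {n : ℕ}
    (e : Ext X Y n) :
    (e.mapExactFunctor P).comp (Ext.mk₀ (η.app Y)) (add_zero n) =
      (Ext.mk₀ (η.app X)).comp (e.mapExactFunctor Q) (zero_add n) := by
  induction n generalizing Y with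
  | zero =>
    obtain ⟨f, rfl⟩ := (Ext.mk₀_bijective X Y).2 e
    simp [Ext.mapExactFunctor_mk₀, Ext.mk₀_comp_mk₀]
  | succ n ih =>
    obtain ⟨S, hS, rfl, x, rfl⟩ := ext_exists_comp_extClass e
    dsimp only
    rw [Ext.mapExactFunctor_comp, Ext.mapExactFunctor_comp, Ext.mapExactFunctor_extClass,
      Ext.mapExactFunctor_extClass]
    refine (Ext.comp_assoc_of_third_deg_zero _ _ _ _).trans ?_
    refine (congrArg (fun z => (x.mapExactFunctor P).comp z rfl)
      (ShortComplex.ShortExact.extClass_naturality (hS.map_of_exact P) (hS.map_of_exact Q)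
        (S.mapNatTrans η))).trans ?_
    refine (Ext.comp_assoc_of_second_deg_zero _ _ _ _).symm.trans ?_
    refine (congrArg (fun z => Ext.comp z (hS.map_of_exact Q).extClass rfl) (ih x)).trans ?_
    exact Ext.comp_assoc _ _ _ _ _ (by omega)

theorem ext_map_id [HasExt.{w} A] [EnoughInjectives A] {X Y : A} {n : ℕ}
    (e : Ext X Y n) : e.mapExactFunctor (𝟭 A) = e := by
  induction n generalizing Y with
  | zero =>
    obtain ⟨f, rfl⟩ := (Ext.mk₀_bijective X Y).2 e
    simp [Ext.mapExactFunctor_mk₀]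
  | succ n ih =>
    obtain ⟨S, hS, rfl, x, rfl⟩ := ext_exists_comp_extClass e
    dsimp only
    rw [Ext.mapExactFunctor_comp, Ext.mapExactFunctor_extClass, ih x]
    rfl

theorem ext_map_comp [HasExt.{w} A] [HasExt.{w} B] [HasExt.{w} C]
    [EnoughInjectives A] (P : A ⥤ B) (Q : B ⥤ C) [P.Additive] [Q.Additive]
    [PreservesFiniteLimits P] [PreservesFiniteColimits P]
    [PreservesFiniteLimits Q] [PreservesFiniteColimits Q] [PreservesFiniteLimits (P ⋙ Q)]
    [PreservesFiniteColimits (P ⋙ Q)] {X Y : A} {n : ℕ} (e : Ext X Y n) :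
    e.mapExactFunctor (P ⋙ Q) = (e.mapExactFunctor P).mapExactFunctor Q := by
  induction n generalizing Y with
  | zero =>
    obtain ⟨f, rfl⟩ := (Ext.mk₀_bijective X Y).2 e
    simp only [Ext.mapExactFunctor_mk₀]; rfl
  | succ n ih =>
    obtain ⟨S, hS, rfl, x, rfl⟩ := ext_exists_comp_extClass e
    dsimp only
    rw [Ext.mapExactFunctor_comp, Ext.mapExactFunctor_comp, Ext.mapExactFunctor_extClass, ih x,
      Ext.mapExactFunctor_extClass]
    refine Eq.trans ?_ (Ext.mapExactFunctor_comp Q _ _ _).symm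
    exact congrArg (fun z => ((x.mapExactFunctor P).mapExactFunctor Q).comp z rfl)
      (Ext.mapExactFunctor_extClass Q (hS.map_of_exact P)).symm

end ExtLemmas


section Cohomology

instance whiskeringLeft_linear (R : Type u) [CommRing R] {C D : Type u} [SmallCategory C]
    [SmallCategory D] (G : C ⥤ D) :
    ((Functor.whiskeringLeft Cᵒᵖ Dᵒᵖ (ModuleCat.{u} R)).obj G.op).Linear R where

variable {R : Type u} [CommRing R] {C D E : Type u} [SmallCategory C] [SmallCategory D]
  [SmallCategory E]

variable (R C) in
/-- The constant module `R`. -/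
abbrev constModule : Cᵒᵖ ⥤ ModuleCat.{u} R := (Functor.const Cᵒᵖ).obj (ModuleCat.of R R)

/-- The cohomology `H^n(C; M) = Ext^n(R, M)` of a small category `C` with coefficients in a
contravariant functor `M` from `C` to `R`-modules, where `R` stands for the constant functor. -/
noncomputable def catCohomology (M : Cᵒᵖ ⥤ ModuleCat.{u} R) (n : ℕ) : ModuleCat.{u} R :=
  ModuleCat.of R (Ext (constModule R C) M n)

/-- The (identity) map from the constant functor to the restriction of the constant functor. -/
def constModuleRes (G : C ⥤ D) : constModule R C ⟶ G.op ⋙ constModule R D where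
  app _ := 𝟙 _

/-- The map `H^n(D; M) ⟶ H^n(C; N)` given by restriction along `G : C ⥤ D`, followed by a map of
coefficients `τ` from the restriction of `M` to `N`. -/
noncomputable def cohomologyMap (G : C ⥤ D) {M : Dᵒᵖ ⥤ ModuleCat.{u} R} {N : Cᵒᵖ ⥤ ModuleCat.{u} R}
    (τ : G.op ⋙ M ⟶ N) (n : ℕ) : catCohomology M n ⟶ catCohomology N n :=
  ModuleCat.ofHom
    ((Ext.mk₀ τ).postcompOfLinear R (constModule R C) (add_zero n) ∘ₗ
      (Ext.mk₀ (constModuleRes G)).precompOfLinear R (G.op ⋙ M) (zero_add n) ∘ₗ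
      ((Functor.whiskeringLeft Cᵒᵖ Dᵒᵖ (ModuleCat.{u} R)).obj G.op).mapExtLinearMap R
        (constModule R D) M n)

theorem cohomologyMap_apply (G : C ⥤ D) {M : Dᵒᵖ ⥤ ModuleCat.{u} R} {N : Cᵒᵖ ⥤ ModuleCat.{u} R}
    (τ : G.op ⋙ M ⟶ N) (n : ℕ) (e : Ext (constModule R D) M n) :
    (cohomologyMap G τ n).hom e =
      ((Ext.mk₀ (constModuleRes G)).comp
        (e.mapExactFunctor ((Functor.whiskeringLeft Cᵒᵖ Dᵒᵖ (ModuleCat.{u} R)).obj G.op))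
          (zero_add n)).comp (Ext.mk₀ τ) (add_zero n) := rfl

theorem cohomologyMap_natTrans {G G' : C ⥤ D} (θ : G ⟶ G') {M : Dᵒᵖ ⥤ ModuleCat.{u} R}
    {N : Cᵒᵖ ⥤ ModuleCat.{u} R} (τ : G.op ⋙ M ⟶ N) (τ' : G'.op ⋙ M ⟶ N)
    (h : ∀ X : C, M.map (θ.app X).op ≫ τ.app (.op X) = τ'.app (.op X)) (n : ℕ) :
    cohomologyMap G τ n = cohomologyMap G' τ' n := by
  ext e
  change Ext _ _ _ at e
  rw [cohomologyMap_apply, cohomologyMap_apply]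
  let η := (Functor.whiskeringLeft Cᵒᵖ Dᵒᵖ (ModuleCat.{u} R)).map (NatTrans.op θ)
  have h1 : τ' = η.app M ≫ τ := by
    ext X : 2
    exact (h X.unop).symm
  have h2 : constModuleRes G = constModuleRes (R := R) G' ≫ η.app (constModule R D) := by
    ext X : 2
    rfl
  have h3 := ext_map_natTrans _ _ η e
  rw [h1, h2, ← Ext.mk₀_comp_mk₀, ← Ext.mk₀_comp_mk₀]
  rw [Ext.comp_assoc_of_second_deg_zero (Ext.mk₀ (constModuleRes G')) (Ext.mk₀ (η.app _))]
  refine (congrArg (fun z => ((Ext.mk₀ (constModuleRes G')).comp z (zero_add n)).comp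
    (Ext.mk₀ τ) (add_zero n)) h3.symm).trans ?_
  simp only [Ext.comp_assoc_of_third_deg_zero]

theorem cohomologyMap_id {M : Cᵒᵖ ⥤ ModuleCat.{u} R} (τ : (𝟭 C).op ⋙ M ⟶ M)
    (h : ∀ X : C, τ.app (.op X) = 𝟙 (M.obj (.op X))) (n : ℕ) :
    cohomologyMap (𝟭 C) τ n = 𝟙 _ := by
  ext e
  change Ext _ _ _ at e
  rw [cohomologyMap_apply]
  let η : (Functor.whiskeringLeft Cᵒᵖ Cᵒᵖ (ModuleCat.{u} R)).obj (𝟭 C).op ⟶ 𝟭 _ :=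
    { app := fun M => { app := fun X => 𝟙 _ } }
  have h1 : τ = η.app M := by
    ext X : 2
    exact h X.unop
  have h2 : constModuleRes (R := R) (𝟭 C) ≫ η.app (constModule R C) = 𝟙 _ := by
    ext X : 2
    exact Category.id_comp _
  have h3 := ext_map_natTrans _ _ η e
  rw [ext_map_id] at h3
  rw [h1, Ext.comp_assoc_of_third_deg_zero]
  refine (congrArg (fun z => (Ext.mk₀ (constModuleRes (𝟭 C))).comp z (zero_add n)) h3).trans ?_
  refine (Ext.comp_assoc_of_second_deg_zero _ _ _ _).symm.trans ?_
  rw [Ext.mk₀_comp_mk₀, h2, Ext.mk₀_id_comp]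
  rfl

theorem cohomologyMap_comp (G : C ⥤ D) (G' : D ⥤ E) {M : Eᵒᵖ ⥤ ModuleCat.{u} R}
    {N : Dᵒᵖ ⥤ ModuleCat.{u} R} {L : Cᵒᵖ ⥤ ModuleCat.{u} R}
    (τ : G.op ⋙ N ⟶ L) (τ' : G'.op ⋙ M ⟶ N) (σ : (G ⋙ G').op ⋙ M ⟶ L)
    (h : ∀ X : C, σ.app (.op X) = τ'.app (.op (G.obj X)) ≫ τ.app (.op X)) (n : ℕ) :
    cohomologyMap (G ⋙ G') σ n = cohomologyMap G' τ' n ≫ cohomologyMap G τ n := by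
  ext e
  change Ext _ _ _ at e
  change _ = (cohomologyMap G τ n).hom ((cohomologyMap G' τ' n).hom e)
  rw [cohomologyMap_apply, cohomologyMap_apply G' τ' n e, cohomologyMap_apply]
  let P := (Functor.whiskeringLeft Dᵒᵖ Eᵒᵖ (ModuleCat.{u} R)).obj G'.op
  let Q := (Functor.whiskeringLeft Cᵒᵖ Dᵒᵖ (ModuleCat.{u} R)).obj G.op
  have h1 : σ = Q.map τ' ≫ τ := by
    ext X : 2
    exact h X.unop
  have h2 : constModuleRes (R := R) (G ⋙ G') =
      constModuleRes G ≫ Q.map (constModuleRes G') := by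
    ext X : 2
    exact (Category.id_comp _).symm
  have h3 := ext_map_comp P Q e
  rw [Ext.mapExactFunctor_comp, Ext.mapExactFunctor_comp, Ext.mapExactFunctor_mk₀,
    Ext.mapExactFunctor_mk₀]
  refine Eq.trans (congrArg (fun z => Ext.comp (Ext.comp (Ext.mk₀ (constModuleRes (G ⋙ G')))
    z (zero_add n)) (Ext.mk₀ σ) (add_zero n)) h3) ?_
  rw [h1, h2, ← Ext.mk₀_comp_mk₀, ← Ext.mk₀_comp_mk₀]
  simp only [Ext.comp_assoc_of_second_deg_zero, Ext.comp_assoc_of_third_deg_zero]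
  rfl

/-- The higher limit `lim^s` of a functor `N : J ⥤ R-Mod`: the `s`-th right derived functor of the
limit functor. -/
noncomputable def higherLimit {J : Type u} [SmallCategory J] (N : J ⥤ ModuleCat.{u} R) (s : ℕ) :
    ModuleCat.{u} R :=
  ((lim : (J ⥤ ModuleCat.{u} R) ⥤ ModuleCat.{u} R).rightDerived s).obj N

/-- A first quadrant cohomological spectral sequence converges to `H`: each `H n` has a finite
decreasing filtration whose graded pieces are the terms `E_∞^{s,t}` with `s + t = n`. The
differentials into and out of `E_r^{s,t}` vanish once `r > s` and `r > t + 1`, so that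
`E_∞^{s,t} = E_r^{s,t}` for all these `r`. -/
def ConvergesTo (E : E₂CohomologicalSpectralSequenceNat (ModuleCat.{u} R))
    (H : ℕ → ModuleCat.{u} R) : Prop :=
  ∀ n : ℕ, ∃ Fil : ℕ → Submodule R (H n), Antitone Fil ∧ Fil 0 = ⊤ ∧ Fil (n + 1) = ⊥ ∧
    ∀ s t : ℕ, s + t = n → ∀ (r : ℤ) (hr : 2 ≤ r), (s : ℤ) < r → (t : ℤ) + 1 < r →
      Nonempty ((E.page r hr).X (s, t) ≃ₗ[R] Fil s ⧸ (Fil (s + 1)).submoduleOf (Fil s))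

end Cohomology

/-- A fusion system over `S`: sets of injective homomorphisms between the subgroups of `S`, closed
under composition, which contain all conjugations by elements of `S`, and which contain with
`φ : P → Q` also its inverse `ψ : φ(P) → P`. In the last axiom `R` is the image of `φ`. -/
structure FusionSystem (S : Type u) [Group S] where
  Mor (P Q : Subgroup S) : Set (P →* Q)
  injective {P Q : Subgroup S} {φ : P →* Q} : φ ∈ Mor P Q → Function.Injective φ
  conj_mem {P Q : Subgroup S} (φ : P →* Q) (s : S) :
    (∀ x : P, (φ x : S) = s * x * s⁻¹) → φ ∈ Mor P Q
  comp_mem {P Q R : Subgroup S} {φ : P →* Q} {ψ : Q →* R} :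
    φ ∈ Mor P Q → ψ ∈ Mor Q R → ψ.comp φ ∈ Mor P R
  symm_mem {P Q R : Subgroup S} {φ : P →* Q} (ψ : R →* P) : φ ∈ Mor P Q →
    (∀ x : P, (φ x : S) ∈ R) → (∀ r : R, (φ (ψ r) : S) = r) → ψ ∈ Mor R P

namespace FusionSystem

section Basic
variable {S : Type u} [Group S] (F : FusionSystem S)

/-- Restriction of a homomorphism to subgroups of the source and of the target. -/
def restrictHom {P Q : Subgroup S} (φ : P →* Q) (A B : Subgroup S) (hA : A ≤ P)
    (h : ∀ (a : S) (ha : a ∈ A), (φ ⟨a, hA ha⟩ : S) ∈ B) : A →* B :=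
  ((Q.subtype.comp φ).comp (Subgroup.inclusion hA)).codRestrict B (fun a => h a a.2)

@[simp]
theorem coe_restrictHom {P Q : Subgroup S} (φ : P →* Q) (A B : Subgroup S) (hA : A ≤ P)
    (h : ∀ (a : S) (ha : a ∈ A), (φ ⟨a, hA ha⟩ : S) ∈ B) (a : A) :
    (restrictHom φ A B hA h a : S) = φ ⟨a, hA a.2⟩ := rfl

variable {F}

theorem exists_inverse {P Q : Subgroup S} {φ : P →* Q} (hφ : φ ∈ F.Mor P Q) (R : Subgroup S)
    (hR : ∀ s, s ∈ R ↔ ∃ x : P, (φ x : S) = s) :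
    ∃ ψ ∈ F.Mor R P, ∀ r : R, (φ (ψ r) : S) = r := by
  have hinj : Function.Injective (Q.subtype.comp φ) :=
    (Subtype.val_injective).comp (F.injective hφ)
  have hR' : R = (Q.subtype.comp φ).range := by
    ext s; rw [hR]; rfl
  subst hR'
  have key : ∀ r : (Q.subtype.comp φ).range,
      (φ ((MonoidHom.ofInjective hinj).symm r) : S) = r := fun r =>
    congrArg Subtype.val ((MonoidHom.ofInjective hinj).apply_symm_apply r)
  exact ⟨(MonoidHom.ofInjective hinj).symm.toMonoidHom,
    F.symm_mem _ hφ (fun x => ⟨x, rfl⟩) key, key⟩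

/-- Fusion systems are closed under restriction. -/
theorem mem_of_agree {P Q A B : Subgroup S} {φ : P →* Q} (hφ : φ ∈ F.Mor P Q) (hA : A ≤ P)
    (α : A →* B) (h : ∀ a : A, (α a : S) = φ ⟨a, hA a.2⟩) : α ∈ F.Mor A B := by
  have h1 : φ.comp (Subgroup.inclusion hA) ∈ F.Mor A Q :=
    F.comp_mem (F.conj_mem _ 1 (by simp)) hφ
  obtain ⟨ψ, hψ, hψ'⟩ := exists_inverse h1 (B.subtype.comp α).range (fun s => by
    constructor
    · rintro ⟨x, rfl⟩; exact ⟨x, (h x).symm⟩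
    · rintro ⟨x, rfl⟩; exact ⟨x, h x⟩)
  have h2 : (B.subtype.comp α).rangeRestrict ∈ F.Mor A (B.subtype.comp α).range := by
    refine F.symm_mem _ hψ (fun x => (ψ x).2) (fun r => ?_)
    have := hψ' ((B.subtype.comp α).rangeRestrict r)
    have h3 : (((B.subtype.comp α).rangeRestrict r : _) : S) = φ.comp (Subgroup.inclusion hA) r :=
      h r
    rw [h3] at this
    exact congrArg Subtype.val (F.injective h1 (Subtype.ext this))
  have h4 : (B.subtype.comp α).range ≤ B := by rintro _ ⟨x, rfl⟩; exact (α x).2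
  exact F.comp_mem h2 (F.conj_mem (Subgroup.inclusion h4) 1 (by simp))

variable (F)

/-- `P` and `Q` are `F`-conjugate: there is an isomorphism `P → Q` in `F`. (Morphisms of `F` are
injective, and inverses of bijective ones are again in `F`.) -/
def IsConj (P Q : Subgroup S) : Prop := ∃ φ ∈ F.Mor P Q, Function.Surjective φ

/-- `P` is fully normalized in `F`. -/
def FullyNormalized (P : Subgroup S) : Prop :=
  ∀ Q, F.IsConj P Q →
    Nat.card (Subgroup.normalizer (Q : Set S)) ≤ Nat.card (Subgroup.normalizer (P : Set S))

/-- `P` is fully centralized in `F`. -/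
def FullyCentralized (P : Subgroup S) : Prop :=
  ∀ Q, F.IsConj P Q →
    Nat.card (Subgroup.centralizer (Q : Set S)) ≤ Nat.card (Subgroup.centralizer (P : Set S))

/-- The group `Aut_F(P)`. -/
def aut (P : Subgroup S) : Subgroup (MulAut P) where
  carrier := {α | α.toMonoidHom ∈ F.Mor P P}
  one_mem' := F.conj_mem _ 1 (by simp)
  mul_mem' {α β} hα hβ := F.comp_mem hβ hα
  inv_mem' {α} hα := F.symm_mem _ hα (fun x => (α x).2)
    (fun r => congrArg Subtype.val (α.apply_symm_apply r))

/-- `P` is fully automized: `Aut_S(P)`, the image of the conjugation action of `N_S(P)`, is a Sylow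
`p`-subgroup of `Aut_F(P)`. -/
def FullyAutomized (p : ℕ) (P : Subgroup S) : Prop :=
  ∃ T : Sylow p (F.aut P), (T : Subgroup (F.aut P)) =
    P.normalizerMonoidHom.range.subgroupOf (F.aut P)

/-- For an isomorphism `φ : P → Q`, the subgroup
`N_φ = {x ∈ N_S(P) | ∃ y ∈ N_S(Q), φ ∘ c_x = c_y ∘ φ}` of `S`. -/
def extensionDomain {P Q : Subgroup S} (φ : P →* Q) : Subgroup S where
  carrier := {x | ∃ hx : x ∈ Subgroup.normalizer (P : Set S),
    ∃ y ∈ Subgroup.normalizer (Q : Set S), ∀ g : P,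
      (φ (P.normalizerMonoidHom ⟨x, hx⟩ g) : S) = y * φ g * y⁻¹}
  one_mem' := ⟨one_mem _, 1, one_mem _, fun g => by
    simp [show (⟨1, one_mem _⟩ : Subgroup.normalizer (P : Set S)) = 1 from rfl]⟩
  mul_mem' := by
    rintro a b ⟨ha, y, hy, h⟩ ⟨hb, z, hz, h'⟩
    refine ⟨mul_mem ha hb, y * z, mul_mem hy hz, fun g => ?_⟩
    rw [show (⟨a * b, mul_mem ha hb⟩ : Subgroup.normalizer (P : Set S)) = ⟨a, ha⟩ * ⟨b, hb⟩
      from rfl, map_mul, MulAut.mul_apply, h, h']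
    group
  inv_mem' := by
    rintro a ⟨ha, y, hy, h⟩
    refine ⟨inv_mem ha, y⁻¹, inv_mem hy, fun g => ?_⟩
    rw [show (⟨a⁻¹, inv_mem ha⟩ : Subgroup.normalizer (P : Set S)) = ⟨a, ha⟩⁻¹ from rfl, map_inv]
    have := h ((P.normalizerMonoidHom ⟨a, ha⟩)⁻¹ g)
    rw [MulAut.apply_inv_self] at this
    rw [this]
    group

/-- `Q` is receptive: every isomorphism `φ : P → Q` in `F` extends to a morphism `N_φ → S` in `F`. -/
def Receptive (Q : Subgroup S) : Prop :=
  ∀ (P : Subgroup S) (φ : P →* Q), φ ∈ F.Mor P Q → Function.Surjective φ →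
    ∃ ψ ∈ F.Mor (extensionDomain φ) ⊤, ∀ (x : P) (hx : (x : S) ∈ extensionDomain φ),
      (ψ ⟨x, hx⟩ : S) = φ x

/-- Saturated fusion systems. -/
structure IsSaturated (p : ℕ) : Prop where
  fullyCentralized_of_fullyNormalized : ∀ P, F.FullyNormalized P → F.FullyCentralized P
  fullyAutomized_of_fullyNormalized : ∀ P, F.FullyNormalized P → F.FullyAutomized p P
  receptive_of_fullyCentralized : ∀ P, F.FullyCentralized P → F.Receptive P

/-- `P` is `F`-centric. -/
def IsCentric (P : Subgroup S) : Prop :=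
  ∀ Q, F.IsConj P Q → Subgroup.centralizer (Q : Set S) ≤ Q

/-- The objects of `F`, regarded as a category: the subgroups of `S`. -/
@[ext]
structure Obj {S : Type u} [Group S] (F : FusionSystem S) where
  subgroup : Subgroup S

/-- The fusion system as a category. -/
instance : Category.{u} F.Obj where
  Hom P Q := {φ : P.subgroup →* Q.subgroup // φ ∈ F.Mor P.subgroup Q.subgroup}
  id P := ⟨MonoidHom.id _, F.conj_mem _ 1 (by simp)⟩
  comp φ ψ := ⟨ψ.1.comp φ.1, F.comp_mem φ.2 ψ.2⟩

/-- Two morphisms `P → Q` are related if they differ by an inner automorphism of `Q`. -/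
def innRel : HomRel F.Obj := fun _ Q φ ψ =>
  ∃ q : Q.subgroup, ∀ x, ψ.1 x = q * φ.1 x * q⁻¹

instance : Congruence F.innRel where
  comp_left := by
    rintro P Q R f g g' ⟨r, h⟩
    exact ⟨r, fun x => h (f.1 x)⟩
  comp_right := by
    rintro P Q R f f' g ⟨q, h⟩
    refine ⟨g.1 q, fun x => ?_⟩
    change g.1 (f'.1 x) = g.1 q * g.1 (f.1 x) * (g.1 q)⁻¹
    rw [h, map_mul, map_mul, map_inv]
  equivalence :=
    { refl := fun f => ⟨1, fun x => by simp⟩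
      symm := by
        rintro f g ⟨q, h⟩
        exact ⟨q⁻¹, fun x => by rw [h]; group⟩
      trans := by
        rintro f g k ⟨q, h⟩ ⟨q', h'⟩
        exact ⟨q' * q, fun x => by rw [h', h]; group⟩ }

/-- The orbit category `O(F)`, with morphisms `Inn(Q) \ Mor_F(P, Q)`. -/
abbrev OrbitCategory : Type u := CategoryTheory.Quotient F.innRel

/-- The full subcategory of `O(F)` on the `F`-centric subgroups. -/
def centric : ObjectProperty F.OrbitCategory := fun P => F.IsCentric P.as.subgroup

/-- The centric orbit category `O^c(F)`. -/
abbrev CentricOrbitCategory : Type u := F.centric.FullSubcategory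

/-- The subgroup underlying an object of the centric orbit category. -/
abbrev CentricOrbitCategory.subgroup {F : FusionSystem S} (P : F.CentricOrbitCategory) :
    Subgroup S := P.obj.as.subgroup

/-- The class of an `F`-morphism. -/
def CentricOrbitCategory.mk {F : FusionSystem S} {P Q : F.CentricOrbitCategory}
    (φ : P.subgroup →* Q.subgroup) (hφ : φ ∈ F.Mor P.subgroup Q.subgroup) : P ⟶ Q :=
  ObjectProperty.homMk ((CategoryTheory.Quotient.functor F.innRel).map
    (X := P.obj.as) (Y := Q.obj.as) ⟨φ, hφ⟩)

theorem CentricOrbitCategory.exists_rep {F : FusionSystem S} {P Q : F.CentricOrbitCategory}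
    (f : P ⟶ Q) : ∃ (φ : P.subgroup →* Q.subgroup) (hφ : φ ∈ F.Mor P.subgroup Q.subgroup),
      mk φ hφ = f := by
  obtain ⟨⟨φ, hφ⟩, h⟩ := Quot.exists_rep f.hom
  exact ⟨φ, hφ, ObjectProperty.hom_ext _ h⟩

theorem CentricOrbitCategory.mk_eq_iff {F : FusionSystem S} {P Q : F.CentricOrbitCategory}
    {φ ψ : P.subgroup →* Q.subgroup} (hφ : φ ∈ F.Mor P.subgroup Q.subgroup)
    (hψ : ψ ∈ F.Mor P.subgroup Q.subgroup) :
    mk φ hφ = mk ψ hψ ↔ ∃ q : Q.subgroup, ∀ x, ψ x = q * φ x * q⁻¹ := by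
  refine Iff.trans ?_ (CategoryTheory.Quotient.functor_map_eq_iff F.innRel
    (X := P.obj.as) (Y := Q.obj.as) ⟨φ, hφ⟩ ⟨ψ, hψ⟩)
  exact ⟨fun h => congrArg (·.hom) h, fun h => ObjectProperty.hom_ext _ h⟩

theorem CentricOrbitCategory.mk_comp_mk {F : FusionSystem S} {P Q R : F.CentricOrbitCategory}
    {φ : P.subgroup →* Q.subgroup} {ψ : Q.subgroup →* R.subgroup}
    (hφ : φ ∈ F.Mor P.subgroup Q.subgroup) (hψ : ψ ∈ F.Mor Q.subgroup R.subgroup) :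
    mk φ hφ ≫ mk ψ hψ = mk (ψ.comp φ) (F.comp_mem hφ hψ) := rfl

theorem CentricOrbitCategory.mk_id {F : FusionSystem S} (P : F.CentricOrbitCategory)
    (h : MonoidHom.id P.subgroup ∈ F.Mor P.subgroup P.subgroup) :
    mk (MonoidHom.id P.subgroup) h = 𝟙 P := rfl
end Basic

section CentralizerSystem
variable {S : Type u} [Group S] (F : FusionSystem S)

theorem map_subtype_le (Q : Subgroup S) (P : Subgroup (Subgroup.centralizer (Q : Set S))) :
    P.map (Subgroup.subtype _) ≤ Subgroup.centralizer (Q : Set S) := by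
  rintro _ ⟨x, -, rfl⟩; exact x.2

/-- `φ : P → R` extends to a morphism `QP → QR` in `F` which is the identity on `Q`. Here `P` and `R`
are subgroups of `C_S(Q)`, so the products `QP` and `QR` are subgroups. (As `F` is closed under
restriction, `φ` is then itself a morphism of `F`.) -/
def IsCentralizerMor (Q : Subgroup S) (P R : Subgroup (Subgroup.centralizer (Q : Set S)))
    (φ : P →* R) : Prop :=
  ∃ ψ ∈ F.Mor (Q ⊔ P.map (Subgroup.subtype _)) (Q ⊔ R.map (Subgroup.subtype _)),
      (∀ (x : S) (hx : x ∈ Q), (ψ ⟨x, le_sup_left (a := Q) hx⟩ : S) = x) ∧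
      ∀ x : P, (ψ ⟨x, le_sup_right (a := Q) ⟨x, x.2, rfl⟩⟩ : S) = (φ x : S)

variable {F} in
theorem isCentralizerMor_of {Q : Subgroup S} {P R : Subgroup (Subgroup.centralizer (Q : Set S))}
    {φ : P →* R} {A B : Subgroup S} {ψ : A →* B} (hψ : ψ ∈ F.Mor A B)
    (hQ : Q ≤ A) (hP : P.map (Subgroup.subtype _) ≤ A)
    (h1 : ∀ (x : S) (hx : x ∈ Q), (ψ ⟨x, hQ hx⟩ : S) = x)
    (h2 : ∀ x : P, (ψ ⟨x, hP ⟨x, x.2, rfl⟩⟩ : S) = (φ x : S)) : F.IsCentralizerMor Q P R φ := by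
  have h3 : Q ⊔ P.map (Subgroup.subtype _) ≤
      ((Q ⊔ R.map (Subgroup.subtype _)).comap (B.subtype.comp ψ)).map A.subtype := by
    refine sup_le (fun x hx => ⟨⟨x, hQ hx⟩, ?_, rfl⟩) ?_
    · exact show (ψ ⟨x, hQ hx⟩ : S) ∈ Q ⊔ R.map (Subgroup.subtype _) by
        rw [h1 x hx]; exact le_sup_left (a := Q) hx
    · rintro _ ⟨x, hx, rfl⟩
      refine ⟨⟨x, hP ⟨x, hx, rfl⟩⟩, ?_, rfl⟩
      exact show (ψ ⟨x, hP ⟨x, hx, rfl⟩⟩ : S) ∈ Q ⊔ R.map (Subgroup.subtype _) by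
        rw [h2 ⟨x, hx⟩]; exact le_sup_right (a := Q) ⟨_, (φ ⟨x, hx⟩).2, rfl⟩
  refine ⟨restrictHom ψ _ _ (sup_le hQ hP) (fun a ha => ?_),
    mem_of_agree hψ (sup_le hQ hP) _ (fun a => rfl), h1, h2⟩
  obtain ⟨⟨b, hb⟩, hb', rfl⟩ := h3 ha
  exact hb'

/-- The centralizer fusion system `C_F(Q)` over `C_S(Q)`. -/
def centralizer (Q : Subgroup S) : FusionSystem (Subgroup.centralizer (Q : Set S)) where
  Mor P R := {φ | F.IsCentralizerMor Q P R φ}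
  injective := by
    rintro P R φ ⟨ψ, hψ, -, h⟩ x y hxy
    have : ψ _ = ψ _ := Subtype.ext ((h x).trans ((congrArg (fun z : R => ((z : Subgroup.centralizer (Q : Set S)) : S)) hxy).trans
      (h y).symm))
    exact Subtype.ext (Subtype.ext (Subtype.mk.inj (F.injective hψ this)))
  conj_mem {P R} φ s h := by
    refine isCentralizerMor_of (A := ⊤) (B := ⊤) (ψ := (MulAut.conj (⟨s, trivial⟩ : (⊤ : Subgroup S))).toMonoidHom)
      (F.conj_mem _ s (fun x => rfl)) le_top le_top (fun x hx => ?_) (fun x => ?_)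
    · change (s : S) * x * (s : S)⁻¹ = x
      rw [← (Subgroup.mem_centralizer_iff.1 s.2 x hx)]; group
    · exact (congrArg Subtype.val (h x)).symm
  comp_mem := by
    rintro P R T φ φ' ⟨ψ, hψ, h1, h2⟩ ⟨ψ', hψ', h1', h2'⟩
    refine ⟨ψ'.comp ψ, F.comp_mem hψ hψ', fun x hx => ?_, fun x => ?_⟩
    · exact (congrArg (fun z => (ψ' z : S)) (Subtype.ext (h1 x hx))).trans (h1' x hx)
    · exact (congrArg (fun z => (ψ' z : S)) (Subtype.ext (h2 x))).trans (h2' (φ x))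
  symm_mem := by
    rintro P R T φ χ ⟨ψ, hψ, h1, h2⟩ hT hχ
    obtain ⟨ω, hω, hω'⟩ := exists_inverse hψ ((Subgroup.subtype _).comp ψ).range (fun s => Iff.rfl)
    have hinj : ∀ a b, (ψ a : S) = ψ b → a = b := fun a b h => F.injective hψ (Subtype.ext h)
    have hQ : Q ≤ ((Subgroup.subtype _).comp ψ).range := fun x hx => ⟨_, h1 x hx⟩
    have hTS : T.map (Subgroup.subtype _) ≤ ((Subgroup.subtype _).comp ψ).range := by
      rintro _ ⟨x, hx, rfl⟩
      exact ⟨_, (h2 (χ ⟨x, hx⟩)).trans (congrArg Subtype.val (hχ ⟨x, hx⟩))⟩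
    refine isCentralizerMor_of hω hQ hTS (fun x hx => ?_) (fun x => ?_)
    · exact congrArg Subtype.val (hinj _ ⟨x, le_sup_left (a := Q) hx⟩ ((hω' _).trans (h1 x hx).symm))
    · exact congrArg Subtype.val (hinj _ ⟨(χ x : S), le_sup_right (a := Q) ⟨_, (χ x).2, rfl⟩⟩
        ((hω' _).trans (((h2 (χ x)).trans (congrArg Subtype.val (hχ x))).symm)))
end CentralizerSystem

section Functoriality
variable {S T : Type u} [Group S] [Group T]

/-- The homomorphism `θ(P) → θ(Q)` that corresponds to `f : P → Q` under the monomorphism `θ`. -/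
noncomputable def mapHom (θ : S →* T) (hθ : Function.Injective θ) {P Q : Subgroup S}
    (f : P →* Q) : P.map θ →* Q.map θ :=
  (Q.equivMapOfInjective θ hθ).toMonoidHom.comp
    (f.comp (P.equivMapOfInjective θ hθ).symm.toMonoidHom)

theorem mapHom_apply (θ : S →* T) (hθ : Function.Injective θ) {P Q : Subgroup S}
    (f : P →* Q) (x : P) (h : θ x ∈ P.map θ) : (mapHom θ hθ f ⟨θ x, h⟩ : T) = θ (f x) := by
  have : (⟨θ x, h⟩ : P.map θ) = P.equivMapOfInjective θ hθ x := rfl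
  rw [this]
  simp [mapHom]

theorem ext_map {θ : S →* T} {P : Subgroup S} {Q : Subgroup T} {f g : P.map θ →* Q}
    (h : ∀ x : P, f ⟨θ x, ⟨x, x.2, rfl⟩⟩ = g ⟨θ x, ⟨x, x.2, rfl⟩⟩) : f = g := by
  ext ⟨_, x, hx, rfl⟩
  exact congrArg Subtype.val (h ⟨x, hx⟩)

/-- The functor of fusion systems induced by a fusion preserving monomorphism. -/
noncomputable def mapFunctor {F₁ : FusionSystem S} {F₂ : FusionSystem T} (θ : S →* T)
    (hθ : Function.Injective θ)
    (hmor : ∀ (P Q : Subgroup S) (f : P →* Q), f ∈ F₁.Mor P Q →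
      mapHom θ hθ f ∈ F₂.Mor (P.map θ) (Q.map θ)) : F₁.Obj ⥤ F₂.Obj where
  obj P := ⟨P.subgroup.map θ⟩
  map f := ⟨mapHom θ hθ f.1, hmor _ _ _ f.2⟩
  map_id P := Subtype.ext (ext_map fun x => Subtype.ext (mapHom_apply θ hθ _ x _))
  map_comp {P Q R} f g := Subtype.ext (ext_map fun x => Subtype.ext (by
    refine (mapHom_apply θ hθ _ x _).trans ?_
    refine (mapHom_apply θ hθ g.1 (f.1 x) ⟨_, (f.1 x).2, rfl⟩).symm.trans ?_
    exact congrArg (fun z => (mapHom θ hθ g.1 z : T))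
      (Subtype.ext (mapHom_apply θ hθ f.1 x _).symm)))

/-- The functor on centric orbit categories induced by a fusion preserving monomorphism which
preserves centric subgroups. -/
noncomputable def centricFunctor {F₁ : FusionSystem S} {F₂ : FusionSystem T} (θ : S →* T)
    (hθ : Function.Injective θ)
    (hmor : ∀ (P Q : Subgroup S) (f : P →* Q), f ∈ F₁.Mor P Q →
      mapHom θ hθ f ∈ F₂.Mor (P.map θ) (Q.map θ))
    (hcen : ∀ P, F₁.IsCentric P → F₂.IsCentric (P.map θ)) :
    F₁.CentricOrbitCategory ⥤ F₂.CentricOrbitCategory :=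
  F₂.centric.lift (F₁.centric.ι ⋙
    CategoryTheory.Quotient.lift F₁.innRel
      (mapFunctor θ hθ hmor ⋙ CategoryTheory.Quotient.functor F₂.innRel)
      (by
        rintro P Q f g ⟨q, hq⟩
        refine CategoryTheory.Quotient.sound _ ⟨⟨θ q, ⟨q, q.2, rfl⟩⟩, ?_⟩
        rintro ⟨_, x, hx, rfl⟩
        refine Subtype.ext ((mapHom_apply θ hθ g.1 ⟨x, hx⟩ _).trans ?_)
        rw [hq]
        simp only [Subgroup.coe_mul, Subgroup.coe_inv, map_mul, map_inv]
        rw [← mapHom_apply θ hθ f.1 ⟨x, hx⟩ ⟨x, hx, rfl⟩]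
        rfl))
    (fun P => hcen _ P.property)

theorem centricFunctor_map_mk {F₁ : FusionSystem S} {F₂ : FusionSystem T} (θ : S →* T)
    (hθ : Function.Injective θ)
    (hmor : ∀ (P Q : Subgroup S) (f : P →* Q), f ∈ F₁.Mor P Q →
      mapHom θ hθ f ∈ F₂.Mor (P.map θ) (Q.map θ))
    (hcen : ∀ P, F₁.IsCentric P → F₂.IsCentric (P.map θ)) {P Q : F₁.CentricOrbitCategory}
    (f : P.subgroup →* Q.subgroup) (hf : f ∈ F₁.Mor P.subgroup Q.subgroup) :
    (centricFunctor θ hθ hmor hcen).map (CentricOrbitCategory.mk f hf) =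
      CentricOrbitCategory.mk (P := (centricFunctor θ hθ hmor hcen).obj P)
        (Q := (centricFunctor θ hθ hmor hcen).obj Q) (mapHom θ hθ f) (hmor _ _ _ hf) := rfl

end Functoriality

section Centralizer
variable {S : Type u} [Group S] {F : FusionSystem S}

theorem mapHom_subtype_mem {Q : Subgroup S} (P R : Subgroup (Subgroup.centralizer (Q : Set S)))
    (φ : P →* R) (h : φ ∈ (F.centralizer Q).Mor P R) :
    mapHom (Subgroup.subtype _) (Subgroup.subtype_injective _) φ ∈
      F.Mor (P.map (Subgroup.subtype _)) (R.map (Subgroup.subtype _)) := by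
  obtain ⟨ψ, hψ, -, h2⟩ := h
  refine mem_of_agree hψ le_sup_right _ ?_
  rintro ⟨_, x, hx, rfl⟩
  exact (mapHom_apply _ _ φ ⟨x, hx⟩ _).trans (h2 ⟨x, hx⟩).symm

theorem IsConj.symm {P Q : Subgroup S} (h : F.IsConj P Q) : F.IsConj Q P := by
  obtain ⟨φ, hφ, hs⟩ := h
  obtain ⟨ψ, hψ, h⟩ := exists_inverse hφ Q (fun s =>
    ⟨fun hs' => (hs ⟨s, hs'⟩).imp fun x hx => congrArg Subtype.val hx,
      by rintro ⟨x, rfl⟩; exact (φ x).2⟩)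
  exact ⟨ψ, hψ, fun x => ⟨φ x, F.injective hφ (Subtype.ext (h _))⟩⟩

theorem IsConj.trans {P Q R : Subgroup S} (h : F.IsConj P Q) (h' : F.IsConj Q R) :
    F.IsConj P R := by
  obtain ⟨φ, hφ, hs⟩ := h
  obtain ⟨ψ, hψ, hs'⟩ := h'
  exact ⟨ψ.comp φ, F.comp_mem hφ hψ, hs'.comp hs⟩

theorem IsCentric.of_isConj {P Q : Subgroup S} (hP : F.IsCentric P) (h : F.IsConj P Q) :
    F.IsCentric Q := fun _ hR => hP _ (h.trans hR)

theorem isConj_map {P A B : Subgroup S} {φ : A →* B} (hφ : φ ∈ F.Mor A B) (hP : P ≤ A)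
    (P' : Subgroup S) (hP' : ∀ s, s ∈ P' ↔ ∃ x : P, (φ ⟨x, hP x.2⟩ : S) = s) : F.IsConj P P' := by
  refine ⟨restrictHom φ P P' hP (fun a ha => (hP' _).2 ⟨⟨a, ha⟩, rfl⟩),
    mem_of_agree hφ hP _ (fun _ => rfl), ?_⟩
  rintro ⟨s, hs⟩
  obtain ⟨x, rfl⟩ := (hP' _).1 hs
  exact ⟨x, rfl⟩

/-- An isomorphism `β : A → E` in `F`, with `E` abelian and fully centralized, extends to
`C_S(A) → C_S(E)`. -/
theorem exists_extension {p : ℕ} (hF : F.IsSaturated p) {A E : Subgroup S}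
    (hE : F.FullyCentralized E) (hab : E ≤ Subgroup.centralizer (E : Set S)) {β : A →* E}
    (hβ : β ∈ F.Mor A E) (hs : Function.Surjective β) :
    ∃ ψ ∈ F.Mor (Subgroup.centralizer (A : Set S)) (Subgroup.centralizer (E : Set S)),
      ∀ (a : A) (h : (a : S) ∈ Subgroup.centralizer (A : Set S)), (ψ ⟨a, h⟩ : S) = β a := by
  obtain ⟨ψ, hψ, h⟩ := hF.receptive_of_fullyCentralized E hE A β hβ hs
  have hle : Subgroup.centralizer (A : Set S) ≤ extensionDomain β := by
    intro x hx
    refine ⟨Subgroup.centralizer_le_normalizer _ hx, 1, one_mem _, fun g => ?_⟩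
    have : A.normalizerMonoidHom ⟨x, Subgroup.centralizer_le_normalizer _ hx⟩ g = g := by
      apply Subtype.ext
      change x * g * x⁻¹ = g
      rw [← Subgroup.mem_centralizer_iff.1 hx g g.2]; group
    rw [this]; simp
  have habA : A ≤ Subgroup.centralizer (A : Set S) := by
    intro x hx
    refine Subgroup.mem_centralizer_iff.2 fun y hy => ?_
    have := Subgroup.mem_centralizer_iff.1 (hab (β ⟨x, hx⟩).2) _ (β ⟨y, hy⟩).2
    have h1 : β (⟨y, hy⟩ * ⟨x, hx⟩) = β (⟨x, hx⟩ * ⟨y, hy⟩) := by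
      rw [map_mul, map_mul]; exact Subtype.ext this
    exact congrArg Subtype.val (F.injective hβ h1)
  refine ⟨restrictHom ψ _ _ hle (fun x hx => ?_), mem_of_agree hψ hle _ (fun _ => rfl),
    fun a ha => h a (hle ha)⟩
  refine Subgroup.mem_centralizer_iff.2 fun e he => ?_
  obtain ⟨a, ha⟩ := hs ⟨e, he⟩
  have h1 : (ψ ⟨a, hle (habA a.2)⟩ : S) = e := (h a _).trans (congrArg Subtype.val ha)
  rw [← h1, ← Subgroup.coe_mul, ← Subgroup.coe_mul, ← map_mul, ← map_mul]
  exact congrArg (fun z => (ψ z : S))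
    (Subtype.ext (Subgroup.mem_centralizer_iff.1 hx a a.2))

theorem le_of_isCentric {E : Subgroup S} (hab : E ≤ Subgroup.centralizer (E : Set S))
    {P : Subgroup (Subgroup.centralizer (E : Set S))} (hP : (F.centralizer E).IsCentric P) :
    E ≤ P.map (Subgroup.subtype _) := by
  intro e he
  refine ⟨⟨e, hab he⟩, hP P ⟨MonoidHom.id _, FusionSystem.conj_mem _ _ 1 (by simp),
    Function.surjective_id⟩ (Subgroup.mem_centralizer_iff.2 fun x _ => ?_), rfl⟩
  exact Subtype.ext (Subgroup.mem_centralizer_iff.1 x.2 e he).symm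

/-- If `E` is abelian and fully centralized, then `C_F(E)`-centric subgroups are `F`-centric. -/
theorem isCentric_map_subtype {p : ℕ} (hF : F.IsSaturated p) {E : Subgroup S}
    (hE : F.FullyCentralized E) (hab : E ≤ Subgroup.centralizer (E : Set S))
    {P : Subgroup (Subgroup.centralizer (E : Set S))} (hP : (F.centralizer E).IsCentric P) :
    F.IsCentric (P.map (Subgroup.subtype _)) := by
  rintro P' ⟨φ, hφ, hs⟩
  have hEP := le_of_isCentric hab hP
  let A : Subgroup S := (P'.subtype.comp (φ.comp (Subgroup.inclusion hEP))).range
  obtain ⟨β, hβ, hβ'⟩ := exists_inverse (F.comp_mem (F.conj_mem (Subgroup.inclusion hEP) 1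
    (by simp)) hφ) A (fun s => Iff.rfl)
  have hφE : ∀ e : E, ∃ h : (φ ⟨e, hEP e.2⟩ : S) ∈ A, β ⟨_, h⟩ = e := fun e => by
    have h : (φ ⟨e, hEP e.2⟩ : S) ∈ A := ⟨e, rfl⟩
    refine ⟨h, ?_⟩
    have := hβ' ⟨_, h⟩
    have h2 := F.injective hφ (Subtype.ext this)
    exact Subtype.ext (Subtype.mk.inj h2)
  obtain ⟨ψ, hψ, hψ'⟩ := exists_extension hF hE hab hβ (fun e => ⟨_, (hφE e).2⟩)
  have hP'A : P' ≤ Subgroup.centralizer (A : Set S) := by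
    intro x hx
    obtain ⟨⟨_, y, hy, rfl⟩, hy'⟩ := hs ⟨x, hx⟩
    refine Subgroup.mem_centralizer_iff.2 ?_
    rintro _ ⟨e, rfl⟩
    have hx' : x = φ ⟨_, ⟨y, hy, rfl⟩⟩ := (congrArg Subtype.val hy').symm
    rw [hx']
    change (φ _ : S) * φ _ = φ _ * φ _
    rw [← Subgroup.coe_mul, ← Subgroup.coe_mul, ← map_mul, ← map_mul]
    exact congrArg (fun z => (φ z : S))
      (Subtype.ext (Subgroup.mem_centralizer_iff.1 y.2 e e.2))
  have hAP' : A ≤ P' := by rintro _ ⟨e, rfl⟩; exact (φ _).2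
  let P'' : Subgroup (Subgroup.centralizer (E : Set S)) :=
    (ψ.comp (Subgroup.inclusion hP'A)).range
  let χ : P →* P'' := (ψ.comp (Subgroup.inclusion hP'A)).rangeRestrict.comp
    (φ.comp (P.equivMapOfInjective _ (Subgroup.subtype_injective _)).toMonoidHom)
  have hχ : χ ∈ (F.centralizer E).Mor P P'' := by
    have hcomp := F.comp_mem hφ (F.comp_mem (F.conj_mem (Subgroup.inclusion hP'A) 1 (by simp)) hψ)
    refine isCentralizerMor_of hcomp hEP le_rfl (fun e he => ?_) (fun x => rfl)
    obtain ⟨h, h'⟩ := hφE ⟨e, he⟩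
    exact (hψ' ⟨_, h⟩ (hP'A (hAP' h))).trans (congrArg Subtype.val h')
  have hχs : Function.Surjective χ := (MonoidHom.rangeRestrict_surjective _).comp
    (hs.comp (P.equivMapOfInjective _ (Subgroup.subtype_injective _)).surjective)
  have hc := hP P'' ⟨χ, hχ, hχs⟩
  intro x hx
  have hxA : x ∈ Subgroup.centralizer (A : Set S) := Subgroup.centralizer_le hAP' hx
  have hmem : ψ ⟨x, hxA⟩ ∈ P'' := by
    refine hc (Subgroup.mem_centralizer_iff.2 ?_)
    rintro _ ⟨y, rfl⟩
    change ψ _ * ψ _ = ψ _ * ψ _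
    rw [← map_mul, ← map_mul]
    exact congrArg ψ (Subtype.ext (Subgroup.mem_centralizer_iff.1 hx y y.2))
  obtain ⟨y, hy⟩ := hmem
  have := congrArg Subtype.val (F.injective hψ hy)
  change (y : S) = x at this
  exact this ▸ y.2

theorem isCentric_of_map_subtype {E : Subgroup S}
    {P : Subgroup (Subgroup.centralizer (E : Set S))}
    (hP : F.IsCentric (P.map (Subgroup.subtype _))) : (F.centralizer E).IsCentric P := by
  rintro Q ⟨φ, hφ, hs⟩ x hx
  have h1 : F.IsConj (P.map (Subgroup.subtype _)) (Q.map (Subgroup.subtype _)) := by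
    refine ⟨_, mapHom_subtype_mem P Q φ hφ, ?_⟩
    exact (Q.equivMapOfInjective _ (Subgroup.subtype_injective _)).surjective.comp
      (hs.comp (P.equivMapOfInjective _ (Subgroup.subtype_injective _)).symm.surjective)
  obtain ⟨y, hy, hxy⟩ := hP _ h1 (show (x : S) ∈ _ from Subgroup.mem_centralizer_iff.2 (by
    rintro _ ⟨y, hy, rfl⟩
    exact congrArg Subtype.val (Subgroup.mem_centralizer_iff.1 hx y hy)))
  exact (Subtype.ext hxy : y = x) ▸ hy

end Centralizer

section Transport
variable {S : Type u} [Group S]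

/-- Elementary abelian `p`-subgroups (the trivial subgroup included). -/
def IsElementaryAbelian (p : ℕ) (E : Subgroup S) : Prop :=
  (∀ x ∈ E, ∀ y ∈ E, x * y = y * x) ∧ ∀ x ∈ E, x ^ p = 1

theorem IsElementaryAbelian.le_centralizer {p : ℕ} {E : Subgroup S}
    (h : IsElementaryAbelian p E) : E ≤ Subgroup.centralizer (E : Set S) :=
  fun x hx => Subgroup.mem_centralizer_iff.2 fun y hy => h.1 y hy x hx

/-- The nontrivial elementary abelian `p`-subgroups which are fully centralized in `F`. -/
def elementaryAbelian (F : FusionSystem S) (p : ℕ) : ObjectProperty F.Obj := fun E =>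
  E.subgroup ≠ ⊥ ∧ IsElementaryAbelian p E.subgroup ∧ F.FullyCentralized E.subgroup

/-- The category `F^e`: the full subcategory of `F` on the nontrivial, fully centralized, elementary
abelian `p`-subgroups of `S`. -/
abbrev ElementaryAbelianCategory (F : FusionSystem S) (p : ℕ) : Type u :=
  (F.elementaryAbelian p).FullSubcategory

variable {F : FusionSystem S} {p : ℕ}

/-- The subgroup underlying an object of `F^e`. -/
abbrev ElementaryAbelianCategory.subgroup (E : F.ElementaryAbelianCategory p) : Subgroup S :=
  E.obj.subgroup

theorem ElementaryAbelianCategory.le_centralizer (E : F.ElementaryAbelianCategory p) :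
    E.subgroup ≤ Subgroup.centralizer (E.subgroup : Set S) := E.property.2.1.le_centralizer

/-- The centric orbit category `O^c(C_F(E))`. -/
abbrev CentralizerOrbit (E : F.ElementaryAbelianCategory p) : Type u :=
  (F.centralizer E.subgroup).CentricOrbitCategory

/-- The inclusion `O^c(C_F(E)) ⥤ O^c(F)` for `E` in `F^e`; it sends `P ≤ C_S(E)` to `P`. -/
noncomputable def centralizerInclusion (hF : F.IsSaturated p) (E : F.ElementaryAbelianCategory p) :
    CentralizerOrbit E ⥤ F.CentricOrbitCategory :=
  centricFunctor (Subgroup.subtype _) (Subgroup.subtype_injective _) mapHom_subtype_mem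
    (fun _ hP => isCentric_map_subtype hF E.property.2.2 E.le_centralizer hP)

instance (hF : F.IsSaturated p) (E : F.ElementaryAbelianCategory p) :
    (centralizerInclusion hF E).Faithful where
  map_injective {P Q} f g h := by
    obtain ⟨φ, hφ, rfl⟩ := CentricOrbitCategory.exists_rep f
    obtain ⟨ψ, hψ, rfl⟩ := CentricOrbitCategory.exists_rep g
    obtain ⟨⟨_, q, hq, rfl⟩, h'⟩ := (CentricOrbitCategory.mk_eq_iff
      (P := (centralizerInclusion hF E).obj P) (Q := (centralizerInclusion hF E).obj Q)
      (mapHom_subtype_mem _ _ φ hφ) (mapHom_subtype_mem _ _ ψ hψ)).1 h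
    refine (CentricOrbitCategory.mk_eq_iff hφ hψ).2 ⟨⟨q, hq⟩, fun x => ?_⟩
    have h1 := congrArg Subtype.val (h' ⟨_, ⟨x, x.2, rfl⟩⟩)
    refine Subtype.ext (Subtype.ext ?_)
    refine (mapHom_apply (Subgroup.subtype _) (Subgroup.subtype_injective _) ψ x
      ⟨x, x.2, rfl⟩).symm.trans (h1.trans ?_)
    exact congrArg (fun z => (q : S) * z * (q : S)⁻¹)
      (mapHom_apply (Subgroup.subtype _) (Subgroup.subtype_injective _) φ x ⟨x, x.2, rfl⟩)

theorem exists_lift (hF : F.IsSaturated p) {E : F.ElementaryAbelianCategory p}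
    {P Q : CentralizerOrbit E}
    (g : P.subgroup.map (Subgroup.subtype _) →* Q.subgroup.map (Subgroup.subtype _))
    (hg : g ∈ F.Mor _ _)
    (h : ∀ (e : E.subgroup) (he : (e : S) ∈ P.subgroup.map (Subgroup.subtype _)),
      (g ⟨e, he⟩ : S) = e) :
    ∃ f : P ⟶ Q, (centralizerInclusion hF E).map f =
      CentricOrbitCategory.mk (P := (centralizerInclusion hF E).obj P)
        (Q := (centralizerInclusion hF E).obj Q) g hg := by
  let P' := P.subgroup.equivMapOfInjective _ (Subgroup.subtype_injective
    (Subgroup.centralizer (E.subgroup : Set S)))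
  let Q' := Q.subgroup.equivMapOfInjective _ (Subgroup.subtype_injective
    (Subgroup.centralizer (E.subgroup : Set S)))
  let f : P.subgroup →* Q.subgroup := Q'.symm.toMonoidHom.comp (g.comp P'.toMonoidHom)
  have hf' : ∀ x, Q' (f x) = g (P' x) := fun x => Q'.apply_symm_apply _
  have hf : f ∈ (F.centralizer E.subgroup).Mor _ _ := by
    refine isCentralizerMor_of hg (le_of_isCentric E.le_centralizer P.property) le_rfl
      (fun x hx => h ⟨x, hx⟩ _) (fun x => ?_)
    exact (congrArg Subtype.val (hf' x)).symm
  refine ⟨CentricOrbitCategory.mk f hf, ?_⟩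
  have : mapHom (Subgroup.subtype _) (Subgroup.subtype_injective _) f = g := by
    apply ext_map
    intro x
    exact Subtype.ext ((mapHom_apply _ _ f x _).trans (congrArg Subtype.val (hf' x)))
  have key : ∀ g' (hg' : g' ∈ F.Mor _ _),
      mapHom (Subgroup.subtype _) (Subgroup.subtype_injective _) f = g' →
      (centralizerInclusion hF E).map (CentricOrbitCategory.mk f hf) =
        CentricOrbitCategory.mk (P := (centralizerInclusion hF E).obj P)
          (Q := (centralizerInclusion hF E).obj Q) g' hg' := by
    rintro _ _ rfl
    rfl
  exact key g hg this

theorem CentricOrbitCategory.isIso_mk {P Q : F.CentricOrbitCategory}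
    (φ : P.subgroup →* Q.subgroup) (hφ : φ ∈ F.Mor P.subgroup Q.subgroup)
    (hs : Function.Surjective φ) : IsIso (mk φ hφ) := by
  obtain ⟨ψ, hψ, h⟩ := exists_inverse hφ Q.subgroup (fun s =>
    ⟨fun hs' => (hs ⟨s, hs'⟩).imp fun x hx => congrArg Subtype.val hx,
      by rintro ⟨x, rfl⟩; exact (φ x).2⟩)
  refine ⟨mk ψ hψ, ?_, ?_⟩
  · rw [mk_comp_mk, ← mk_id P (F.conj_mem _ 1 (by simp))]
    congr 1
    ext x
    exact congrArg Subtype.val (F.injective hφ (Subtype.ext (h (φ x))))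
  · rw [mk_comp_mk, ← mk_id Q (F.conj_mem _ 1 (by simp))]
    congr 1
    ext x
    exact h x

/-- For `φ : E → E'` in `F^e`, a functor `O^c(C_F(E')) ⥤ O^c(C_F(E))` that sends each `P` to an
`F`-conjugate of `P` by an isomorphism, natural in `P` as a morphism of `O^c(F)`, which extends
`φ⁻¹ : φ(E) → E`. (If `F` is given by conjugation in a group and `φ` by conjugation with `g`, then
conjugation with `g⁻¹` is such a functor.) -/
structure Transport (hF : F.IsSaturated p) {E E' : F.ElementaryAbelianCategory p}
    (φ : E ⟶ E') where
  functor : CentralizerOrbit E' ⥤ CentralizerOrbit E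
  comparison : centralizerInclusion hF E' ⟶ functor ⋙ centralizerInclusion hF E
  spec (P : CentralizerOrbit E') :
    ∃ (g : ((centralizerInclusion hF E').obj P).subgroup →*
        ((centralizerInclusion hF E).obj (functor.obj P)).subgroup) (hg : g ∈ F.Mor _ _),
      comparison.app P = CentricOrbitCategory.mk g hg ∧ Function.Surjective g ∧
      ∀ (e : E.subgroup) (he : (φ.hom.1 e : S) ∈ ((centralizerInclusion hF E').obj P).subgroup),
        (g ⟨φ.hom.1 e, he⟩ : S) = e

namespace Transport
variable {hF : F.IsSaturated p} {E E' E'' : F.ElementaryAbelianCategory p}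

/-- The identity functor is a transport for the identity. -/
noncomputable def id (hF : F.IsSaturated p) (E : F.ElementaryAbelianCategory p) : Transport hF (𝟙 E) where
  functor := 𝟭 _
  comparison := { app := fun P => 𝟙 _ }
  spec P := ⟨MonoidHom.id _, F.conj_mem _ 1 (by simp), rfl, Function.surjective_id,
    fun _ _ => rfl⟩

theorem mem_inclusion (hF : F.IsSaturated p) (E : F.ElementaryAbelianCategory p)
    (P : CentralizerOrbit E) (e : E.subgroup) :
    (e : S) ∈ ((centralizerInclusion hF E).obj P).subgroup :=
  le_of_isCentric E.le_centralizer P.property e.2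

/-- Transports can be composed. -/
noncomputable def comp {φ : E ⟶ E'} {φ' : E' ⟶ E''} (T : Transport hF φ) (T' : Transport hF φ') :
    Transport hF (φ ≫ φ') where
  functor := T'.functor ⋙ T.functor
  comparison := T'.comparison ≫ Functor.whiskerLeft T'.functor T.comparison
  spec P := by
    obtain ⟨g', hg', h1', h2', h3'⟩ := T'.spec P
    obtain ⟨g, hg, h1, h2, h3⟩ := T.spec (T'.functor.obj P)
    refine ⟨g.comp g', F.comp_mem hg' hg, ?_, h2.comp h2', fun e he => ?_⟩
    · have : (T'.comparison ≫ Functor.whiskerLeft T'.functor T.comparison).app P =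
        T'.comparison.app P ≫ T.comparison.app (T'.functor.obj P) := rfl
      rw [this, h1, h1']
      rfl
    · have h4 := h3' (φ.hom.1 e) he
      refine Eq.trans ?_ (h3 e (mem_inclusion hF E' _ _))
      exact congrArg (fun z => (g z : S)) (Subtype.ext h4)

instance {φ : E ⟶ E'} (T : Transport hF φ) (P : CentralizerOrbit E') :
    IsIso (T.comparison.app P) := by
  obtain ⟨g, hg, h1, h2, -⟩ := T.spec P
  rw [h1]
  exact CentricOrbitCategory.isIso_mk g hg h2

theorem exists_natTrans {φ : E ⟶ E'} (T T' : Transport hF φ) :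
    ∃ θ : T.functor ⟶ T'.functor, ∀ P,
      T.comparison.app P ≫ (centralizerInclusion hF E).map (θ.app P) = T'.comparison.app P := by
  have key : ∀ P, ∃ f : T.functor.obj P ⟶ T'.functor.obj P,
      T.comparison.app P ≫ (centralizerInclusion hF E).map f = T'.comparison.app P := by
    intro P
    obtain ⟨g, hg, h1, h2, h3⟩ := T.spec P
    obtain ⟨g', hg', h1', h2', h3'⟩ := T'.spec P
    obtain ⟨k, hk, h⟩ := exists_inverse hg _ (fun s =>
      ⟨fun hs' => (h2 ⟨s, hs'⟩).imp fun x hx => congrArg Subtype.val hx,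
        by rintro ⟨x, rfl⟩; exact (g x).2⟩)
    have hk2 : ∀ x, k (g x) = x := fun x => F.injective hg (Subtype.ext (h _))
    obtain ⟨f, hf⟩ := exists_lift hF (P := T.functor.obj P) (Q := T'.functor.obj P)
      (g'.comp k) (F.comp_mem hk hg') (fun e he => by
        have hm := mem_inclusion hF E' P (φ.hom.1 e)
        have h4 : (⟨e, he⟩ : (T.functor.obj P).subgroup.map (Subgroup.subtype _)) =
          g ⟨_, hm⟩ := Subtype.ext (h3 e hm).symm
        rw [h4]
        refine Eq.trans ?_ (h3' e hm)
        exact congrArg (fun z => (g' z : S)) (hk2 _))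
    refine ⟨f, ?_⟩
    rw [hf, h1, h1']
    refine (CentricOrbitCategory.mk_comp_mk hg (F.comp_mem hk hg')).trans ?_
    congr 1
    ext x
    exact congrArg (fun z => (g' z : S)) (hk2 x)
  choose f hf using key
  refine ⟨{ app := f, naturality := fun P Q a => ?_ }, hf⟩
  apply (centralizerInclusion hF E).map_injective
  rw [← cancel_epi (T.comparison.app P), Functor.map_comp, Functor.map_comp]
  have h1 := T.comparison.naturality a
  have h2 := T'.comparison.naturality a
  dsimp only [Functor.comp_map, Functor.comp_obj] at h1 h2
  rw [← Category.assoc, ← h1, Category.assoc, hf, h2, ← Category.assoc, hf]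

variable {R : Type u} [CommRing R]

/-- The map `H^n(O^c(C_F(E)); M) ⟶ H^n(O^c(C_F(E')); M)` induced by a transport for `φ : E → E'`. -/
noncomputable def cohomologyMap {φ : E ⟶ E'} (T : Transport hF φ)
    (M : F.CentricOrbitCategoryᵒᵖ ⥤ ModuleCat.{u} R) (n : ℕ) :
    catCohomology ((centralizerInclusion hF E).op ⋙ M) n ⟶
      catCohomology ((centralizerInclusion hF E').op ⋙ M) n :=
  _root_.cohomologyMap T.functor (Functor.whiskerRight (NatTrans.op T.comparison) M) n

/-- The map induced on cohomology depends on `φ` only. -/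
theorem cohomologyMap_eq {φ : E ⟶ E'} (T T' : Transport hF φ)
    (M : F.CentricOrbitCategoryᵒᵖ ⥤ ModuleCat.{u} R) (n : ℕ) :
    T.cohomologyMap M n = T'.cohomologyMap M n := by
  obtain ⟨θ, hθ⟩ := exists_natTrans T T'
  refine cohomologyMap_natTrans θ _ _ (fun P => ?_) n
  refine (M.map_comp _ _).symm.trans ?_
  change M.map (T.comparison.app P ≫ (centralizerInclusion hF E).map (θ.app P)).op =
    M.map (T'.comparison.app P).op
  rw [hθ]

theorem cohomologyMap_id_eq (M : F.CentricOrbitCategoryᵒᵖ ⥤ ModuleCat.{u} R) (n : ℕ) :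
    (Transport.id hF E).cohomologyMap M n = 𝟙 _ :=
  _root_.cohomologyMap_id _ (fun _ => M.map_id _) n

theorem cohomologyMap_comp_eq {φ : E ⟶ E'} {φ' : E' ⟶ E''} (T : Transport hF φ)
    (T' : Transport hF φ') (M : F.CentricOrbitCategoryᵒᵖ ⥤ ModuleCat.{u} R) (n : ℕ) :
    (T.comp T').cohomologyMap M n = T.cohomologyMap M n ≫ T'.cohomologyMap M n :=
  _root_.cohomologyMap_comp _ _ _ _ _ (fun _ => M.map_comp _ _) n

/-- Every `φ : E → E'` has a transport: `φ⁻¹ : φ(E) → E` extends to `C_S(E') → C_S(E)`. -/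
theorem nonempty (hF : F.IsSaturated p) (φ : E ⟶ E') : Nonempty (Transport hF φ) := by
  let A : Subgroup S := (E'.subgroup.subtype.comp φ.hom.1).range
  obtain ⟨β, hβ, hβ'⟩ := exists_inverse φ.hom.2 A (fun s => Iff.rfl)
  have hβφ : ∀ e (h : (φ.hom.1 e : S) ∈ A), β ⟨_, h⟩ = e := fun e h =>
    F.injective φ.hom.2 (Subtype.ext (hβ' _))
  have hmA : ∀ e, (φ.hom.1 e : S) ∈ A := fun e => ⟨e, rfl⟩
  obtain ⟨ψ₀, hψ₀, hψ₀'⟩ := exists_extension hF E.property.2.2 E.le_centralizer hβ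
    (fun e => ⟨_, hβφ e (hmA e)⟩)
  have hAE : A ≤ E'.subgroup := by rintro _ ⟨e, rfl⟩; exact (φ.hom.1 e).2
  have hle : Subgroup.centralizer (E'.subgroup : Set S) ≤ Subgroup.centralizer (A : Set S) :=
    Subgroup.centralizer_le hAE
  let ψ := ψ₀.comp (Subgroup.inclusion hle)
  have hψ : ψ ∈ F.Mor _ _ := F.comp_mem (F.conj_mem (Subgroup.inclusion hle) 1 (by simp)) hψ₀
  have hψφ : ∀ (e : E.subgroup) (h : (φ.hom.1 e : S) ∈ _), (ψ ⟨φ.hom.1 e, h⟩ : S) = e :=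
    fun e h => (hψ₀' ⟨_, hmA e⟩ (hle h)).trans (congrArg Subtype.val (hβφ e _))
  have hinj : Function.Injective ψ := F.injective hψ
  let res (P : Subgroup (Subgroup.centralizer (E'.subgroup : Set S))) :
      P.map (Subgroup.subtype _) →* (P.map ψ).map (Subgroup.subtype _) :=
    restrictHom ψ _ _ (map_subtype_le _ P) (by
      rintro _ ⟨x, hx, rfl⟩; exact ⟨_, ⟨x, hx, rfl⟩, rfl⟩)
  have hres : ∀ P, res P ∈ F.Mor _ _ := fun P => mem_of_agree hψ (map_subtype_le _ P) _ (fun _ => rfl)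
  have hress : ∀ P, Function.Surjective (res P) := by
    rintro P ⟨_, _, ⟨x, hx, rfl⟩, rfl⟩
    exact ⟨⟨_, ⟨x, hx, rfl⟩⟩, rfl⟩
  have hcen : ∀ P, (F.centralizer E'.subgroup).IsCentric P →
      (F.centralizer E.subgroup).IsCentric (P.map ψ) := fun P hP =>
    isCentric_of_map_subtype ((isCentric_map_subtype hF E'.property.2.2 E'.le_centralizer
      hP).of_isConj ⟨_, hres P, hress P⟩)
  have hmor : ∀ (P Q : Subgroup (Subgroup.centralizer (E'.subgroup : Set S))) (f : P →* Q),
      f ∈ (F.centralizer E'.subgroup).Mor P Q →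
      mapHom ψ hinj f ∈ (F.centralizer E.subgroup).Mor (P.map ψ) (Q.map ψ) := by
    rintro P Q f ⟨k, hk, hk1, hk2⟩
    have hleP : E'.subgroup ⊔ P.map (Subgroup.subtype _) ≤ Subgroup.centralizer E'.subgroup :=
      sup_le E'.le_centralizer (map_subtype_le _ _)
    have hleQ : E'.subgroup ⊔ Q.map (Subgroup.subtype _) ≤ Subgroup.centralizer E'.subgroup :=
      sup_le E'.le_centralizer (map_subtype_le _ _)
    have hi : ψ.comp (Subgroup.inclusion hleP) ∈ F.Mor _ _ :=
      F.comp_mem (F.conj_mem (Subgroup.inclusion hleP) 1 (by simp)) hψ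
    have hj : ψ.comp (Subgroup.inclusion hleQ) ∈ F.Mor _ _ :=
      F.comp_mem (F.conj_mem (Subgroup.inclusion hleQ) 1 (by simp)) hψ
    obtain ⟨ω, hω, hω'⟩ := exists_inverse hi
      ((Subgroup.subtype _).comp (ψ.comp (Subgroup.inclusion hleP))).range (fun s => Iff.rfl)
    have hω2 : ∀ x h, ω ⟨(ψ (Subgroup.inclusion hleP x) : S), h⟩ = x := fun x h =>
      F.injective hi (Subtype.ext (hω' _))
    have hEφ : ∀ e : E.subgroup, (ψ (Subgroup.inclusion hleP ⟨φ.hom.1 e,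
        le_sup_left (a := E'.subgroup) (φ.hom.1 e).2⟩) : S) = e := fun e => hψφ e _
    have hE : E.subgroup ≤
        ((Subgroup.subtype _).comp (ψ.comp (Subgroup.inclusion hleP))).range := fun e he =>
      ⟨_, hEφ ⟨e, he⟩⟩
    have hP : (P.map ψ).map (Subgroup.subtype _) ≤
        ((Subgroup.subtype _).comp (ψ.comp (Subgroup.inclusion hleP))).range := by
      rintro _ ⟨_, ⟨x, hx, rfl⟩, rfl⟩
      exact ⟨⟨x, le_sup_right (a := E'.subgroup) ⟨x, hx, rfl⟩⟩, rfl⟩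
    refine isCentralizerMor_of (F.comp_mem (F.comp_mem hω hk) hj) hE hP (fun e he => ?_) ?_
    · have h1 : (⟨e, hE he⟩ : ((Subgroup.subtype _).comp
          (ψ.comp (Subgroup.inclusion hleP))).range) = ⟨_, ⟨_, rfl⟩⟩ :=
        Subtype.ext (hEφ ⟨e, he⟩).symm
      have h2 := (congrArg ω h1).trans (hω2 _ _)
      change (ψ (Subgroup.inclusion hleQ (k (ω ⟨e, hE he⟩))) : S) = e
      rw [h2]
      refine Eq.trans ?_ (hψφ ⟨e, he⟩ (hleP (le_sup_left (a := E'.subgroup) (φ.hom.1 ⟨e, he⟩).2)))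
      exact congrArg (fun z => (ψ z : S)) (Subtype.ext (hk1 _ (φ.hom.1 ⟨e, he⟩).2))
    · rintro ⟨_, x, hx, rfl⟩
      have h2 := hω2 ⟨x, le_sup_right (a := E'.subgroup) ⟨x, hx, rfl⟩⟩ ⟨_, rfl⟩
      change (ψ (Subgroup.inclusion hleQ (k (ω ⟨(ψ x : S), _⟩))) : S) = _
      have h3 : ω ⟨(ψ x : S), hP ⟨_, ⟨x, hx, rfl⟩, rfl⟩⟩ =
        ⟨x, le_sup_right (a := E'.subgroup) ⟨x, hx, rfl⟩⟩ := h2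
      rw [h3]
      refine Eq.trans ?_ (congrArg Subtype.val
        (mapHom_apply ψ hinj f ⟨x, hx⟩ ⟨x, hx, rfl⟩)).symm
      exact congrArg (fun z => (ψ z : S)) (Subtype.ext (hk2 ⟨x, hx⟩))
  refine ⟨⟨centricFunctor ψ hinj hmor hcen,
    { app := fun P => CentricOrbitCategory.mk (P := (centralizerInclusion hF E').obj P)
        (Q := (centralizerInclusion hF E).obj ((centricFunctor ψ hinj hmor hcen).obj P))
        (res P.subgroup) (hres P.subgroup)
      naturality := fun P Q f => ?_ }, fun P => ?_⟩⟩
  · obtain ⟨f, hf, rfl⟩ := CentricOrbitCategory.exists_rep f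
    refine (CentricOrbitCategory.mk_comp_mk (P := (centralizerInclusion hF E').obj P)
      (Q := (centralizerInclusion hF E').obj Q)
      (R := (centralizerInclusion hF E).obj ((centricFunctor ψ hinj hmor hcen).obj Q))
      (mapHom_subtype_mem _ _ f hf) (hres Q.subgroup)).trans ?_
    refine Eq.trans ?_ (CentricOrbitCategory.mk_comp_mk (P := (centralizerInclusion hF E').obj P)
      (Q := (centralizerInclusion hF E).obj ((centricFunctor ψ hinj hmor hcen).obj P))
      (R := (centralizerInclusion hF E).obj ((centricFunctor ψ hinj hmor hcen).obj Q))
      (hres P.subgroup) (mapHom_subtype_mem _ _ _ (hmor _ _ f hf))).symm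
    congr 1
    apply ext_map
    intro x
    apply Subtype.ext
    have h1 := mapHom_apply (Subgroup.subtype _) (Subgroup.subtype_injective _)
      (mapHom ψ hinj f) ⟨ψ x, ⟨x, x.2, rfl⟩⟩ ⟨_, ⟨x, x.2, rfl⟩, rfl⟩
    refine Eq.trans ?_ h1.symm
    refine Eq.trans ?_ (congrArg Subtype.val (mapHom_apply ψ hinj f x ⟨x, x.2, rfl⟩)).symm
    exact congrArg (fun z => (ψ z : S)) (Subtype.ext (mapHom_apply _ _ f x _))
  · exact ⟨res P.subgroup, hres P.subgroup, rfl, hress _, fun e he => hψφ e _⟩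

end Transport

/-- The functor `E ↦ H^n(O^c(C_F(E)); M)` on `F^e`, with the induced maps. -/
noncomputable def centralizerCohomology {R : Type u} [CommRing R] (hF : F.IsSaturated p)
    (M : F.CentricOrbitCategoryᵒᵖ ⥤ ModuleCat.{u} R) (n : ℕ) :
    F.ElementaryAbelianCategory p ⥤ ModuleCat.{u} R where
  obj E := catCohomology ((centralizerInclusion hF E).op ⋙ M) n
  map φ := (Transport.nonempty hF φ).some.cohomologyMap M n
  map_id E := (Transport.cohomologyMap_eq _ (Transport.id hF E) M n).trans
    (Transport.cohomologyMap_id_eq M n)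
  map_comp φ φ' := (Transport.cohomologyMap_eq _ ((Transport.nonempty hF φ).some.comp
    (Transport.nonempty hF φ').some) M n).trans (Transport.cohomologyMap_comp_eq _ _ M n)

/-- The induced maps of `centralizerCohomology` can be computed with any transport. -/
theorem centralizerCohomology_map {R : Type u} [CommRing R] (hF : F.IsSaturated p)
    (M : F.CentricOrbitCategoryᵒᵖ ⥤ ModuleCat.{u} R) (n : ℕ)
    {E E' : F.ElementaryAbelianCategory p} (φ : E ⟶ E') (T : Transport hF φ) :
    (centralizerCohomology hF M n).map φ = T.cohomologyMap M n :=
  Transport.cohomologyMap_eq _ T M n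

end Transport
end FusionSystem

/-! Write `C = O^c(F)` and `J = F^e`. The proof is a Grothendieck spectral sequence for a functor `ζ
: Cᵒᵖ ⥤ J`, which sends a centric subgroup `P` to the group of elements of `Z(P)` killed by `p`,
replaced by a fully centralized `F`-conjugate (`centralFunctor`). It is contravariant: if `φ : P →
Q` is a morphism, `Z(Q)` centralizes the centric subgroup `φ(P)`, hence lies in it, and `φ⁻¹`
carries it into `Z(P)`. It factors through the orbit category because inner automorphisms of `Q` fix
`Z(Q)`. Its values are nontrivial because `S` is a nontrivial `p`-group.

Let `I` be an injective resolution of `M`. The right Kan extension along `ζ` is right adjoint to an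
exact restriction functor, so `Ran I` is a complex of injectives, and `Hom(R, Ran I) = Hom(R, I)`
computes `H^*(C; M)`. Filtering `Ran I` by truncations gives a spectral sequence from `Ext^s(R,
H^t(Ran I))`, that is, from the higher limits of `H^t(Ran I)` over `J`
(`exists_hypercohomology_spectralSequence`, `nonempty_ext_linearEquiv_higherLimit`).

It remains to identify `H^t(Ran I)`. By Yoneda and adjunction its value at `E` is `Ext^t(R[Hom(E, ζ
-)], M)`. The group theory enters here. Let `x : E → ζ(P)` be a morphism with image `A` in `Z(P)`.
As `E` is receptive, `x⁻¹ : A → E` extends to `C_S(A) → C_S(E)`, and this moves `P ≤ C_S(A)`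
isomorphically to a centric subgroup of `C_F(E)`. Thus every `x` arises from a map of `P` into the
image of `O^c(C_F(E))`, and there is a universal such map (`exists_universal_toCentralElements`).
Formally (`UniversalFamily`), left Kan extension along `ι : O^c(C_F(E)) ⥤ C` is then a coproduct
indexed by the maps `x`, hence exact, so restriction along `ι` preserves injectives; and maps out of
`R[Hom(E, ζ -)]` are maps from the constant functor `R` to the restriction. Hence the `Ext`-group is
`H^t(O^c(C_F(E)); M)` (`extMap_bijective`), and `extMap_naturality` matches the induced maps. -/

/-! ### Linear maps between small modules in a large universe. -/

section ShrinkHom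

variable {R : Type u} [CommRing R]

/-- The map induced by a linear map on shrunk modules. -/
noncomputable def shrinkHom {A B : Type w} [AddCommGroup A] [AddCommGroup B] [Module R A]
    [Module R B] [Small.{u} A] [Small.{u} B] (f : A →ₗ[R] B) :
    ModuleCat.of R (Shrink.{u} A) ⟶ ModuleCat.of R (Shrink.{u} B) :=
  ModuleCat.ofHom ((Shrink.linearEquiv R B).symm.toLinearMap ∘ₗ f ∘ₗ
    (Shrink.linearEquiv R A).toLinearMap)

variable {A B C : Type w} [AddCommGroup A] [AddCommGroup B] [AddCommGroup C] [Module R A]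
    [Module R B] [Module R C] [Small.{u} A] [Small.{u} B] [Small.{u} C]

theorem linearEquiv_shrinkHom (f : A →ₗ[R] B) (x : Shrink.{u} A) :
    Shrink.linearEquiv R B ((shrinkHom f).hom x) = f (Shrink.linearEquiv R A x) :=
  (Shrink.linearEquiv R B).apply_symm_apply _

theorem shrinkHom_id : shrinkHom (LinearMap.id : A →ₗ[R] A) = 𝟙 _ := by
  refine ModuleCat.hom_ext (LinearMap.ext fun x => ?_)
  apply (Shrink.linearEquiv R A).injective
  rw [linearEquiv_shrinkHom]
  rfl

theorem shrinkHom_comp (f : A →ₗ[R] B) (g : B →ₗ[R] C) :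
    shrinkHom (g ∘ₗ f) = shrinkHom f ≫ shrinkHom g := by
  refine ModuleCat.hom_ext (LinearMap.ext fun x => ?_)
  apply (Shrink.linearEquiv R C).injective
  change _ = Shrink.linearEquiv R C ((shrinkHom g).hom ((shrinkHom f).hom x))
  rw [linearEquiv_shrinkHom, linearEquiv_shrinkHom, linearEquiv_shrinkHom]
  rfl

/-- Shrinking is a linear isomorphism at each term, so exactness can be read off on elements. The
conclusion is about `ComposableArrows` because the axioms of a spectral object have that form. -/
theorem exact_shrinkHom (f : A →ₗ[R] B) (g : B →ₗ[R] C) (h : Function.Exact f g) :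
    (ComposableArrows.mk₂ (shrinkHom f) (shrinkHom g)).Exact := by
  have w : shrinkHom f ≫ shrinkHom g = 0 := by
    rw [← shrinkHom_comp, h.linearMap_comp_eq_zero]
    refine ModuleCat.hom_ext (LinearMap.ext fun x => ?_)
    apply (Shrink.linearEquiv R C).injective
    rw [linearEquiv_shrinkHom]
    exact (map_zero (Shrink.linearEquiv R C)).symm
  refine ShortComplex.Exact.exact_toComposableArrows (S := ShortComplex.mk _ _ w) ?_
  rw [ShortComplex.moduleCat_exact_iff]
  intro x hx
  change (shrinkHom g).hom x = 0 at hx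
  obtain ⟨y, hy⟩ := (h (Shrink.linearEquiv R B x)).1 (by
    rw [← linearEquiv_shrinkHom, hx, map_zero])
  refine ⟨(Shrink.linearEquiv R A).symm y, ?_⟩
  apply (Shrink.linearEquiv R B).injective
  refine (linearEquiv_shrinkHom f _).trans ?_
  rw [LinearEquiv.apply_symm_apply, hy]

end ShrinkHom

/-! ### Applying `Hom(X, -)` to a spectral object of a triangulated category. -/

section HomSpectralObject

open Pretriangulated ComposableArrows Opposite

variable {T : Type*} [Category.{w} T] [HasShift T ℤ] [Preadditive T]
  (R : Type u) [CommRing R] [Linear R T]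

/-- The connecting map on `Hom(X, -)` of a triangle. -/
noncomputable def coyonedaδ (X : T) {Y Z : T} (f : Z ⟶ Y⟦(1 : ℤ)⟧) (n₀ n₁ : ℤ)
    (h : n₀ + 1 = n₁) : (X ⟶ Z⟦n₀⟧) →ₗ[R] (X ⟶ Y⟦n₁⟧) :=
  Linear.rightComp R X (f⟦n₀⟧' ≫ (shiftFunctorAdd' T 1 n₀ n₁ (by omega)).inv.app _)

variable {R}

theorem coyonedaδ_naturality (X : T) {Y Z Y' Z' : T} (f : Z ⟶ Y⟦(1 : ℤ)⟧)
    (f' : Z' ⟶ Y'⟦(1 : ℤ)⟧) (a : Z ⟶ Z') (b : Y ⟶ Y') (h : a ≫ f' = f ≫ b⟦(1 : ℤ)⟧')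
    (n₀ n₁ : ℤ) (hn : n₀ + 1 = n₁) :
    coyonedaδ R X f' n₀ n₁ hn ∘ₗ Linear.rightComp R X (a⟦n₀⟧') =
      Linear.rightComp R X (b⟦n₁⟧') ∘ₗ coyonedaδ R X f n₀ n₁ hn := by
  ext x
  change (x ≫ a⟦n₀⟧') ≫ f'⟦n₀⟧' ≫ (shiftFunctorAdd' T 1 n₀ n₁ _).inv.app _ =
    (x ≫ f⟦n₀⟧' ≫ (shiftFunctorAdd' T 1 n₀ n₁ _).inv.app _) ≫ b⟦n₁⟧'
  have h1 := (shiftFunctorAdd' T 1 n₀ n₁ (by omega)).inv.naturality b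
  simp only [Category.assoc]
  rw [← h1]
  refine congrArg (x ≫ ·) ?_
  rw [← Functor.map_comp_assoc, h, Functor.map_comp_assoc]
  rfl

variable [HasZeroObject T] [∀ n : ℤ, (shiftFunctor T n).Additive] [Pretriangulated T]

/-- `Hom(X, -)` is a homological functor to abelian groups. This and the next two lemmas restate its
long exact sequence for `R`-linear maps, whose underlying functions are the same. -/
theorem coyoneda_shift_exact₂ (X : T) (t : Triangle T) (ht : t ∈ distTriang T) (n : ℤ) :
    Function.Exact (Linear.rightComp R X (t.mor₁⟦n⟧')) (Linear.rightComp R X (t.mor₂⟦n⟧')) :=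
  (ShortComplex.ab_exact_iff_function_exact _).1
    ((preadditiveCoyoneda.obj (op X)).homologySequence_exact₂ t ht n)

theorem coyoneda_shift_exact₃ (X : T) (t : Triangle T) (ht : t ∈ distTriang T) (n₀ n₁ : ℤ)
    (h : n₀ + 1 = n₁) :
    Function.Exact (Linear.rightComp R X (t.mor₂⟦n₀⟧')) (coyonedaδ R X t.mor₃ n₀ n₁ h) := by
  have h1 := (ShortComplex.ab_exact_iff_function_exact _).1
    ((preadditiveCoyoneda.obj (op X)).homologySequence_exact₃ t ht n₀ n₁ h)
  -- The linear connecting map has the same values as the connecting map of the homological functor.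
  have h2 : ∀ x : X ⟶ t.obj₃⟦n₀⟧, coyonedaδ R X t.mor₃ n₀ n₁ h x =
    (preadditiveCoyoneda.obj (op X)).homologySequenceδ t n₀ n₁ h x := fun x =>
    (preadditiveCoyoneda_homologySequenceδ_apply t n₀ n₁ h (A := op X) x).symm
  intro x
  rw [h2]
  exact h1 x

theorem coyoneda_shift_exact₁ (X : T) (t : Triangle T) (ht : t ∈ distTriang T) (n₀ n₁ : ℤ)
    (h : n₀ + 1 = n₁) :
    Function.Exact (coyonedaδ R X t.mor₃ n₀ n₁ h) (Linear.rightComp R X (t.mor₁⟦n₁⟧')) := by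
  have h1 := (ShortComplex.ab_exact_iff_function_exact _).1
    ((preadditiveCoyoneda.obj (op X)).homologySequence_exact₁ t ht n₀ n₁ h)
  have h2 : ∀ x : X ⟶ t.obj₃⟦n₀⟧, coyonedaδ R X t.mor₃ n₀ n₁ h x =
    (preadditiveCoyoneda.obj (op X)).homologySequenceδ t n₀ n₁ h x := fun x =>
    (preadditiveCoyoneda_homologySequenceδ_apply t n₀ n₁ h (A := op X) x).symm
  intro x
  refine (h1 x).trans ?_
  exact exists_congr fun y => ⟨fun e => (h2 y).trans e, fun e => (h2 y).symm.trans e⟩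

variable {ι : Type*} [Category ι] (Z : Triangulated.SpectralObject T ι) (X : T)
  [∀ (D : ComposableArrows ι 1) (n : ℤ), Small.{u} (X ⟶ (Z.ω₁.obj D)⟦n⟧)]

variable (R) in
/-- The functors of shifted morphisms from `X` into a spectral object. -/
noncomputable def shrinkCoyoneda (n : ℤ) : ComposableArrows ι 1 ⥤ ModuleCat.{u} R where
  obj D := ModuleCat.of R (Shrink.{u} (X ⟶ (Z.ω₁.obj D)⟦n⟧))
  map f := shrinkHom (Linear.rightComp R X ((Z.ω₁.map f)⟦n⟧'))
  map_id D := by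
    rw [← shrinkHom_id]
    congr 1
    ext x
    simp
  map_comp f g := by
    rw [← shrinkHom_comp]
    congr 1
    ext x
    simp

variable (R) in
/-- The spectral object `H^n(D) = Hom(X, Z(D)⟦n⟧)` attached to a spectral object `Z` in a
triangulated category. -/
noncomputable def homSpectralObject : Abelian.SpectralObject (ModuleCat.{u} R) ι where
  H n := shrinkCoyoneda R Z X n
  δ' n₀ n₁ h :=
    { app := fun D => shrinkHom (coyonedaδ R X (Z.δ'.app D) n₀ n₁ h)
      naturality := fun D D' f => by
        refine (shrinkHom_comp _ _).symm.trans ((congrArg shrinkHom ?_).trans (shrinkHom_comp _ _))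
        exact coyonedaδ_naturality X _ _ _ _ (Z.δ'.naturality f) n₀ n₁ h }
  exact₁' n₀ n₁ h D := exact_shrinkHom _ _
    (coyoneda_shift_exact₁ X _ (Z.distinguished' D) n₀ n₁ h)
  exact₂' n D := exact_shrinkHom _ _ (coyoneda_shift_exact₂ X _ (Z.distinguished' D) n)
  exact₃' n₀ n₁ h D := exact_shrinkHom _ _
    (coyoneda_shift_exact₃ X _ (Z.distinguished' D) n₀ n₁ h)

end HomSpectralObject

/-! ### Convergence of the spectral sequence of a first quadrant spectral object. -/

section Convergence

open ComposableArrows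

variable {R : Type u} [CommRing R]

/-- If `g` is surjective and its kernel is the preimage of `P` under `b`, then the target of `g` is
the quotient of the range of `b` by `P`. -/
theorem nonempty_equiv_range_quotient {V W E : Type*} [AddCommGroup V] [AddCommGroup W]
    [AddCommGroup E] [Module R V] [Module R W] [Module R E] (b : V →ₗ[R] W) (g : V →ₗ[R] E)
    (hg : Function.Surjective g) (P : Submodule R W) (h : ∀ v, g v = 0 ↔ b v ∈ P) :
    Nonempty (E ≃ₗ[R] LinearMap.range b ⧸ P.submoduleOf (LinearMap.range b)) := by
  let q := (P.submoduleOf (LinearMap.range b)).mkQ ∘ₗ b.rangeRestrict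
  have hq : Function.Surjective q :=
    (Submodule.mkQ_surjective _).comp b.surjective_rangeRestrict
  have hk : LinearMap.ker g = LinearMap.ker q := by
    ext v
    rw [LinearMap.mem_ker, h, LinearMap.mem_ker]
    exact (Submodule.Quotient.mk_eq_zero (P.submoduleOf (LinearMap.range b))
      (x := b.rangeRestrict v)).symm
  exact ⟨(g.quotKerEquivOfSurjective hg).symm ≪≫ₗ Submodule.quotEquivOfEq _ _ hk ≪≫ₗ
    q.quotKerEquivOfSurjective hq⟩

theorem ConvergesTo.of_linearEquiv {E : E₂CohomologicalSpectralSequenceNat (ModuleCat.{u} R)}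
    {H H' : ℕ → ModuleCat.{u} R} (h : ConvergesTo E H) (e : ∀ n, H n ≃ₗ[R] H' n) :
    ConvergesTo E H' := by
  intro n
  obtain ⟨Fil, h1, h2, h3, h4⟩ := h n
  refine ⟨fun s => (Fil s).map (e n).toLinearMap, fun a b hab => Submodule.map_mono (h1 hab),
    ?_, ?_, fun s t hst r hr hs ht => ?_⟩
  · simp only [h2, Submodule.map_top]
    exact LinearEquiv.range _
  · simp only [h3, Submodule.map_bot]
  · obtain ⟨k⟩ := h4 s t hst r hr hs ht
    refine ⟨k ≪≫ₗ Submodule.Quotient.equiv _ _ ((e n).submoduleMap (Fil s)) ?_⟩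
    ext ⟨x, hx⟩
    constructor
    · rintro ⟨y, hy, hxy⟩
      have h5 : e n y = x := congrArg Subtype.val hxy
      exact ⟨y, hy, h5⟩
    · rintro ⟨y, hy, hxy⟩
      have h6 : y ∈ Fil s := h1 (Nat.le_succ s) hy
      exact ⟨⟨y, h6⟩, hy, Subtype.ext hxy⟩

variable (Y : SpectralObject (ModuleCat.{u} R) EInt)

/-- The map `H^n(⊥ ≤ a) ⟶ H^n(⊥ ≤ b)`. -/
noncomputable def spectralObjectMap (n : ℤ) {a b : EInt} (h : a ≤ b) :
    (Y.H n).obj (mk₁ (homOfLE (bot_le : ⊥ ≤ a))) ⟶ (Y.H n).obj (mk₁ (homOfLE (bot_le : ⊥ ≤ b))) :=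
  (Y.H n).map (twoδ₂Toδ₁ (homOfLE bot_le) (homOfLE h) _ rfl)

theorem spectralObjectMap_comp (n : ℤ) {a b c : EInt} (h : a ≤ b) (h' : b ≤ c) :
    spectralObjectMap Y n h ≫ spectralObjectMap Y n h' = spectralObjectMap Y n (h.trans h') := by
  refine ((Y.H n).map_comp _ _).symm.trans ?_
  congr 1

/-- The filtration of `H^n(⊥ ≤ ⊤)` by the images of the `H^n(⊥ ≤ a)`. -/
noncomputable def spectralObjectFiltration (n : ℤ) (a : EInt) :
    Submodule R ((Y.H n).obj (mk₁ (homOfLE (bot_le : (⊥ : EInt) ≤ ⊤)))) :=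
  LinearMap.range (spectralObjectMap Y n (le_top : a ≤ ⊤)).hom

theorem spectralObjectFiltration_mono (n : ℤ) {a b : EInt} (h : a ≤ b) :
    spectralObjectFiltration Y n a ≤ spectralObjectFiltration Y n b := by
  rintro _ ⟨x, rfl⟩
  refine ⟨(spectralObjectMap Y n h).hom x, ?_⟩
  rw [← spectralObjectMap_comp Y n h le_top]
  rfl

/-- Exactness gives `ker g = im a + im d` and `im d = ker b`. Hence `g v = 0` exactly when `v`
agrees with an element of `im a` up to `ker b`, which is the condition on `b v`. -/
theorem eq_zero_iff_of_exact {A B V E W : ModuleCat.{u} R} (a : A ⟶ V) (d : B ⟶ V) (b : V ⟶ W)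
    (g : V ⟶ E) (w : biprod.desc a d ≫ g = 0) (hE : (ShortComplex.mk _ _ w).Exact)
    (w' : d ≫ b = 0) (hd : (ShortComplex.mk _ _ w').Exact) (v : V) :
    g.hom v = 0 ↔ b.hom v ∈ LinearMap.range (a ≫ b).hom := by
  rw [ShortComplex.moduleCat_exact_iff] at hE hd
  constructor
  · intro hv
    obtain ⟨x, rfl⟩ := hE v hv
    refine ⟨(biprod.fst : A ⊞ B ⟶ A).hom x, ?_⟩
    have h3 : biprod.desc a d ≫ b = biprod.fst ≫ a ≫ b := by
      rw [biprod.desc_eq, Preadditive.add_comp, Category.assoc, Category.assoc, w', comp_zero,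
        add_zero]
    exact (LinearMap.congr_fun (congrArg ModuleCat.Hom.hom h3) x).symm
  · rintro ⟨y, hy⟩
    obtain ⟨z, hz⟩ := hd (v - a.hom y) (by
      change b.hom (v - a.hom y) = 0
      rw [map_sub, ← hy]
      exact sub_self _)
    have h4 : v = a.hom y + d.hom z := sub_eq_iff_eq_add'.1 hz.symm
    have h5 : a ≫ g = 0 := by rw [← biprod.inl_desc a d, Category.assoc, w, comp_zero]
    have h6 : d ≫ g = 0 := by rw [← biprod.inr_desc a d, Category.assoc, w, comp_zero]
    rw [h4, map_add]
    exact (congrArg₂ (· + ·) (LinearMap.congr_fun (congrArg ModuleCat.Hom.hom h5) y)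
      (LinearMap.congr_fun (congrArg ModuleCat.Hom.hom h6) z)).trans (add_zero _)

/-- The term `E` is the cokernel of `H^{n₁}(⊥ ≤ a) ⊕ H^{n₀}(b ≤ ⊤) → H^{n₁}(⊥ ≤ b)`. The second
summand maps by `δ` onto the kernel of `H^{n₁}(⊥ ≤ b) → H^{n₁}(⊥ ≤ ⊤)`, so dividing by it leaves the
image in `H^{n₁}(⊥ ≤ ⊤)`, and the first summand accounts for the smaller image. -/
theorem nonempty_E_equiv_filtration_quotient (n₀ n₁ n₂ : ℤ) (h₁ : n₀ + 1 = n₁) (h₂ : n₁ + 1 = n₂)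
    {a b : EInt} (h : a ≤ b) :
    Nonempty (Y.E (homOfLE (bot_le : ⊥ ≤ a)) (homOfLE h) (homOfLE (le_top : b ≤ ⊤)) n₀ n₁ n₂ h₁ h₂
      ≃ₗ[R] spectralObjectFiltration Y n₁ b ⧸ (spectralObjectFiltration Y n₁ a).submoduleOf
        (spectralObjectFiltration Y n₁ b)) := by
  let S := Y.cokernelSequenceE (homOfLE (bot_le : ⊥ ≤ a)) (homOfLE h)
    (homOfLE (le_top : b ≤ ⊤)) (homOfLE bot_le) rfl n₀ n₁ n₂ h₁ h₂
  have hs : Function.Surjective S.g.hom :=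
    (ModuleCat.epi_iff_surjective S.g).1 inferInstance
  refine nonempty_equiv_range_quotient (spectralObjectMap Y n₁ (le_top : b ≤ ⊤)).hom S.g.hom hs
    (spectralObjectFiltration Y n₁ a) (fun v => ?_)
  refine (eq_zero_iff_of_exact (spectralObjectMap Y n₁ h)
    (Y.δ (homOfLE (bot_le : ⊥ ≤ b)) (homOfLE (le_top : b ≤ ⊤)) n₀ n₁)
    (spectralObjectMap Y n₁ (le_top : b ≤ ⊤)) S.g S.zero
    (Y.cokernelSequenceE_exact (homOfLE (bot_le : ⊥ ≤ a)) (homOfLE h)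
      (homOfLE (le_top : b ≤ ⊤)) (homOfLE bot_le) rfl n₀ n₁ n₂ h₁ h₂) _
    (Y.exact₁ (homOfLE (bot_le : ⊥ ≤ b)) (homOfLE (le_top : b ≤ ⊤)) (homOfLE bot_le) rfl
      n₀ n₁ h₁) v).trans ?_
  rw [spectralObjectMap_comp]
  rfl

/-- The spectral sequence of a first quadrant spectral object converges to `H^n(⊥ ≤ ⊤)`. -/
theorem convergesTo_of_isFirstQuadrant [Y.IsFirstQuadrant] :
    ConvergesTo Y.E₂SpectralSequenceNat
      (fun n => (Y.H n).obj (mk₁ (homOfLE (bot_le : (⊥ : EInt) ≤ ⊤)))) := by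
  intro n
  -- The index `n + 1 - s` reverses the order. The offset is forced by the ends: `H^n(n + 1 ≤ ⊤)`
  -- vanishes, so `s = 0` gives everything, and `H^n(⊥ ≤ 0)` vanishes, so `s = n + 1` gives zero.
  refine ⟨fun s => spectralObjectFiltration Y n (WithBotTop.coe ((n : ℤ) + 1 - s)),
    fun a b hab => spectralObjectFiltration_mono Y n ?_, ?_, ?_, fun s t hst r hr hs ht => ?_⟩
  · rw [WithBotTop.coe_le_coe]
    omega
  · have h1 : IsZero ((Y.H n).obj (mk₁ (homOfLE
        (le_top : WithBotTop.coe ((n : ℤ) + 1 - (0 : ℕ)) ≤ ⊤)))) :=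
      Y.isZero₂_of_isFirstQuadrant _ _ _ _ (by rw [WithBotTop.coe_lt_coe]; omega)
    have h2 := Y.exact₂ (homOfLE (bot_le : ⊥ ≤ WithBotTop.coe ((n : ℤ) + 1 - (0 : ℕ))))
      (homOfLE le_top) _ rfl n
    have h3 := h2.epi_f (h1.eq_of_tgt _ _)
    exact LinearMap.range_eq_top.2 ((ModuleCat.epi_iff_surjective _).1 h3)
  · have h1 : IsZero ((Y.H n).obj (mk₁ (homOfLE
        (bot_le : ⊥ ≤ WithBotTop.coe ((n : ℤ) + 1 - (n + 1 : ℕ)))))) :=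
      Y.isZero₁_of_isFirstQuadrant _ _ _ (by rw [WithBotTop.coe_le_coe]; omega) _
    have h2 : spectralObjectMap Y n (le_top : WithBotTop.coe ((n : ℤ) + 1 - (n + 1 : ℕ)) ≤ ⊤) = 0 :=
      h1.eq_of_src _ _
    change LinearMap.range (spectralObjectMap Y n _).hom = ⊥
    rw [h2]
    exact LinearMap.range_zero
  · subst hst
    have e1 : (WithBotTop.coe (((s + t : ℕ) : ℤ) + 1 - s) : EInt) = WithBotTop.coe ((t : ℤ) + 1) := by
      congr 1; push_cast; ring
    have e2 : (WithBotTop.coe (((s + t : ℕ) : ℤ) + 1 - (s + 1 : ℕ)) : EInt) =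
        WithBotTop.coe (t : ℤ) := by
      congr 1; push_cast; ring
    -- The two indices are made variables so that they can be replaced by `t` and `t + 1` inside the
    -- dependent types.
    suffices ∀ a b : EInt, a = WithBotTop.coe (t : ℤ) → b = WithBotTop.coe ((t : ℤ) + 1) →
        Nonempty ((Y.E₂SpectralSequenceNat.page r hr).X (s, t) ≃ₗ[R]
          spectralObjectFiltration Y (s + t : ℕ) b ⧸
            (spectralObjectFiltration Y (s + t : ℕ) a).submoduleOf
              (spectralObjectFiltration Y (s + t : ℕ) b)) from this _ _ e2 e1
    rintro _ _ rfl rfl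
    have hle : (WithBotTop.coe (t : ℤ) : EInt) ≤ WithBotTop.coe ((t : ℤ) + 1) := by
      rw [WithBotTop.coe_le_coe]; omega
    have hle₀ : (WithBotTop.coe ((t : ℤ) - r + 2) : EInt) ≤ WithBotTop.coe (t : ℤ) := by
      rw [WithBotTop.coe_le_coe]; omega
    have hle₃ : (WithBotTop.coe ((t : ℤ) + 1) : EInt) ≤ WithBotTop.coe ((t : ℤ) + r - 1) := by
      rw [WithBotTop.coe_le_coe]; omega
    obtain ⟨e⟩ := nonempty_E_equiv_filtration_quotient Y (((s + t : ℕ) : ℤ) - 1) (s + t : ℕ)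
      (((s + t : ℕ) : ℤ) + 1) (by omega) rfl hle
    -- `E_r^{s,t}` is the term of `t - r + 2 ≤ t ≤ t + 1 ≤ t + r - 1`; the next two isomorphisms
    -- move its outer ends to `⊥` and `⊤`.
    let i₁ := Y.spectralSequencePageXIso SpectralObject.coreE₂CohomologicalNat r hr (s, t)
      (WithBotTop.coe ((t : ℤ) - r + 2)) (WithBotTop.coe (t : ℤ)) (WithBotTop.coe ((t : ℤ) + 1))
      (WithBotTop.coe ((t : ℤ) + r - 1)) rfl rfl rfl rfl (((s + t : ℕ) : ℤ) - 1) (s + t : ℕ)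
      (((s + t : ℕ) : ℤ) + 1) (by simp) (by omega) rfl
    -- From `t + 1 < r` one gets `t - r + 2 ≤ 0`, so the cohomology of `⊥ ≤ t - r + 2` vanishes.
    let i₂ := Y.isoMapFourδ₁Toδ₀' ⊥ (WithBotTop.coe ((t : ℤ) - r + 2)) (WithBotTop.coe (t : ℤ))
      (WithBotTop.coe ((t : ℤ) + 1)) (WithBotTop.coe ((t : ℤ) + r - 1)) bot_le hle₀ hle hle₃
      (((s + t : ℕ) : ℤ) - 1) (s + t : ℕ) (((s + t : ℕ) : ℤ) + 1)
      (Y.isZero₁_of_isFirstQuadrant _ _ _ (by rw [WithBotTop.coe_le_coe]; omega) _) (by omega) rfl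
    -- From `s < r` one gets `s + t - 1 < t + r - 1`, so `H^{s+t-1}(t + r - 1 ≤ ⊤)` vanishes.
    let i₃ := Y.isoMapFourδ₄Toδ₃' ⊥ (WithBotTop.coe (t : ℤ))
      (WithBotTop.coe ((t : ℤ) + 1)) (WithBotTop.coe ((t : ℤ) + r - 1)) ⊤ bot_le hle hle₃ le_top
      (((s + t : ℕ) : ℤ) - 1) (s + t : ℕ) (((s + t : ℕ) : ℤ) + 1)
      (Y.isZero₂_of_isFirstQuadrant _ _ _ _ (by rw [WithBotTop.coe_lt_coe]; omega)) (by omega) rfl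
    exact ⟨(i₁ ≪≫ i₂.symm ≪≫ i₃).toLinearEquiv ≪≫ₗ e⟩

/-- The second page of the spectral sequence of a first quadrant spectral object. -/
theorem nonempty_page_two_iso [Y.IsFirstQuadrant] (hr : (2 : ℤ) ≤ 2) (s t : ℕ) :
    Nonempty ((Y.E₂SpectralSequenceNat.page 2 hr).X (s, t) ≅
      (Y.H ((s : ℤ) + t)).obj (mk₁ (homOfLE (show (WithBotTop.coe (t : ℤ) : EInt) ≤
        WithBotTop.coe ((t : ℤ) + 1) by rw [WithBotTop.coe_le_coe]; omega)))) := by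
  -- For `r = 2` the outer indices `t - r + 2` and `t + r - 1` are `t` and `t + 1`. The outer arrows
  -- are then identities, and `E` reduces to `H`.
  refine ⟨Y.spectralSequencePageXIso SpectralObject.coreE₂CohomologicalNat 2 le_rfl (s, t)
    (WithBotTop.coe (t : ℤ)) (WithBotTop.coe (t : ℤ)) (WithBotTop.coe ((t : ℤ) + 1))
    (WithBotTop.coe ((t : ℤ) + 1)) ?_ rfl rfl ?_ ((s : ℤ) + t - 1) ((s : ℤ) + t)
    ((s : ℤ) + t + 1) rfl (by omega) rfl ≪≫ Y.EIsoH _ _ _ _ _ rfl⟩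
  · simp
  · simp only [SpectralObject.coreE₂CohomologicalNat]
    congr 1
    ring

end Convergence

/-! ### The hypercohomology spectral sequence from the truncations of a complex. -/

section DerivedSpectralSequence

open Pretriangulated ComposableArrows DerivedCategory

variable {A : Type*} [Category.{u} A] [Abelian A] [HasDerivedCategory.{w} A]

/-- A bounded below object is isomorphic to a bounded below complex of injectives, which is
K-injective. Morphisms into it are homotopy classes of chain maps, and these form a set in the
universe of the morphisms of `A`. -/
theorem small_hom_of_isGE [EnoughInjectives A] (X Y : DerivedCategory A) (n : ℤ) [Y.IsGE n] :
    Small.{u} (X ⟶ Y) := by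
  obtain ⟨K, _, ⟨e⟩⟩ := exists_iso_Q_obj_of_isGE Y n
  obtain ⟨L, i, hi, hL, _⟩ := CochainComplex.Plus.modelCategoryQuillen.exists_quasiIso_injective K n
  have : L.IsKInjective := CochainComplex.isKInjective_of_injective L n
  have hiso : IsIso (Q.map i) := inferInstance
  let e' : Y ≅ Qh.obj ((HomotopyCategory.quotient A _).obj L) :=
    e ≪≫ asIso (Q.map i) ≪≫ (quotientCompQhIso A).symm.app L
  let Z := Qh.objPreimage X
  let e'' : Qh.obj Z ≅ X := Qh.objObjPreimageIso X
  exact small_of_injective.{u} (f := fun f : X ⟶ Y =>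
    (Equiv.ofBijective _ (CochainComplex.IsKInjective.Qh_map_bijective Z L)).symm
      (e''.hom ≫ f ≫ e'.hom)) (fun f g h => by
        have h' := (Equiv.injective _) h
        rwa [cancel_epi, cancel_mono] at h')

/-- Homology in degree `n` of the first map of truncations. -/
theorem nonempty_homology_iso_of_isLE (T : Triangle (DerivedCategory A)) (hT : T ∈ distTriang _)
    (n : ℤ) (h : T.obj₁.IsLE (n - 1)) :
    Nonempty ((homologyFunctor A n).obj T.obj₂ ≅ (homologyFunctor A n).obj T.obj₃) := by
  have h1 := isZero_of_isLE T.obj₁ (n - 1) n (by omega)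
  have h2 := isZero_of_isLE T.obj₁ (n - 1) (n + 1) (by omega)
  have hm : Mono ((homologyFunctor A n).map T.mor₂) :=
    ((homologyFunctor A 0).homologySequence_mono_shift_map_mor₂_iff T hT n).2 (h1.eq_of_src _ _)
  have he : Epi ((homologyFunctor A n).map T.mor₂) :=
    ((homologyFunctor A 0).homologySequence_epi_shift_map_mor₂_iff T hT n (n + 1) rfl).2
      (h2.eq_of_tgt _ _)
  have := isIso_of_mono_of_epi ((homologyFunctor A n).map T.mor₂)
  exact ⟨asIso ((homologyFunctor A n).map T.mor₂)⟩

/-- In the long exact homology sequence both neighbours, `H^n` and `H^{n-1}` of the third object,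
vanish. -/
theorem nonempty_homology_iso_of_isGE (T : Triangle (DerivedCategory A)) (hT : T ∈ distTriang _)
    (n : ℤ) (h : T.obj₃.IsGE (n + 1)) :
    Nonempty ((homologyFunctor A n).obj T.obj₁ ≅ (homologyFunctor A n).obj T.obj₂) := by
  have h1 := isZero_of_isGE T.obj₃ (n + 1) n (by omega)
  have h2 := isZero_of_isGE T.obj₃ (n + 1) (n - 1) (by omega)
  have he : Epi ((homologyFunctor A n).map T.mor₁) :=
    ((homologyFunctor A 0).homologySequence_epi_shift_map_mor₁_iff T hT n).2 (h1.eq_of_tgt _ _)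
  have hm : Mono ((homologyFunctor A n).map T.mor₁) :=
    ((homologyFunctor A 0).homologySequence_mono_shift_map_mor₁_iff T hT (n - 1) n (by omega)).2
      (h2.eq_of_src _ _)
  have := isIso_of_mono_of_epi ((homologyFunctor A n).map T.mor₁)
  exact ⟨asIso ((homologyFunctor A n).map T.mor₁)⟩

/-- The double truncation is concentrated in degree `n`, so it is a single object placed in that
degree. That object is found by taking `H^n`, which neither of the two truncations changes. -/
theorem nonempty_truncation_iso_single (K : DerivedCategory A) (n : ℤ) :
    Nonempty ((TStructure.t.truncGE n).obj ((TStructure.t.truncLT (n + 1)).obj K) ≅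
      (singleFunctor A n).obj ((homologyFunctor A n).obj K)) := by
  let K' := (TStructure.t.truncLT (n + 1)).obj K
  have hGE : ((TStructure.t.truncGE n).obj K').IsGE n := inferInstance
  have hLE' : K'.IsLE n := inferInstance
  have hLE : ((TStructure.t.truncGE n).obj K').IsLE n :=
    inferInstanceAs (TStructure.t.IsLE ((TStructure.t.eTruncGE.obj (WithBotTop.coe n)).obj K') n)
  obtain ⟨N, ⟨e⟩⟩ := exists_iso_singleFunctor_obj_of_isGE_of_isLE
    ((TStructure.t.truncGE n).obj K') n
  obtain ⟨e₁⟩ := nonempty_homology_iso_of_isLE _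
    (TStructure.t.triangleLTGE_distinguished n K') n inferInstance
  obtain ⟨e₂⟩ := nonempty_homology_iso_of_isGE _
    (TStructure.t.triangleLTGE_distinguished (n + 1) K) n inferInstance
  let e₃ : N ≅ (homologyFunctor A n).obj K := ((singleFunctorCompHomologyFunctorIso A n).app N).symm
    ≪≫ (homologyFunctor A n).mapIso e.symm ≪≫ e₁.symm ≪≫ e₂
  exact ⟨e ≪≫ (singleFunctor A n).mapIso e₃⟩

variable (R : Type u) [CommRing R] [Linear R A]

/-- Composition with an isomorphism as a linear equivalence. -/
def homLinearEquivOfIso {T : Type*} [Category T] [Preadditive T] [Linear R T] (X : T) {Y Z : T}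
    (e : Y ≅ Z) : (X ⟶ Y) ≃ₗ[R] (X ⟶ Z) :=
  { Linear.rightComp R X e.hom with
    invFun := fun f => f ≫ e.inv
    left_inv := fun f => by simp [Linear.rightComp]
    right_inv := fun f => by simp [Linear.rightComp] }

/-- The slice of `K` in degree `t` is `H^t(K)[-t]`, so its shift by `s + t` is `H^t(K)[s]`, and
morphisms from `X` into that are `Ext^s`. This yields the second page. -/
theorem nonempty_hom_truncation_equiv_ext [HasExt.{u} A] (X : A) (K : DerivedCategory A) (s t : ℕ) :
    Nonempty (((singleFunctor A 0).obj X ⟶ ((TStructure.t.truncGE (t : ℤ)).obj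
      ((TStructure.t.truncLT ((t : ℤ) + 1)).obj K))⟦(s : ℤ) + t⟧) ≃ₗ[R]
        Ext X ((homologyFunctor A (t : ℤ)).obj K) s) := by
  obtain ⟨e⟩ := nonempty_truncation_iso_single K t
  let N := (homologyFunctor A (t : ℤ)).obj K
  let e₁ : ((singleFunctor A (t : ℤ)).obj N)⟦(s : ℤ) + t⟧ ≅ ((singleFunctor A 0).obj N)⟦(s : ℤ)⟧ :=
    (shiftFunctorAdd' (DerivedCategory A) (t : ℤ) (s : ℤ) ((s : ℤ) + t) (by omega)).app _ ≪≫
      (shiftFunctor _ (s : ℤ)).mapIso (((singleFunctors A).shiftIso (t : ℤ) 0 t (by omega)).app N)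
  exact ⟨homLinearEquivOfIso R _ ((shiftFunctor _ _).mapIso e ≪≫ e₁) ≪≫ₗ
    (Ext.homLinearEquiv (R := R)).symm⟩

variable [EnoughInjectives A]

/-- The values of the spectral object are truncations of `K`, so they still live in degrees `≥ 0`
and become bounded below by `-n` after the shift. -/
instance small_hom_spectralObject (X : DerivedCategory A) (K : DerivedCategory A) [K.IsGE 0]
    (D : ComposableArrows EInt 1) (n : ℤ) :
    Small.{u} (X ⟶ ((TStructure.t.spectralObject K).ω₁.obj D)⟦n⟧) := by
  have h1 : TStructure.t.IsGE ((TStructure.t.spectralObject K).ω₁.obj D) 0 :=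
    inferInstanceAs (TStructure.t.IsGE ((TStructure.t.eTruncGE.obj (D.obj 0)).obj
      ((TStructure.t.eTruncLT.obj (D.obj 1)).obj K)) 0)
  have h2 : (((TStructure.t.spectralObject K).ω₁.obj D)⟦n⟧).IsGE (-n) :=
    TStructure.t.isGE_shift _ 0 n (-n) (by omega)
  exact small_hom_of_isGE _ _ (-n)

theorem isZero_shrink_hom {T : Type*} [Category.{w} T] [Preadditive T] [Linear R T] {X Y : T}
    [Small.{u} (X ⟶ Y)] (h : ∀ f : X ⟶ Y, f = 0) :
    IsZero (ModuleCat.of R (Shrink.{u} (X ⟶ Y))) := by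
  have : Subsingleton (X ⟶ Y) := ⟨fun f g => (h f).trans (h g).symm⟩
  have : Subsingleton (Shrink.{u} (X ⟶ Y)) := (equivShrink _).symm.subsingleton
  exact ModuleCat.isZero_of_subsingleton _

/-- If `j ≤ 0`, the truncation of `K` below `j` is zero because `K` lives in degrees `≥ 0`. If `n <
i`, the truncation from `i` on lives in degrees `≥ 1` after the shift by `n`, and there are no
morphisms to it from an object placed in degree `0`. -/
instance isFirstQuadrant_homSpectralObject (X : A) (K : DerivedCategory A) [K.IsGE 0] :
    (homSpectralObject R (TStructure.t.spectralObject K)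
      ((singleFunctor A 0).obj X)).IsFirstQuadrant where
  isZero₁ i j hij hj n := by
    refine isZero_shrink_hom R (fun f => ?_)
    have h1 : IsZero ((TStructure.t.eTruncLT.obj j).obj K) :=
      TStructure.t.isZero_eTruncLT_obj_obj K 0 j hj
    have h2 : IsZero (((TStructure.t.eTruncGE.obj i).obj ((TStructure.t.eTruncLT.obj j).obj K))⟦n⟧) :=
      (shiftFunctor _ n).map_isZero ((TStructure.t.eTruncGE.obj i).map_isZero h1)
    exact h2.eq_of_tgt _ _
  isZero₂ i j hij n hi := by
    refine isZero_shrink_hom R (fun f => ?_)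
    have h1 := TStructure.t.isGE_eTruncGE_obj_obj (n + 1) i (by
      induction i using WithBotTop.rec with
      | bot => simp at hi
      | coe i => rw [WithBotTop.coe_lt_coe] at hi; rw [WithBotTop.coe_le_coe]; omega
      | top => exact le_top) ((TStructure.t.eTruncLT.obj j).obj K)
    have h2 := TStructure.t.isGE_shift ((TStructure.t.eTruncGE.obj i).obj
      ((TStructure.t.eTruncLT.obj j).obj K)) (n + 1) n 1 (by omega)
    exact TStructure.t.zero_of_isLE_of_isGE f 0 1 (by omega)
      (inferInstanceAs (((singleFunctor A 0).obj X).IsLE 0)) h2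

/-- The hypercohomology spectral sequence
`Ext^s(X, H^t(K)) ⟹ Hom(X, K⟦s + t⟧)` for a complex `K` with cohomology in degrees `≥ 0`. -/
theorem exists_hypercohomology_spectralSequence [HasExt.{u} A] (X : A) (K : DerivedCategory A)
    [K.IsGE 0] (H : ℕ → ModuleCat.{u} R)
    (e : ∀ n, Nonempty (H n ≃ₗ[R] ((singleFunctor A 0).obj X ⟶ K⟦(n : ℤ)⟧))) :
    ∃ E : E₂CohomologicalSpectralSequenceNat (ModuleCat.{u} R),
      (∀ (hr : (2 : ℤ) ≤ 2) (s t : ℕ), Nonempty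
        ((E.page 2 hr).X (s, t) ≃ₗ[R] Ext X ((homologyFunctor A (t : ℤ)).obj K) s)) ∧
      ConvergesTo E H := by
  let Y := homSpectralObject R (TStructure.t.spectralObject K) ((singleFunctor A 0).obj X)
  refine ⟨Y.E₂SpectralSequenceNat, fun hr s t => ?_, ?_⟩
  · obtain ⟨e₁⟩ := nonempty_page_two_iso Y hr s t
    obtain ⟨e₂⟩ := nonempty_hom_truncation_equiv_ext R X K s t
    exact ⟨e₁.toLinearEquiv ≪≫ₗ Shrink.linearEquiv R _ ≪≫ₗ e₂⟩
  · refine (convergesTo_of_isFirstQuadrant Y).of_linearEquiv (fun n => ?_)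
    -- On `⊥ ≤ ⊤` nothing is truncated: the value of the spectral object is definitionally `K`.
    have : Small.{u} ((singleFunctor A 0).obj X ⟶ K⟦(n : ℤ)⟧) :=
      small_hom_spectralObject _ K (mk₁ (homOfLE (bot_le : (⊥ : EInt) ≤ ⊤))) n
    exact (Shrink.linearEquiv R ((singleFunctor A 0).obj X ⟶ K⟦(n : ℤ)⟧) :
      Shrink.{u} ((singleFunctor A 0).obj X ⟶ K⟦(n : ℤ)⟧) ≃ₗ[R] _) ≪≫ₗ (e n).some.symm

end DerivedSpectralSequence

/-! ### Morphisms into a K-injective complex as cocycles modulo coboundaries. -/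

section Cocycles

open Pretriangulated DerivedCategory CochainComplex.HomComplex

variable (R : Type u) [CommRing R] {A : Type*} [Category.{u} A] [Abelian A] [Linear R A]

/-- The module of cocycles of degree `n` of the complex `Hom(X, K)`. -/
abbrev homCocycles (X : A) (K : CochainComplex A ℤ) (n : ℤ) : Submodule R (X ⟶ K.X n) :=
  LinearMap.ker (Linear.rightComp R X (K.d n (n + 1)))

variable {R} in
theorem homCocycles.condition {X : A} {K : CochainComplex A ℤ} {n : ℤ}
    (f : homCocycles R X K n) : (f : X ⟶ K.X n) ≫ K.d n (n + 1) = 0 := f.2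

/-- Precomposition of cocycles. -/
def homCocycles.precomp {X X' : A} (g : X' ⟶ X) (K : CochainComplex A ℤ) (n : ℤ) :
    homCocycles R X K n →ₗ[R] homCocycles R X' K n :=
  (Linear.leftComp R (K.X n) g).restrict (fun f hf => by
    have hf' : f ≫ K.d n (n + 1) = 0 := hf
    change (g ≫ f) ≫ K.d n (n + 1) = 0
    rw [Category.assoc, hf', comp_zero])

variable [HasDerivedCategory.{w} A]

/-- The morphism in the derived category given by a morphism of complexes to a shift. -/
noncomputable def shiftedHomOfHom {L K : CochainComplex A ℤ} {n : ℤ} (g : L ⟶ K⟦n⟧) :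
    Q.obj L ⟶ (Q.obj K)⟦n⟧ :=
  Q.map g ≫ (Q.commShiftIso n).hom.app K

theorem shiftedHomOfHom_add {L K : CochainComplex A ℤ} {n : ℤ} (g g' : L ⟶ K⟦n⟧) :
    shiftedHomOfHom (g + g') = shiftedHomOfHom g + shiftedHomOfHom g' := by
  unfold shiftedHomOfHom
  rw [Functor.map_add]
  exact Preadditive.add_comp _ _ _ _ _ _

theorem shiftedHomOfHom_comp {L' L K : CochainComplex A ℤ} {n : ℤ} (a : L' ⟶ L) (g : L ⟶ K⟦n⟧) :
    shiftedHomOfHom (a ≫ g) = Q.map a ≫ shiftedHomOfHom g := by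
  unfold shiftedHomOfHom
  rw [Functor.map_comp, Category.assoc]

/-- This factors `Q` through the homotopy category, where the bijectivity for K-injective targets
applies. -/
theorem Q_map_eq {L K : CochainComplex A ℤ} (g : L ⟶ K) :
    Q.map g = (quotientCompQhIso A).inv.app L ≫ Qh.map ((HomotopyCategory.quotient A _).map g) ≫
      (quotientCompQhIso A).hom.app K := by
  have h := (quotientCompQhIso A).hom.naturality g
  refine ((quotientCompQhIso A).inv_hom_id_app_assoc L (Q.map g)).symm.trans ?_
  exact congrArg ((quotientCompQhIso A).inv.app L ≫ ·) h.symm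

/-- The shift of a K-injective complex is K-injective, so a morphism into it in the derived category
comes from a homotopy class, and each homotopy class contains a chain map. -/
theorem shiftedHomOfHom_surjective {L K : CochainComplex A ℤ} [K.IsKInjective] {n : ℤ} :
    Function.Surjective (shiftedHomOfHom : (L ⟶ K⟦n⟧) → _) := by
  intro φ
  obtain ⟨ψ, hψ⟩ := (CochainComplex.IsKInjective.Qh_map_bijective
    ((HomotopyCategory.quotient A _).obj L) (K⟦n⟧)).2
    ((quotientCompQhIso A).hom.app L ≫ φ ≫ (Q.commShiftIso n).inv.app K ≫
      (quotientCompQhIso A).inv.app (K⟦n⟧))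
  obtain ⟨g, rfl⟩ := (HomotopyCategory.quotient A _).map_surjective ψ
  refine ⟨g, ?_⟩
  unfold shiftedHomOfHom
  rw [Q_map_eq]
  refine (congrArg (fun z => ((quotientCompQhIso A).inv.app L ≫ z ≫
      (quotientCompQhIso A).hom.app (K⟦n⟧)) ≫ (Q.commShiftIso n).hom.app K) hψ).trans ?_
  simp only [Category.assoc]
  rw [Iso.inv_hom_id_app_assoc]
  have h1 := (quotientCompQhIso A).inv_hom_id_app_assoc (K⟦n⟧) ((Q.commShiftIso n).hom.app K)
  refine (congrArg (fun z => φ ≫ (Q.commShiftIso n).inv.app K ≫ z) h1).trans ?_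
  refine (congrArg (fun z => φ ≫ z) ((Q.commShiftIso n).inv_hom_id_app K)).trans ?_
  exact Category.comp_id _

theorem shiftedHomOfHom_eq_zero_iff {L K : CochainComplex A ℤ} [K.IsKInjective] {n : ℤ}
    (g : L ⟶ K⟦n⟧) :
    shiftedHomOfHom g = 0 ↔ (HomotopyCategory.quotient A (ComplexShape.up ℤ)).map g = 0 := by
  have h1 : shiftedHomOfHom g = 0 ↔ Q.map g = 0 := Preadditive.IsIso.comp_right_eq_zero _ _
  have h2 : Q.map g = 0 ↔ Qh.map ((HomotopyCategory.quotient A (ComplexShape.up ℤ)).map g) = 0 := by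
    rw [Q_map_eq, Preadditive.IsIso.comp_left_eq_zero, Preadditive.IsIso.comp_right_eq_zero]
  rw [h1, h2]
  constructor
  · intro h
    apply (CochainComplex.IsKInjective.Qh_map_bijective
      ((HomotopyCategory.quotient A _).obj L) (K⟦n⟧)).1
    rw [h, Functor.map_zero]
  · intro h
    rw [h, Functor.map_zero]

/-- The morphism of complexes given by a cocycle of `Hom(X, K)`. -/
noncomputable def chainMapOfCocycle {X : A} {K : CochainComplex A ℤ} {n : ℤ} (f : X ⟶ K.X n)
    (hf : f ≫ K.d n (n + 1) = 0) : (CochainComplex.singleFunctor A 0).obj X ⟶ K⟦n⟧ :=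
  Cocycle.equivHomShift.symm (Cocycle.fromSingleMk f (zero_add n) (n + 1) rfl hf)

/-- The linear map from cocycles of `Hom(X, K)` to morphisms in the derived category. -/
noncomputable def homOfCocycle (X : A) (K : CochainComplex A ℤ) (n : ℤ) :
    homCocycles R X K n →ₗ[R]
      (Q.obj ((CochainComplex.singleFunctor A 0).obj X) ⟶ (Q.obj K)⟦n⟧) where
  toFun f := shiftedHomOfHom (chainMapOfCocycle f.1 (homCocycles.condition f))
  map_add' f g := by
    have h := Cocycle.fromSingleMk_add f.1 g.1 (zero_add n) (n + 1) rfl (homCocycles.condition f)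
      (homCocycles.condition g)
    rw [← shiftedHomOfHom_add]
    congr 1
    exact (congrArg Cocycle.equivHomShift.symm h).trans (map_add _ _ _)
  map_smul' r f := by
    -- Multiplication by `r` is written as precomposition with `r • 𝟙 X`. The construction is
    -- compatible with precomposition, and the passage to the derived category is linear on
    -- morphisms of `A`.
    have h : (r • 𝟙 X) ≫ f.1 = r • f.1 := by rw [Linear.smul_comp, Category.id_comp]
    have h2 := Cocycle.fromSingleMk_precomp (r • 𝟙 X) f.1 (zero_add n) (n + 1) rfl
      (homCocycles.condition f)
    have h3 : chainMapOfCocycle (r • f).1 (homCocycles.condition (r • f)) =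
        (CochainComplex.singleFunctor A 0).map (r • 𝟙 X) ≫
          chainMapOfCocycle f.1 (homCocycles.condition f) := by
      unfold chainMapOfCocycle
      rw [← Cocycle.equivHomShift_symm_precomp, ← h2]
      simp only [h]
      rfl
    rw [h3, shiftedHomOfHom_comp]
    have h4 : Q.map ((CochainComplex.singleFunctor A 0).map (r • 𝟙 X)) = r • 𝟙 _ :=
      ((singleFunctor A 0).map_smul r (𝟙 X)).trans
        (congrArg (r • ·) ((singleFunctor A 0).map_id X))
    rw [h4, Linear.smul_comp, Category.id_comp]
    rfl

variable {R}

theorem homOfCocycle_precomp {X X' : A} (a : X' ⟶ X) {K : CochainComplex A ℤ} {n : ℤ}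
    (f : homCocycles R X K n) :
    homOfCocycle R X' K n (homCocycles.precomp R a K n f) =
      Q.map ((CochainComplex.singleFunctor A 0).map a) ≫ homOfCocycle R X K n f := by
  have h := Cocycle.fromSingleMk_precomp a f.1 (zero_add n) (n + 1) rfl (homCocycles.condition f)
  refine Eq.trans ?_ (shiftedHomOfHom_comp _ _)
  change shiftedHomOfHom _ = _
  congr 1
  exact (congrArg Cocycle.equivHomShift.symm h).trans (Cocycle.equivHomShift_symm_precomp _ _)

/-- Chain maps from a complex concentrated in degree `0` to `K⟦n⟧` are exactly the cocycles of
degree `n`, and by K-injectivity every morphism is represented by a chain map. -/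
theorem homOfCocycle_surjective (X : A) (K : CochainComplex A ℤ) [K.IsKInjective] (n : ℤ) :
    Function.Surjective (homOfCocycle R X K n) := by
  intro φ
  obtain ⟨g, rfl⟩ := shiftedHomOfHom_surjective φ
  obtain ⟨f, hf, hfg⟩ := Cocycle.fromSingleMk_surjective (Cocycle.equivHomShift g) n (zero_add n)
    (n + 1) rfl
  refine ⟨⟨f, hf⟩, ?_⟩
  change shiftedHomOfHom _ = _
  congr 1
  exact (congrArg Cocycle.equivHomShift.symm hfg).trans (AddEquiv.symm_apply_apply _ _)

/-- By K-injectivity the morphism vanishes exactly when the chain map is null-homotopic, and a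
homotopy out of a complex concentrated in degree `0` is one morphism to `K.X m` with the given
coboundary. -/
theorem homOfCocycle_eq_zero_iff {X : A} {K : CochainComplex A ℤ} [K.IsKInjective] {n : ℤ}
    (f : homCocycles R X K n) (m : ℤ) (hm : m + 1 = n) :
    homOfCocycle R X K n f = 0 ↔ ∃ g : X ⟶ K.X m, g ≫ K.d m n = f := by
  rw [← Cocycle.fromSingleMk_mem_coboundaries_iff f.1 (zero_add n) (n + 1) rfl
    (homCocycles.condition f) m hm, ← CohomologyClass.toHom_mk_eq_zero_iff,
    CohomologyClass.toHom_mk]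
  exact shiftedHomOfHom_eq_zero_iff _

end Cocycles

/-! ### `Ext`-groups computed by cocycles in an injective resolution. -/

section ExtCocycles

open DerivedCategory

theorem nonempty_linearEquiv_of_surjective {R V V' H H' : Type*} [CommRing R] [AddCommGroup V]
    [AddCommGroup V'] [AddCommGroup H] [AddCommGroup H'] [Module R V] [Module R V'] [Module R H]
    [Module R H'] (p : V →ₗ[R] H) (p' : V' →ₗ[R] H') (hp : Function.Surjective p)
    (hp' : Function.Surjective p') (e : V ≃ₗ[R] V') (h : ∀ v, p v = 0 ↔ p' (e v) = 0) :
    Nonempty (H ≃ₗ[R] H') := by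
  have hk : (LinearMap.ker p).map e.toLinearMap = LinearMap.ker p' := by
    ext v
    constructor
    · rintro ⟨x, hx, rfl⟩
      exact (h x).1 hx
    · intro hv
      refine ⟨e.symm v, (h _).2 ?_, e.apply_symm_apply v⟩
      rwa [LinearEquiv.apply_symm_apply]
  exact ⟨(p.quotKerEquivOfSurjective hp).symm ≪≫ₗ Submodule.Quotient.equiv _ _ e hk ≪≫ₗ
    p'.quotKerEquivOfSurjective hp'⟩

variable {R : Type u} [CommRing R] {A : Type*} [Category.{u} A] [Abelian A] [Linear R A]
  [HasDerivedCategory.{w} A]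

/-- Compatible isomorphisms of the modules `Hom(X, K^n)` and `Hom(X', K'^n)` give isomorphic
modules of morphisms in the derived categories. -/
theorem nonempty_hom_linearEquiv {B : Type*} [Category.{u} B] [Abelian B] [Linear R B]
    [HasDerivedCategory.{w} B] (X : A) (K : CochainComplex A ℤ) [K.IsKInjective]
    (X' : B) (K' : CochainComplex B ℤ) [K'.IsKInjective]
    (e : ∀ n, (X ⟶ K.X n) ≃ₗ[R] (X' ⟶ K'.X n))
    (h : ∀ n m (f : X ⟶ K.X n), e m (f ≫ K.d n m) = e n f ≫ K'.d n m) (n : ℤ) :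
    Nonempty (((singleFunctor A 0).obj X ⟶ (Q.obj K)⟦n⟧) ≃ₗ[R]
      ((singleFunctor B 0).obj X' ⟶ (Q.obj K')⟦n⟧)) := by
  have hmap : (homCocycles R X K n).map (e n).toLinearMap = homCocycles R X' K' n := by
    ext f
    constructor
    · rintro ⟨f, hf, rfl⟩
      have hf' : f ≫ K.d n (n + 1) = 0 := hf
      change e n f ≫ K'.d n (n + 1) = 0
      rw [← h, hf', map_zero]
    · intro hf
      have hf' : f ≫ K'.d n (n + 1) = 0 := hf
      refine ⟨(e n).symm f, ?_, (e n).apply_symm_apply f⟩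
      change (e n).symm f ≫ K.d n (n + 1) = 0
      apply (e (n + 1)).injective
      rw [h, LinearEquiv.apply_symm_apply, hf', map_zero]
  let e' : homCocycles R X K n ≃ₗ[R] homCocycles R X' K' n :=
    (e n).submoduleMap _ ≪≫ₗ LinearEquiv.ofEq _ _ hmap
  refine nonempty_linearEquiv_of_surjective (homOfCocycle R X K n) (homOfCocycle R X' K' n)
    (homOfCocycle_surjective X K n) (homOfCocycle_surjective X' K' n) e' (fun f => ?_)
  refine (homOfCocycle_eq_zero_iff f (n - 1) (by omega)).trans
    (Iff.trans ?_ (homOfCocycle_eq_zero_iff (e' f) (n - 1) (by omega)).symm)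
  constructor
  · rintro ⟨g, hg⟩
    refine ⟨e _ g, ?_⟩
    rw [← h, hg]
    rfl
  · rintro ⟨g, hg⟩
    refine ⟨(e _).symm g, ?_⟩
    apply (e n).injective
    rw [h, LinearEquiv.apply_symm_apply, hg]
    rfl

theorem isKInjective_cochainComplex {A : Type*} [Category* A] [Abelian A] {Y : A}
    (I : InjectiveResolution Y) : I.cochainComplex.IsKInjective :=
  CochainComplex.isKInjective_of_injective _ 0

variable [HasExt.{u} A] {Y : A} (I : InjectiveResolution Y)

/-- An injective resolution in the derived category. -/
noncomputable def resolutionIso :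
    (singleFunctor A 0).obj Y ≅ Q.obj I.cochainComplex :=
  haveI : QuasiIso I.ι' := inferInstance
  haveI : IsIso (Q.map I.ι') :=
    Localization.inverts Q (HomologicalComplex.quasiIso A (ComplexShape.up ℤ)) _ this
  (asIso (Q.map I.ι') :
    Q.obj ((CochainComplex.singleFunctor A 0).obj Y) ≅ Q.obj I.cochainComplex)

variable (R) in
/-- Morphisms to the shift of an injective resolution are elements of `Ext`. -/
noncomputable def extEquivHom (X : A) (n : ℕ) :
    Ext X Y n ≃ₗ[R] ((singleFunctor A 0).obj X ⟶ (Q.obj I.cochainComplex)⟦(n : ℤ)⟧) :=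
  Ext.homLinearEquiv (R := R) ≪≫ₗ
    homLinearEquivOfIso R _ ((shiftFunctor _ (n : ℤ)).mapIso (resolutionIso I))

variable (R) in
/-- The class in `Ext` of a cocycle. -/
noncomputable def extOfCocycle (X : A) (n : ℕ) :
    homCocycles R X I.cochainComplex n →ₗ[R] Ext X Y n :=
  (extEquivHom R I X n).symm.toLinearMap ∘ₗ homOfCocycle R X I.cochainComplex n

theorem extOfCocycle_surjective (X : A) (n : ℕ) :
    Function.Surjective (extOfCocycle R I X n) :=
  have := isKInjective_cochainComplex I
  (extEquivHom R I X n).symm.surjective.comp (homOfCocycle_surjective X _ n)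

theorem extOfCocycle_eq_zero_iff {X : A} {n : ℕ} (f : homCocycles R X I.cochainComplex n)
    (m : ℤ) (hm : m + 1 = n) :
    extOfCocycle R I X n f = 0 ↔
      ∃ g : X ⟶ I.cochainComplex.X m, g ≫ I.cochainComplex.d m n = f := by
  have := isKInjective_cochainComplex I
  rw [← homOfCocycle_eq_zero_iff f m hm]
  exact (extEquivHom R I X n).symm.map_eq_zero_iff

theorem extEquivHom_mk₀_comp {X X' : A} (a : X' ⟶ X) {n : ℕ} (x : Ext X Y n) :
    extEquivHom R I X' n ((Ext.mk₀ a).comp x (zero_add n)) =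
      (singleFunctor A 0).map a ≫ extEquivHom R I X n x := by
  have h : (Ext.homLinearEquiv (R := R)) ((Ext.mk₀ a).comp x (zero_add n)) =
      (singleFunctor A 0).map a ≫ (Ext.homLinearEquiv (R := R)) x := by
    change Ext.hom _ = _ ≫ Ext.hom _
    rw [Ext.comp_hom, Ext.mk₀_hom]
    exact ShiftedHom.mk₀_comp _ _ _ _
  refine (congrArg (homLinearEquivOfIso R _
    ((shiftFunctor _ (n : ℤ)).mapIso (resolutionIso I))) h).trans ?_
  exact Category.assoc _ _ _

/-- Naturality in the source object is needed later to recognize the maps induced on the homology of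
the right Kan extension. -/
theorem extOfCocycle_precomp {X X' : A} (a : X' ⟶ X) {n : ℕ}
    (f : homCocycles R X I.cochainComplex n) :
    extOfCocycle R I X' n (homCocycles.precomp R a _ n f) =
      (Ext.mk₀ a).comp (extOfCocycle R I X n f) (zero_add n) := by
  apply (extEquivHom R I X' n).injective
  rw [extEquivHom_mk₀_comp]
  refine ((extEquivHom R I X' n).apply_symm_apply _).trans ((homOfCocycle_precomp a f).trans ?_)
  exact congrArg ((singleFunctor A 0).map a ≫ ·) ((extEquivHom R I X n).apply_symm_apply _).symm

end ExtCocycles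

/-! ### Higher limits as `Ext`-groups out of the constant functor. -/

section HigherLimit

variable {R : Type u} [CommRing R] {J : Type u} [SmallCategory J]

theorem π_limit_lift_one {N : J ⥤ ModuleCat.{u} R}
    (f : (Functor.const J).obj (ModuleCat.of R R) ⟶ N) (j : J) :
    (limit.π N j).hom ((limit.lift N ⟨_, f⟩).hom (1 : R)) = (f.app j).hom (1 : R) :=
  congr($(limit.lift_π (F := N) ⟨_, f⟩ j).hom (1 : R))

/-- Maps from the constant functor are elements of the limit. -/
noncomputable def constHomEquivLimit (N : J ⥤ ModuleCat.{u} R) :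
    ((Functor.const J).obj (ModuleCat.of R R) ⟶ N) ≃ₗ[R] (limit N : ModuleCat.{u} R) where
  toFun f := (limit.lift N ⟨_, f⟩).hom (1 : R)
  map_add' f g := by
    apply Concrete.limit_ext
    intro j
    change (limit.π N j).hom _ = (limit.π N j).hom _
    rw [π_limit_lift_one, map_add, π_limit_lift_one, π_limit_lift_one]
    rfl
  map_smul' r f := by
    apply Concrete.limit_ext
    intro j
    change (limit.π N j).hom _ = (limit.π N j).hom _
    rw [π_limit_lift_one, map_smul, π_limit_lift_one]
    rfl
  invFun x :=
    { app := fun j => ModuleCat.ofHom (LinearMap.toSpanSingleton R _ ((limit.π N j).hom x))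
      naturality := fun i j f => by
        apply ModuleCat.hom_ext
        apply LinearMap.ext_ring
        change (1 : R) • (limit.π N j).hom x = (N.map f).hom ((1 : R) • (limit.π N i).hom x)
        rw [one_smul, one_smul, ← limit.w N f]
        rfl }
  left_inv f := by
    ext j : 2
    apply ModuleCat.hom_ext
    apply LinearMap.ext_ring
    change (1 : R) • (limit.π N j).hom _ = _
    rw [one_smul, π_limit_lift_one]
  right_inv x := by
    apply Concrete.limit_ext
    intro j
    refine (π_limit_lift_one _ j).trans ?_
    exact one_smul R _

theorem constHomEquivLimit_comp {N N' : J ⥤ ModuleCat.{u} R}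
    (f : (Functor.const J).obj (ModuleCat.of R R) ⟶ N) (a : N ⟶ N') :
    constHomEquivLimit N' (f ≫ a) = (lim.map a).hom (constHomEquivLimit N f) := by
  have : limit.lift N' ⟨_, f ≫ a⟩ = limit.lift N ⟨_, f⟩ ≫ lim.map a := by
    apply limit.hom_ext
    intro j
    simp
  exact congr(($this).hom (1 : R))

/-- Homology of a complex of modules as a quotient of the cocycles. -/
theorem exists_cocycles_to_homology (K : CochainComplex (ModuleCat.{u} R) ℕ) (s : ℕ) :
    ∃ π : LinearMap.ker (K.d s (s + 1)).hom →ₗ[R] K.homology s, Function.Surjective π ∧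
      ∀ x, π x = 0 ↔ ∃ y, (K.d ((ComplexShape.up ℕ).prev s) s).hom y = x := by
  let S := K.sc' ((ComplexShape.up ℕ).prev s) s (s + 1)
  let e : K.homology s ≅ S.moduleCatLeftHomologyData.H :=
    K.homologyIsoSc' _ s (s + 1) rfl (CochainComplex.next ℕ s) ≪≫ S.moduleCatHomologyIso
  refine ⟨e.toLinearEquiv.symm.toLinearMap ∘ₗ Submodule.mkQ _,
    e.toLinearEquiv.symm.surjective.comp (Submodule.mkQ_surjective _), fun x => ?_⟩
  refine (e.toLinearEquiv.symm.map_eq_zero_iff (x := Submodule.mkQ _ x)).trans ?_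
  refine (Submodule.Quotient.mk_eq_zero _).trans ?_
  constructor
  · rintro ⟨y, rfl⟩
    exact ⟨y, rfl⟩
  · rintro ⟨y, hy⟩
    exact ⟨y, Subtype.ext hy⟩

/-- Higher limits are extension groups. -/
theorem nonempty_ext_linearEquiv_higherLimit (N : J ⥤ ModuleCat.{u} R) (s : ℕ) :
    Nonempty (Ext ((Functor.const J).obj (ModuleCat.of R R)) N s ≃ₗ[R] higherLimit N s) := by
  let _ := HasDerivedCategory.standard (J ⥤ ModuleCat.{u} R)
  let X := (Functor.const J).obj (ModuleCat.of R R)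
  let I := InjectiveResolution.of N
  let K := (lim.mapHomologicalComplex (ComplexShape.up ℕ)).obj I.cocomplex
  obtain ⟨π, hπ, hπ'⟩ := exists_cocycles_to_homology K s
  let i : higherLimit N s ≅ K.homology s := I.isoRightDerivedObj lim s
  -- `Hom(R, I^n) ≅ lim I^n`, compatibly with the differentials. Hence the complexes computing `Ext`
  -- and the derived limit have the same cocycles and, as checked below, the same coboundaries.
  let c (n : ℕ) : (X ⟶ I.cochainComplex.X n) ≃ₗ[R] K.X n :=
    (homLinearEquivOfIso R X (I.cochainComplexXIso n n rfl)) ≪≫ₗ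
      constHomEquivLimit (I.cocomplex.X n)
  have hc (n m : ℕ) (f : X ⟶ I.cochainComplex.X n) :
      c m (f ≫ I.cochainComplex.d n m) = (K.d n m).hom (c n f) := by
    refine Eq.trans ?_ (constHomEquivLimit_comp _ _)
    refine congrArg (constHomEquivLimit (I.cocomplex.X m)) ?_
    change (f ≫ I.cochainComplex.d n m) ≫ (I.cochainComplexXIso m m rfl).hom =
      (f ≫ (I.cochainComplexXIso n n rfl).hom) ≫ _
    rw [I.cochainComplex_d n m n m rfl rfl]
    simp
  have hmap : (homCocycles R X I.cochainComplex s).map (c s).toLinearMap =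
      LinearMap.ker (K.d s (s + 1)).hom := by
    ext x
    constructor
    · rintro ⟨f, hf, rfl⟩
      have hf' := homCocycles.condition ⟨f, hf⟩
      change (K.d s (s + 1)).hom (c s f) = 0
      rw [← hc]
      exact (congrArg (c (s + 1)) hf').trans (map_zero _)
    · intro hx
      have hx' : (K.d s (s + 1)).hom x = 0 := hx
      refine ⟨(c s).symm x, ?_, (c s).apply_symm_apply x⟩
      change (c s).symm x ≫ I.cochainComplex.d s ((s + 1 : ℕ) : ℤ) = 0
      apply (c (s + 1)).injective
      rw [hc, LinearEquiv.apply_symm_apply, hx', map_zero]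
  let e : homCocycles R X I.cochainComplex s ≃ₗ[R] LinearMap.ker (K.d s (s + 1)).hom :=
    (c s).submoduleMap _ ≪≫ₗ LinearEquiv.ofEq _ _ hmap
  obtain ⟨e'⟩ := nonempty_linearEquiv_of_surjective (extOfCocycle R I X s) π
    (extOfCocycle_surjective I X s) hπ e (fun f => by
      rw [hπ', extOfCocycle_eq_zero_iff I f ((s : ℤ) - 1) (by omega)]
      change _ ↔ ∃ y, _ = c s f
      -- Degree `0` is separate because the indexing differs. In the complex over `ℤ` the term in
      -- degree `-1` is zero, while over `ℕ` the predecessor of `0` is `0` by default and the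
      -- differential from `0` to `0` is zero. Neither side has nonzero coboundaries.
      cases s with
      | zero =>
        constructor
        · rintro ⟨g, hg⟩
          refine ⟨0, ?_⟩
          rw [← hg, map_zero, (CochainComplex.isZero_of_isStrictlyGE I.cochainComplex 0 _
            (by simp)).eq_of_tgt g 0, zero_comp, map_zero]
        · rintro ⟨g, hg⟩
          refine ⟨0, ?_⟩
          apply (c 0).injective
          rw [← hg]
          simp
      | succ s =>
        have hs : ((s + 1 : ℕ) : ℤ) - 1 = s := by omega
        rw [hs, CochainComplex.prev_nat_succ]
        constructor
        · rintro ⟨g, hg⟩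
          exact ⟨c s g, by rw [← hc, hg]⟩
        · rintro ⟨y, hy⟩
          refine ⟨(c s).symm y, ?_⟩
          apply (c (s + 1)).injective
          rw [hc, LinearEquiv.apply_symm_apply, hy])
  exact ⟨e' ≪≫ₗ i.toLinearEquiv.symm⟩

end HigherLimit

/-! ### Transfer of `Ext` along an exact functor that preserves injectives. -/

section ExtTransfer

variable {A B : Type*} [Category* A] [Category* B] [Abelian A] [Abelian B] [HasExt.{w} A]
  [HasExt.{w} B] [EnoughInjectives A] (L : A ⥤ B) [L.Additive] [PreservesFiniteLimits L]
  [PreservesFiniteColimits L] [L.PreservesInjectiveObjects]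

attribute [local instance] Ext.subsingleton_of_injective in
/-- If `L` is an exact functor that preserves injective objects, then a natural bijection between
`Hom(X, Y)` and `Hom(X', L Y)` extends to the `Ext`-groups. -/
theorem bijective_mk₀_comp_mapExactFunctor {X : A} {X' : B} (c : X' ⟶ L.obj X)
    (h : ∀ Y : A, Function.Bijective (fun f : X ⟶ Y => c ≫ L.map f)) (Y : A) (n : ℕ) :
    Function.Bijective (fun e : Ext X Y n =>
      (Ext.mk₀ c).comp (e.mapExactFunctor L) (zero_add n)) := by
  let α (Y : A) (n : ℕ) : Ext X Y n →+ Ext X' (L.obj Y) n :=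
    ((Ext.mk₀ c).precomp (L.obj Y) (zero_add n)).comp (L.mapExtAddHom X Y n)
  change Function.Bijective (α Y n)
  induction n generalizing Y with
  | zero =>
    have h1 : α Y 0 ∘ Ext.mk₀ = Ext.mk₀ ∘ fun f => c ≫ L.map f := by
      ext f : 1
      change (Ext.mk₀ c).comp ((Ext.mk₀ f).mapExactFunctor L) (zero_add 0) = Ext.mk₀ (c ≫ L.map f)
      rw [Ext.mapExactFunctor_mk₀, Ext.mk₀_comp_mk₀]
    refine (Function.Bijective.of_comp_iff _ (Ext.mk₀_bijective X Y)).1 ?_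
    rw [h1]
    exact (Ext.mk₀_bijective X' (L.obj Y)).comp (h Y)
  | succ n hn =>
    -- Dimension shifting along `0 → Y → I → I/Y → 0`. Both `I` and `L I` are injective, so the
    -- connecting maps onto `Ext^{n+1}` are surjective on both sides. The claim for `n + 1` follows
    -- from the claim for `n` by comparing the two right exact sequences.
    let I : InjectivePresentation Y := Classical.arbitrary _
    let S := ShortComplex.mk _ _ (cokernel.condition I.f)
    have : Injective (S.map L).X₂ := Functor.PreservesInjectiveObjects.injective_obj I.injective
    have hS : S.ShortExact := { exact := ShortComplex.exact_cokernel I.f }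
    have hδ (x : Ext X S.X₃ n) : α S.X₁ (n + 1) (x.comp hS.extClass rfl) =
        (α S.X₃ n x).comp (hS.map_of_exact L).extClass rfl := by
      change (Ext.mk₀ c).comp (Ext.mapExactFunctor L _) (zero_add (n + 1)) = _
      rw [Ext.mapExactFunctor_comp, Ext.mapExactFunctor_extClass]
      exact (Ext.comp_assoc _ _ _ (zero_add n) _ (by omega)).symm
    have hg (x : Ext X S.X₂ n) : α S.X₃ n (x.comp (Ext.mk₀ S.g) (add_zero n)) =
        (α S.X₂ n x).comp (Ext.mk₀ (S.map L).g) (add_zero n) := by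
      change (Ext.mk₀ c).comp (Ext.mapExactFunctor L _) (zero_add n) = _
      rw [Ext.mapExactFunctor_comp, Ext.mapExactFunctor_mk₀]
      exact (Ext.comp_assoc_of_third_deg_zero _ _ _ _).symm
    exact AddMonoidHom.bijective_of_surjective_of_bijective_of_right_exact
      ((Ext.mk₀ S.g).postcomp X (add_zero n)) (hS.extClass.postcomp X rfl)
      ((Ext.mk₀ (S.map L).g).postcomp X' (add_zero n))
      ((hS.map_of_exact L).extClass.postcomp X' rfl)
      (α S.X₂ n) (α S.X₃ n) (α S.X₁ (n + 1)) (AddMonoidHom.ext fun x => (hg x).symm)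
      (AddMonoidHom.ext fun x => (hδ x).symm)
      ((ShortComplex.ab_exact_iff_function_exact _).mp
        (Ext.covariant_sequence_exact₃' X hS n (n + 1) rfl))
      ((ShortComplex.ab_exact_iff_function_exact _).mp
        (Ext.covariant_sequence_exact₃' X' (hS.map_of_exact L) n (n + 1) rfl))
      (hn _).surjective (hn _)
      (fun x₁ ↦ Ext.covariant_sequence_exact₁ _ hS x₁ (by subsingleton) rfl)
      (fun y₁ ↦ Ext.covariant_sequence_exact₁ _ (hS.map_of_exact L) y₁ (by subsingleton) rfl)

end ExtTransfer

/-! ### Universal families, and restriction functors that preserve injectives. -/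

section Decomposition

variable {C J W : Type u} [SmallCategory C] [SmallCategory J] [SmallCategory W]

/-- A natural family of maps `E ⟶ ζ (ι w)` such that the maps `P ⟶ ι w` which give rise to a
prescribed `x : E ⟶ ζ P` factor uniquely through one of them. -/
structure UniversalFamily (ζ : Cᵒᵖ ⥤ J) (ι : W ⥤ C) (E : J) where
  map (w : W) : E ⟶ ζ.obj (.op (ι.obj w))
  naturality {w w' : W} (g : w ⟶ w') : map w' ≫ ζ.map (ι.map g).op = map w
  exists_universal {P : C} (x : E ⟶ ζ.obj (.op P)) : ∃ (w : W) (f : P ⟶ ι.obj w),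
    map w ≫ ζ.map f.op = x ∧ ∀ (w' : W) (f' : P ⟶ ι.obj w'), map w' ≫ ζ.map f'.op = x →
      ∃! g : w ⟶ w', f ≫ ι.map g = f'

namespace UniversalFamily

variable {ζ : Cᵒᵖ ⥤ J} {ι : W ⥤ C} {E : J} (c : UniversalFamily ζ ι E)

/-- The object through which the maps with associated element `x` factor. -/
noncomputable def obj {P : C} (x : E ⟶ ζ.obj (.op P)) : W := (c.exists_universal x).choose

/-- The universal map with associated element `x`. -/
noncomputable def hom {P : C} (x : E ⟶ ζ.obj (.op P)) : P ⟶ ι.obj (c.obj x) :=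
  (c.exists_universal x).choose_spec.choose

theorem map_comp_hom {P : C} (x : E ⟶ ζ.obj (.op P)) :
    c.map (c.obj x) ≫ ζ.map (c.hom x).op = x :=
  (c.exists_universal x).choose_spec.choose_spec.1

theorem existsUnique_lift {P : C} {w : W} (f : P ⟶ ι.obj w) :
    ∃! g : c.obj (c.map w ≫ ζ.map f.op) ⟶ w, c.hom (c.map w ≫ ζ.map f.op) ≫ ι.map g = f :=
  (c.exists_universal _).choose_spec.choose_spec.2 w f rfl

/-- The universal maps as objects of the category of all maps `P ⟶ ι w`. -/
noncomputable def arrow (P : Cᵒᵖ) (x : E ⟶ ζ.obj P) : CostructuredArrow ι.op P :=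
  CostructuredArrow.mk
    (show ι.op.obj (.op (c.obj (P := P.unop) x)) ⟶ P from (c.hom (P := P.unop) x).op)

/-- The inclusion of the universal maps into the category of all maps `P ⟶ ι w`. -/
noncomputable def discreteFunctor (P : Cᵒᵖ) :
    Discrete (E ⟶ ζ.obj P) ⥤ CostructuredArrow ι.op P :=
  Discrete.functor (c.arrow P)

/-- By naturality of the family, a morphism between maps `P ⟶ ι w` preserves the associated element
of `Hom(E, ζ P)`. So an object can map only to the universal map with its own associated element. -/
theorem eq_of_hom_arrow {P : Cᵒᵖ} {d : CostructuredArrow ι.op P} {x : E ⟶ ζ.obj P}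
    (a : d ⟶ c.arrow P x) : c.map d.left.unop ≫ ζ.map d.hom = x := by
  have h1 : c.map (c.obj (P := P.unop) x) ≫ ζ.map (c.hom (P := P.unop) x).op = x :=
    c.map_comp_hom (P := P.unop) x
  have h2 : ι.op.map a.left ≫ (c.hom (P := P.unop) x).op = d.hom := CostructuredArrow.w a
  have h3 : c.map d.left.unop ≫ ζ.map (ι.op.map a.left) = c.map (c.obj (P := P.unop) x) :=
    c.naturality a.left.unop
  rw [← h2]
  refine (congrArg (c.map d.left.unop ≫ ·) (ζ.map_comp _ _)).trans ?_
  exact (Category.assoc _ _ _).symm.trans ((congrArg (· ≫ _) h3).trans h1)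

/-- This is the unique factorization through the universal map, read in the opposite category. -/
theorem exists_hom_arrow {P : Cᵒᵖ} (d : CostructuredArrow ι.op P) :
    ∃ a : d ⟶ c.arrow P (c.map d.left.unop ≫ ζ.map d.hom), ∀ b, b = a := by
  obtain ⟨g, hg, hg'⟩ := c.existsUnique_lift (P := P.unop) (w := d.left.unop) d.hom.unop
  refine ⟨CostructuredArrow.homMk (show d.left ⟶ (c.arrow P _).left from g.op)
    (congrArg Quiver.Hom.op hg), fun b => ?_⟩
  ext
  exact congrArg Quiver.Hom.op
    (hg' b.left.unop (congrArg Quiver.Hom.unop (CostructuredArrow.w b)))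

/-- Each object has exactly one morphism to exactly one universal map, so the comma category in the
definition of finality has a single object. Colimits over all maps `P ⟶ ι w` are therefore
coproducts over `Hom(E, ζ P)`. -/
instance (P : Cᵒᵖ) : (c.discreteFunctor P).Final where
  out d := by
    obtain ⟨a, ha⟩ := c.exists_hom_arrow d
    let z₀ : StructuredArrow d (c.discreteFunctor P) :=
      StructuredArrow.mk (show d ⟶ (c.discreteFunctor P).obj
        ⟨c.map d.left.unop ≫ ζ.map d.hom⟩ from a)
    have hz (z : StructuredArrow d (c.discreteFunctor P)) : z = z₀ := by
      obtain ⟨⟨⟨⟩⟩, ⟨x⟩, b⟩ := z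
      obtain rfl := c.eq_of_hom_arrow b
      obtain rfl := ha b
      rfl
    have : Nonempty (StructuredArrow d (c.discreteFunctor P)) := ⟨z₀⟩
    refine zigzag_isConnected (fun z z' => ?_)
    rw [hz z, hz z']

variable {R : Type u} [CommRing R]

/-- The value of the left Kan extension at `P` is a colimit over the maps `P ⟶ ι w`. By finality of
the discrete subcategory of universal maps it is a coproduct, and coproducts of modules are exact.
-/
theorem preservesMonomorphisms_lan (c : UniversalFamily ζ ι E) :
    (ι.op.lan : (Wᵒᵖ ⥤ ModuleCat.{u} R) ⥤ (Cᵒᵖ ⥤ ModuleCat.{u} R)).PreservesMonomorphisms where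
  preserves {V V'} f _ := by
    have (P : Cᵒᵖ) : Mono ((ι.op.lan.map f).app P) := by
      have := hasExactColimitsOfShape_of_final (ModuleCat.{u} R) (c.discreteFunctor P)
      have : (colim : (CostructuredArrow ι.op P ⥤ ModuleCat.{u} R) ⥤ _).PreservesMonomorphisms :=
        inferInstance
      let φ := Functor.whiskerLeft (CostructuredArrow.proj ι.op P) f
      have (j : _) : Mono (φ.app j) := inferInstanceAs (Mono (f.app _))
      have : Mono φ := NatTrans.mono_of_mono_app φ
      refine colim.map_mono' φ (ι.op.isPointwiseLeftKanExtensionLeftKanExtensionUnit V P)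
        (ι.op.isPointwiseLeftKanExtensionLeftKanExtensionUnit V' P) _ (fun j => ?_)
      have h := congr($(ι.op.lanUnit.naturality f).app j.left)
      change (ι.op.leftKanExtensionUnit V).app j.left ≫ (ι.op.leftKanExtension V).map j.hom ≫
        (ι.op.lan.map f).app P = f.app j.left ≫ (ι.op.leftKanExtensionUnit V').app j.left ≫
        (ι.op.leftKanExtension V').map j.hom
      have h' : (ι.op.leftKanExtension V).map j.hom ≫ (ι.op.lan.map f).app P =
        (ι.op.lan.map f).app (ι.op.obj j.left) ≫ (ι.op.leftKanExtension V').map j.hom :=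
        (ι.op.lan.map f).naturality j.hom
      exact (congrArg ((ι.op.leftKanExtensionUnit V).app j.left ≫ ·) h').trans
        ((Category.assoc _ _ _).symm.trans
          ((congrArg (· ≫ (ι.op.leftKanExtension V').map j.hom) h.symm).trans
            (Category.assoc _ _ _)))
    exact NatTrans.mono_of_mono_app _

/-- Restriction along `ι` preserves injective objects. -/
theorem preservesInjectiveObjects (c : UniversalFamily ζ ι E) :
    ((Functor.whiskeringLeft Wᵒᵖ Cᵒᵖ (ModuleCat.{u} R)).obj ι.op).PreservesInjectiveObjects where
  injective_obj {I} hI :=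
    have := c.preservesMonomorphisms_lan (R := R)
    (ι.op.lanAdjunction (ModuleCat.{u} R)).map_injective I hI

end UniversalFamily
end Decomposition

/-! ### The free module on `Hom(E, -)` and the linear Yoneda lemma. -/

section FreeCoyoneda

variable (R : Type u) [CommRing R] (J : Type u) [SmallCategory J]

/-- The functor that sends `E` to the free module on `Hom(E, -)`. -/
noncomputable def freeCoyoneda : Jᵒᵖ ⥤ J ⥤ ModuleCat.{u} R :=
  coyoneda ⋙ (Functor.whiskeringRight J (Type u) (ModuleCat.{u} R)).obj (ModuleCat.free R)

variable {R J}

/-- The basis element of `freeCoyoneda` given by a morphism. -/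
noncomputable def freeCoyonedaMk {E X : J} (x : E ⟶ X) :
    ((freeCoyoneda R J).obj (.op E)).obj X :=
  ModuleCat.freeMk (R := R) (X := (E ⟶ X)) x

theorem freeCoyonedaMk_map {E X Y : J} (x : E ⟶ X) (f : X ⟶ Y) :
    (((freeCoyoneda R J).obj (.op E)).map f).hom (freeCoyonedaMk x) =
      freeCoyonedaMk (R := R) (x ≫ f) :=
  ModuleCat.free_map_apply (R := R) ((coyoneda.obj (.op E)).map f) x

theorem freeCoyoneda_map_mk {E E' X : J} (x : E ⟶ X) (g : E' ⟶ E) :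
    (((freeCoyoneda R J).map g.op).app X).hom (freeCoyonedaMk x) =
      freeCoyonedaMk (R := R) (g ≫ x) :=
  ModuleCat.free_map_apply (R := R) ((coyoneda.map g.op).app X) x

theorem freeCoyoneda_hom_ext {E X : J} {V : ModuleCat.{u} R}
    {f g : ((freeCoyoneda R J).obj (.op E)).obj X ⟶ V}
    (h : ∀ x : E ⟶ X, f.hom (freeCoyonedaMk x) = g.hom (freeCoyonedaMk x)) : f = g :=
  ModuleCat.free_hom_ext h

/-- The map from `freeCoyoneda` given by a function on morphisms. -/
noncomputable def freeCoyonedaDesc {E X : J} {V : ModuleCat.{u} R} (f : (E ⟶ X) → V) :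
    ((freeCoyoneda R J).obj (.op E)).obj X ⟶ V :=
  ModuleCat.freeDesc (↾ f)

theorem freeCoyonedaDesc_mk {E X : J} {V : ModuleCat.{u} R} (f : (E ⟶ X) → V) (x : E ⟶ X) :
    (freeCoyonedaDesc f).hom (freeCoyonedaMk x) = f x :=
  ModuleCat.freeDesc_apply _ x

/-- The Yoneda lemma. -/
noncomputable def freeCoyonedaEquiv (E : J) (V : J ⥤ ModuleCat.{u} R) :
    ((freeCoyoneda R J).obj (.op E) ⟶ V) ≃ₗ[R] V.obj E where
  toFun f := (f.app E).hom (freeCoyonedaMk (𝟙 E))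
  map_add' f g := rfl
  map_smul' r f := rfl
  invFun v :=
    { app := fun X => freeCoyonedaDesc (fun x => (V.map x).hom v)
      naturality := fun X Y f => by
        apply freeCoyoneda_hom_ext
        intro x
        refine (congrArg _ (freeCoyonedaMk_map x f)).trans ((freeCoyonedaDesc_mk _ _).trans ?_)
        refine Eq.trans ?_ (congrArg (V.map f).hom (freeCoyonedaDesc_mk _ x)).symm
        rw [V.map_comp]
        rfl }
  left_inv f := by
    ext X : 2
    apply freeCoyoneda_hom_ext
    intro x
    refine (freeCoyonedaDesc_mk _ _).trans ?_
    have h := congr(($(f.naturality x)).hom (freeCoyonedaMk (𝟙 E)))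
    refine h.symm.trans (congrArg (f.app X).hom ((freeCoyonedaMk_map _ _).trans ?_))
    rw [Category.id_comp]
  right_inv v := (freeCoyonedaDesc_mk _ _).trans (by rw [V.map_id]; rfl)

theorem freeCoyonedaEquiv_comp {E : J} {V V' : J ⥤ ModuleCat.{u} R}
    (f : (freeCoyoneda R J).obj (.op E) ⟶ V) (a : V ⟶ V') :
    freeCoyonedaEquiv E V' (f ≫ a) = (a.app E).hom (freeCoyonedaEquiv E V f) := rfl

theorem freeCoyonedaEquiv_map_comp {E E' : J} {V : J ⥤ ModuleCat.{u} R}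
    (f : (freeCoyoneda R J).obj (.op E) ⟶ V) (g : E ⟶ E') :
    freeCoyonedaEquiv E' V ((freeCoyoneda R J).map g.op ≫ f) =
      (V.map g).hom (freeCoyonedaEquiv E V f) := by
  have h := congr(($(f.naturality g)).hom (freeCoyonedaMk (𝟙 E)))
  refine Eq.trans ?_ h
  change (f.app E').hom _ = (f.app E').hom _
  refine congrArg (f.app E').hom
    ((freeCoyoneda_map_mk _ _).trans (Eq.trans ?_ (freeCoyonedaMk_map _ _).symm))
  rw [Category.id_comp, Category.comp_id]

end FreeCoyoneda

/-! ### Comparison of `Ext^n(R[Hom(E, ζ -)], M)` with cohomology over `W`. -/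

/-- The assumption `h` is the case of degree zero. The general case follows because the action of
exact functors on `Ext` respects composites (`ext_map_comp`) and natural transformations
(`ext_map_natTrans`). It is applied to three restriction functors. -/
theorem mk₀_comp_mapExactFunctor_naturality {A B B' : Type*} [Category* A] [Category* B]
    [Category* B'] [Abelian A] [Abelian B] [Abelian B'] [HasExt.{w} A] [HasExt.{w} B]
    [HasExt.{w} B'] [EnoughInjectives A] (P : A ⥤ B) (P' : A ⥤ B') (Q : B ⥤ B') [P.Additive]
    [P'.Additive] [Q.Additive] [PreservesFiniteLimits P] [PreservesFiniteColimits P]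
    [PreservesFiniteLimits P'] [PreservesFiniteColimits P'] [PreservesFiniteLimits Q]
    [PreservesFiniteColimits Q] (ν : P ⋙ Q ⟶ P') {X X' Y : A} (a : X' ⟶ X) {Z : B} {Z' : B'}
    (k : Z ⟶ P.obj X) (k' : Z' ⟶ P'.obj X') (r : Z' ⟶ Q.obj Z)
    (h : k' ≫ P'.map a = r ≫ Q.map k ≫ ν.app X) {n : ℕ} (e : Ext X Y n) :
    (Ext.mk₀ k').comp (((Ext.mk₀ a).comp e (zero_add n)).mapExactFunctor P') (zero_add n) =
      ((Ext.mk₀ r).comp (((Ext.mk₀ k).comp (e.mapExactFunctor P) (zero_add n)).mapExactFunctor Q)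
        (zero_add n)).comp (Ext.mk₀ (ν.app Y)) (add_zero n) := by
  have := comp_preservesFiniteLimits P Q
  have := comp_preservesFiniteColimits P Q
  have h1 := ext_map_natTrans (P ⋙ Q) P' ν e
  rw [ext_map_comp P Q e] at h1
  rw [Ext.mapExactFunctor_comp, Ext.mapExactFunctor_mk₀, Ext.mapExactFunctor_comp,
    Ext.mapExactFunctor_mk₀, ← Ext.comp_assoc_of_second_deg_zero, Ext.mk₀_comp_mk₀, h,
    ← Ext.mk₀_comp_mk₀, ← Ext.mk₀_comp_mk₀]
  simp only [Ext.comp_assoc_of_second_deg_zero, Ext.comp_assoc_of_third_deg_zero]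
  exact congrArg (fun z => (Ext.mk₀ r).comp
    ((Ext.mk₀ (Q.map k)).comp z (zero_add n)) (zero_add n)) h1.symm

namespace UniversalFamily

variable {R : Type u} [CommRing R] {C J W : Type u} [SmallCategory C] [SmallCategory J]
  [SmallCategory W] {ζ : Cᵒᵖ ⥤ J} {ι : W ⥤ C} {E : J} (c : UniversalFamily ζ ι E)

variable (R) in
/-- The section of the restriction of the free module on `Hom(E, ζ -)`. -/
noncomputable def constHom :
    constModule R W ⟶ ι.op ⋙ ζ ⋙ (freeCoyoneda R J).obj (.op E) where
  app w := ModuleCat.ofHom (LinearMap.toSpanSingleton R _ (freeCoyonedaMk (c.map w.unop)))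
  naturality w w' g := by
    apply ModuleCat.hom_ext
    apply LinearMap.ext_ring
    refine (one_smul R _).trans (Eq.trans ?_
      (congrArg (((freeCoyoneda R J).obj (.op E)).map (ζ.map (ι.op.map g))).hom
        (one_smul R (freeCoyonedaMk (c.map w.unop)))).symm)
    refine Eq.trans ?_ (freeCoyonedaMk_map _ _).symm
    exact congrArg freeCoyonedaMk (c.naturality g.unop).symm

theorem constHom_app_one (w : Wᵒᵖ) :
    ((c.constHom R).app w).hom (1 : R) = freeCoyonedaMk (c.map w.unop) :=
  one_smul R _

/-- Every basis element `x : E ⟶ ζ P` is the restriction of a member of the family along the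
universal map for `x`. A natural transformation is therefore determined by its values on the family,
and these form an element of the limit of the restriction of `N`. Conversely, such an element
extends, since universality makes the prescribed values consistent. -/
theorem bijective_constHom_comp (N : Cᵒᵖ ⥤ ModuleCat.{u} R) :
    Function.Bijective (fun f : ζ ⋙ (freeCoyoneda R J).obj (.op E) ⟶ N =>
      c.constHom R ≫ ((Functor.whiskeringLeft Wᵒᵖ Cᵒᵖ (ModuleCat.{u} R)).obj ι.op).map f) := by
  constructor
  · intro f f' h
    have h' (w : W) : (f.app (.op (ι.obj w))).hom (freeCoyonedaMk (c.map w)) =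
        (f'.app (.op (ι.obj w))).hom (freeCoyonedaMk (c.map w)) := by
      have h1 := congr((($h).app (.op w)).hom (1 : R))
      refine Eq.trans ?_ (h1.trans ?_)
      · exact congrArg (f.app (.op (ι.obj w))).hom (c.constHom_app_one (.op w)).symm
      · exact congrArg (f'.app (.op (ι.obj w))).hom (c.constHom_app_one (.op w))
    have key (f : ζ ⋙ (freeCoyoneda R J).obj (.op E) ⟶ N) (P : C) (x : E ⟶ ζ.obj (.op P)) :
        (f.app (.op P)).hom (freeCoyonedaMk x) =
        (N.map (c.hom x).op).hom
          ((f.app (.op (ι.obj (c.obj x)))).hom (freeCoyonedaMk (c.map (c.obj x)))) := by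
      have h := congr(($(f.naturality (c.hom x).op)).hom (freeCoyonedaMk (c.map (c.obj x))))
      refine Eq.trans ?_ h
      refine congrArg (f.app (.op P)).hom (Eq.trans ?_ (freeCoyonedaMk_map _ _).symm)
      exact congrArg freeCoyonedaMk (c.map_comp_hom x).symm
    ext P : 2
    apply freeCoyoneda_hom_ext
    intro x
    exact (key f P.unop x).trans ((congrArg _ (h' _)).trans (key f' P.unop x).symm)
  · intro s
    let σ (w : W) : N.obj (.op (ι.obj w)) := (s.app (.op w)).hom (1 : R)
    have hσ {w w' : W} (g : w ⟶ w') : (N.map (ι.map g).op).hom (σ w') = σ w :=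
      congr(($(s.naturality g.op)).hom (1 : R)).symm
    -- Any `f` factors through the universal map with the same associated element, so both give the
    -- same restriction of `σ`. Naturality of the extension and its agreement with `s` both follow
    -- from this.
    have hlift {P : C} {w : W} (f : P ⟶ ι.obj w) :
        (N.map (c.hom (c.map w ≫ ζ.map f.op)).op).hom (σ (c.obj (c.map w ≫ ζ.map f.op))) =
          (N.map f.op).hom (σ w) := by
      obtain ⟨g, hg, -⟩ := c.existsUnique_lift f
      rw [← hσ g]
      refine Eq.trans ?_ (congrArg (fun z : P ⟶ ι.obj w => (N.map z.op).hom (σ w)) hg)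
      rw [op_comp, N.map_comp]
      rfl
    let f : ζ ⋙ (freeCoyoneda R J).obj (.op E) ⟶ N :=
      { app := fun P => freeCoyonedaDesc (fun x : E ⟶ ζ.obj (.op P.unop) =>
          (N.map (c.hom x).op).hom (σ (c.obj x)))
        naturality := fun P Q h => by
          apply freeCoyoneda_hom_ext
          intro x
          refine (congrArg _ (freeCoyonedaMk_map x (ζ.map h))).trans
            ((freeCoyonedaDesc_mk _ _).trans ?_)
          refine Eq.trans ?_ (congrArg (N.map h).hom (freeCoyonedaDesc_mk _ x)).symm
          have h1 : x ≫ ζ.map h =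
              c.map (c.obj (P := P.unop) x) ≫ ζ.map (h.unop ≫ c.hom (P := P.unop) x).op := by
            rw [op_comp, ζ.map_comp, ← Category.assoc]
            exact congrArg (· ≫ ζ.map h) (c.map_comp_hom (P := P.unop) x).symm
          have h2 := hlift (h.unop ≫ c.hom (P := P.unop) x)
          rw [← h1] at h2
          refine h2.trans ?_
          rw [op_comp, N.map_comp]
          rfl }
    refine ⟨f, ?_⟩
    ext w : 2
    apply ModuleCat.hom_ext
    apply LinearMap.ext_ring
    refine (congrArg (f.app (ι.op.obj w)).hom (c.constHom_app_one w)).trans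
      ((freeCoyonedaDesc_mk _ _).trans ?_)
    have h := hlift (𝟙 (ι.obj w.unop))
    rw [op_id, ζ.map_id, Category.comp_id, N.map_id] at h
    exact h

variable (R) in
/-- The comparison of the `Ext`-groups of the free module on `Hom(E, ζ -)` with cohomology. -/
noncomputable def extMap (M : Cᵒᵖ ⥤ ModuleCat.{u} R) (n : ℕ) :
    Ext (ζ ⋙ (freeCoyoneda R J).obj (.op E)) M n →ₗ[R] catCohomology (ι.op ⋙ M) n :=
  (Ext.mk₀ (c.constHom R)).precompOfLinear R (ι.op ⋙ M) (zero_add n) ∘ₗ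
    ((Functor.whiskeringLeft Wᵒᵖ Cᵒᵖ (ModuleCat.{u} R)).obj ι.op).mapExtLinearMap R
      (ζ ⋙ (freeCoyoneda R J).obj (.op E)) M n

/-- Restriction along `ι` is exact and preserves injectives, so the bijection on `Hom` in
`bijective_constHom_comp` propagates to all `Ext`-groups. -/
theorem extMap_bijective (M : Cᵒᵖ ⥤ ModuleCat.{u} R) (n : ℕ) :
    Function.Bijective (c.extMap R M n) :=
  have := c.preservesInjectiveObjects (R := R)
  bijective_mk₀_comp_mapExactFunctor
    ((Functor.whiskeringLeft Wᵒᵖ Cᵒᵖ (ModuleCat.{u} R)).obj ι.op) (c.constHom R)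
    c.bijective_constHom_comp M n

/-- Compatibility of the comparison with a change of `E`. -/
theorem extMap_naturality {W' : Type u} [SmallCategory W'] {ι' : W' ⥤ C} {E' : J}
    (c' : UniversalFamily ζ ι' E') (φ : E ⟶ E') (T : W' ⥤ W) (η : ι' ⟶ T ⋙ ι)
    (h : ∀ w, c.map (T.obj w) ≫ ζ.map (η.app w).op = φ ≫ c'.map w)
    (M : Cᵒᵖ ⥤ ModuleCat.{u} R) (n : ℕ) (e : Ext (ζ ⋙ (freeCoyoneda R J).obj (.op E)) M n) :
    c'.extMap R M n ((Ext.mk₀ (Functor.whiskerLeft ζ ((freeCoyoneda R J).map φ.op))).comp e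
      (zero_add n)) =
    (cohomologyMap T (Functor.whiskerRight (NatTrans.op η) M) n).hom (c.extMap R M n e) := by
  let P := (Functor.whiskeringLeft Wᵒᵖ Cᵒᵖ (ModuleCat.{u} R)).obj ι.op
  let P' := (Functor.whiskeringLeft W'ᵒᵖ Cᵒᵖ (ModuleCat.{u} R)).obj ι'.op
  let Q := (Functor.whiskeringLeft W'ᵒᵖ Wᵒᵖ (ModuleCat.{u} R)).obj T.op
  let ν : P ⋙ Q ⟶ P' :=
    (Functor.whiskeringLeft W'ᵒᵖ Cᵒᵖ (ModuleCat.{u} R)).map (NatTrans.op η)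
  let X := ζ ⋙ (freeCoyoneda R J).obj (.op E)
  -- Both composites send `1` to a basis element; the two basis elements agree by `h`.
  have h3 : c'.constHom R ≫ P'.map (Functor.whiskerLeft ζ ((freeCoyoneda R J).map φ.op)) =
      constModuleRes T ≫ Q.map (c.constHom R) ≫ ν.app X := by
    ext w : 2
    apply ModuleCat.hom_ext
    apply LinearMap.ext_ring
    refine (congrArg _ (c'.constHom_app_one w)).trans ((freeCoyoneda_map_mk _ _).trans ?_)
    refine Eq.trans ?_ (congrArg ((ν.app X).app w).hom (c.constHom_app_one (T.op.obj w))).symm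
    refine Eq.trans ?_ (freeCoyonedaMk_map _ _).symm
    exact congrArg freeCoyonedaMk (h w.unop).symm
  exact mk₀_comp_mapExactFunctor_naturality P P' Q ν _ (c.constHom R) (c'.constHom R)
    (constModuleRes T) h3 e

end UniversalFamily

/-! ### Objectwise recognition of the homology of functors. -/

section FunctorHomology

variable {R : Type u} [CommRing R] {J : Type u} [SmallCategory J]

/-- The homology of a complex of functors, described objectwise. -/
theorem nonempty_shortComplex_homology_iso (S : ShortComplex (J ⥤ ModuleCat.{u} R))
    (N : J ⥤ ModuleCat.{u} R)
    (θ : ∀ j, LinearMap.ker (S.g.app j).hom →ₗ[R] N.obj j)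
    (hθ : ∀ j, Function.Surjective (θ j))
    (hθ' : ∀ j x, θ j x = 0 ↔ ∃ y, (S.f.app j).hom y = x)
    (hnat : ∀ {i j : J} (φ : i ⟶ j) (x : LinearMap.ker (S.g.app i).hom)
      (y : LinearMap.ker (S.g.app j).hom), (S.X₂.map φ).hom x = y →
      θ j y = (N.map φ).hom (θ i x)) :
    Nonempty (S.homology ≅ N) := by
  have hz (j : J) (z : S.cycles.obj j) : (S.iCycles.app j).hom z ∈
      LinearMap.ker (S.g.app j).hom :=
    congr((($(S.iCycles_g)).app j).hom z)
  let q : S.cycles ⟶ N :=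
    { app := fun j => ModuleCat.ofHom (θ j ∘ₗ (S.iCycles.app j).hom.codRestrict _ (hz j))
      naturality := fun i j φ => by
        ext z
        exact hnat φ ⟨_, hz i z⟩ ⟨_, hz j _⟩ congr(($(S.iCycles.naturality φ)).hom z).symm }
  have hf (j : J) (y : S.X₁.obj j) :
      (S.iCycles.app j).hom ((S.toCycles.app j).hom y) = (S.f.app j).hom y :=
    congr((($(S.toCycles_i)).app j).hom y)
  have hq : S.toCycles ≫ q = 0 := by
    ext j : 2
    ext y
    exact (hθ' j ⟨_, hz j _⟩).2 ⟨y, (hf j y).symm⟩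
  let d : S.homology ⟶ N := S.descHomology q hq
  have hd (j : J) (z : S.cycles.obj j) :
      (d.app j).hom ((S.homologyπ.app j).hom z) = θ j ⟨_, hz j z⟩ :=
    congr((($(S.π_descHomology q hq)).app j).hom z)
  have (j : J) : IsIso (d.app j) := by
    rw [ConcreteCategory.isIso_iff_bijective]
    have hi : Function.Injective (S.iCycles.app j).hom :=
      (ModuleCat.mono_iff_injective _).1 inferInstance
    have hπ : Function.Surjective (S.homologyπ.app j).hom :=
      (ModuleCat.epi_iff_surjective _).1 inferInstance
    constructor
    · refine (injective_iff_map_eq_zero (d.app j).hom).2 fun h hh => ?_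
      obtain ⟨z, rfl⟩ := hπ h
      rw [hd, hθ'] at hh
      obtain ⟨y, hy⟩ := hh
      have hy' : (S.toCycles.app j).hom y = z := hi ((hf j y).trans hy)
      rw [← hy']
      exact congr((($(S.toCycles_comp_homologyπ)).app j).hom y)
    · intro n
      obtain ⟨x, rfl⟩ := hθ j n
      -- Evaluation at `j` is exact, so an element of the kernel at `j` comes from the cycles of the
      -- complex of functors.
      have he : (ShortComplex.mk S.iCycles S.g S.iCycles_g).Exact :=
        ShortComplex.exact_of_f_is_kernel _ S.cyclesIsKernel
      obtain ⟨z, hz'⟩ := (ShortComplex.moduleCat_exact_iff _).1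
        (he.map ((evaluation J (ModuleCat.{u} R)).obj j)) x.1 x.2
      refine ⟨(S.homologyπ.app j).hom z, (hd j z).trans ?_⟩
      exact congrArg (θ j) (Subtype.ext hz')
  have : IsIso d := NatIso.isIso_of_isIso_app d
  exact ⟨asIso d⟩

end FunctorHomology

/-! ### The spectral sequence of a right Kan extension followed by the limit. -/

section Grothendieck

/-- Isomorphic objects have isomorphic `Ext`-groups. -/
noncomputable def extLinearEquivOfIso (R : Type*) [CommRing R] {A : Type*} [Category* A]
    [Abelian A] [Linear R A] [HasExt.{w} A] (X : A) {Y Z : A} (i : Y ≅ Z) (n : ℕ) :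
    Ext X Y n ≃ₗ[R] Ext X Z n :=
  LinearEquiv.ofLinearMap ((Ext.mk₀ i.hom).postcompOfLinear R X (add_zero n))
    ((Ext.mk₀ i.inv).postcompOfLinear R X (add_zero n))
    (LinearMap.ext fun x => by
      change (x.comp (Ext.mk₀ i.inv) (add_zero n)).comp (Ext.mk₀ i.hom) (add_zero n) = x
      simp)
    (LinearMap.ext fun x => by
      change (x.comp (Ext.mk₀ i.hom) (add_zero n)).comp (Ext.mk₀ i.inv) (add_zero n) = x
      simp)

variable {R : Type u} [CommRing R] {C J : Type u} [SmallCategory C] [SmallCategory J]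
  (ζ : Cᵒᵖ ⥤ J)

/-- Restriction along `ζ` is left adjoint to the right Kan extension, as an isomorphism of modules
of morphisms. -/
noncomputable def ranHomEquiv (V : J ⥤ ModuleCat.{u} R) (N : Cᵒᵖ ⥤ ModuleCat.{u} R) :
    (V ⟶ ζ.ran.obj N) ≃ₗ[R] (ζ ⋙ V ⟶ N) where
  toEquiv := ((ζ.ranAdjunction (ModuleCat.{u} R)).homEquiv V N).symm
  map_add' f g := (ζ.ranAdjunction (ModuleCat.{u} R)).homAddEquiv_symm_add V N f g
  map_smul' r f := by
    refine (Adjunction.homEquiv_counit _ _ _ _).trans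
      (Eq.trans ?_ (congrArg (r • ·) (Adjunction.homEquiv_counit _ _ _ _)).symm)
    exact Linear.smul_comp _ _ _ r (Functor.whiskerLeft ζ f)
      ((ζ.ranAdjunction (ModuleCat.{u} R)).counit.app N)

theorem ranHomEquiv_comp {V : J ⥤ ModuleCat.{u} R} {N N' : Cᵒᵖ ⥤ ModuleCat.{u} R}
    (f : V ⟶ ζ.ran.obj N) (a : N ⟶ N') :
    ranHomEquiv ζ V N' (f ≫ ζ.ran.map a) = ranHomEquiv ζ V N f ≫ a :=
  (ζ.ranAdjunction (ModuleCat.{u} R)).homEquiv_naturality_right_symm f a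

theorem ranHomEquiv_precomp {V V' : J ⥤ ModuleCat.{u} R} {N : Cᵒᵖ ⥤ ModuleCat.{u} R}
    (a : V' ⟶ V) (f : V ⟶ ζ.ran.obj N) :
    ranHomEquiv ζ V' N (a ≫ f) = Functor.whiskerLeft ζ a ≫ ranHomEquiv ζ V N f :=
  (ζ.ranAdjunction (ModuleCat.{u} R)).homEquiv_naturality_left_symm a f

instance ran_additive :
    (ζ.ran : (Cᵒᵖ ⥤ ModuleCat.{u} R) ⥤ (J ⥤ ModuleCat.{u} R)).Additive :=
  (ζ.ranAdjunction (ModuleCat.{u} R)).right_adjoint_additive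

/-- Elements of the right Kan extension. -/
noncomputable def ranObjEquiv (E : J) (N : Cᵒᵖ ⥤ ModuleCat.{u} R) :
    (ζ.ran.obj N).obj E ≃ₗ[R] (ζ ⋙ (freeCoyoneda R J).obj (.op E) ⟶ N) :=
  (freeCoyonedaEquiv E (ζ.ran.obj N)).symm ≪≫ₗ ranHomEquiv ζ _ N

theorem ranObjEquiv_comp {E : J} {N N' : Cᵒᵖ ⥤ ModuleCat.{u} R} (x : (ζ.ran.obj N).obj E)
    (a : N ⟶ N') :
    ranObjEquiv ζ E N' (((ζ.ran.map a).app E).hom x) = ranObjEquiv ζ E N x ≫ a := by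
  obtain ⟨f, rfl⟩ := (freeCoyonedaEquiv E (ζ.ran.obj N)).surjective x
  rw [← freeCoyonedaEquiv_comp]
  change ranHomEquiv ζ _ N' ((freeCoyonedaEquiv _ _).symm _) =
    ranHomEquiv ζ _ N ((freeCoyonedaEquiv _ _).symm _) ≫ a
  rw [LinearEquiv.symm_apply_apply, LinearEquiv.symm_apply_apply, ranHomEquiv_comp]

/-- Under the Yoneda identification, the structure maps of the right Kan extension become
precomposition with the maps of free modules. This is what makes the computation of its homology
natural in `E`. -/
theorem ranObjEquiv_map {E E' : J} {N : Cᵒᵖ ⥤ ModuleCat.{u} R} (φ : E ⟶ E')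
    (x : (ζ.ran.obj N).obj E) :
    ranObjEquiv ζ E' N (((ζ.ran.obj N).map φ).hom x) =
      Functor.whiskerLeft ζ ((freeCoyoneda R J).map φ.op) ≫ ranObjEquiv ζ E N x := by
  obtain ⟨f, rfl⟩ := (freeCoyonedaEquiv E (ζ.ran.obj N)).surjective x
  rw [← freeCoyonedaEquiv_map_comp]
  change ranHomEquiv ζ _ N ((freeCoyonedaEquiv _ _).symm _) =
    _ ≫ ranHomEquiv ζ _ N ((freeCoyonedaEquiv _ _).symm _)
  rw [LinearEquiv.symm_apply_apply, LinearEquiv.symm_apply_apply, ranHomEquiv_precomp]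

/-- The image of an injective resolution under the right Kan extension. -/
noncomputable abbrev ranComplex {M : Cᵒᵖ ⥤ ModuleCat.{u} R} (I : InjectiveResolution M) :
    CochainComplex (J ⥤ ModuleCat.{u} R) ℤ :=
  (ζ.ran.mapHomologicalComplex (ComplexShape.up ℤ)).obj I.cochainComplex

instance ranComplex_isStrictlyGE {M : Cᵒᵖ ⥤ ModuleCat.{u} R} (I : InjectiveResolution M) :
    (ranComplex ζ I).IsStrictlyGE 0 := by
  rw [CochainComplex.isStrictlyGE_iff]
  intro i hi
  exact ζ.ran.map_isZero (CochainComplex.isZero_of_isStrictlyGE I.cochainComplex 0 i hi)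

/-- The right Kan extension is right adjoint to restriction, which preserves monomorphisms, so its
terms are injective; the complex is also bounded below. -/
instance ranComplex_isKInjective {M : Cᵒᵖ ⥤ ModuleCat.{u} R} (I : InjectiveResolution M) :
    (ranComplex ζ I).IsKInjective :=
  have (n : ℤ) : Injective ((ranComplex ζ I).X n) :=
    (ζ.ranAdjunction (ModuleCat.{u} R)).map_injective (I.cochainComplex.X n) inferInstance
  CochainComplex.isKInjective_of_injective _ 0

/-- At `E` the complex is `Hom(R[Hom(E, ζ -)], I)` by `ranObjEquiv`, so its homology there is
`Ext^t(R[Hom(E, ζ -)], M)`. The functor `N` with the equivalences `α` is any model of these groups,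
and `hα` says that it has the right induced maps. -/
theorem nonempty_ranComplex_homology_iso {M : Cᵒᵖ ⥤ ModuleCat.{u} R} (I : InjectiveResolution M)
    (t : ℕ) (N : J ⥤ ModuleCat.{u} R)
    (α : ∀ E, Ext (ζ ⋙ (freeCoyoneda R J).obj (.op E)) M t ≃ₗ[R] N.obj E)
    (hα : ∀ {E E' : J} (φ : E ⟶ E') (e : Ext (ζ ⋙ (freeCoyoneda R J).obj (.op E)) M t),
      α E' ((Ext.mk₀ (Functor.whiskerLeft ζ ((freeCoyoneda R J).map φ.op))).comp e
        (zero_add t)) = (N.map φ).hom (α E e)) :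
    Nonempty ((ranComplex ζ I).homology t ≅ N) := by
  let _ := HasDerivedCategory.standard (Cᵒᵖ ⥤ ModuleCat.{u} R)
  let d (i j : ℤ) := ζ.ran.map (I.cochainComplex.d i j)
  let S : ShortComplex (J ⥤ ModuleCat.{u} R) := ShortComplex.mk (d (t - 1) t) (d t (t + 1))
    ((ranComplex ζ I).d_comp_d _ _ _)
  have hS : (ranComplex ζ I).homology t ≅ S.homology :=
    (ranComplex ζ I).homologyIsoSc' _ _ _ (by simp) (by simp)
  let e (E : J) := ranObjEquiv ζ E (I.cochainComplex.X t)
  let X (E : J) := ζ ⋙ (freeCoyoneda R J).obj (.op E)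
  have hmem (E : J) (x : LinearMap.ker ((d t (t + 1)).app E).hom) :
      e E x.1 ∈ homCocycles R (X E) I.cochainComplex t := by
    change ranObjEquiv ζ E _ _ ≫ I.cochainComplex.d _ _ = 0
    refine (ranObjEquiv_comp ζ x.1 (I.cochainComplex.d t (t + 1))).symm.trans ?_
    exact (congrArg _ x.2).trans (map_zero _)
  let κ (E : J) : LinearMap.ker ((d t (t + 1)).app E).hom →ₗ[R] homCocycles R (X E) I.cochainComplex t :=
    ((e E).toLinearMap ∘ₗ Submodule.subtype _).codRestrict _ (hmem E)
  have hκ (E : J) : Function.Surjective (κ E) := by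
    intro f
    refine ⟨⟨(e E).symm f, ?_⟩, Subtype.ext ((e E).apply_symm_apply f)⟩
    change ((ζ.ran.map (I.cochainComplex.d t (t + 1))).app E).hom ((e E).symm f) = 0
    apply (ranObjEquiv ζ E (I.cochainComplex.X (t + 1))).injective
    rw [ranObjEquiv_comp, map_zero]
    refine (congrArg (· ≫ _) ((e E).apply_symm_apply f)).trans ?_
    exact homCocycles.condition f
  -- An element of the kernel at `E` is read as a cocycle with values in `I`, then as its class in
  -- `Ext`, then as an element of `N`.
  let θ (E : J) : LinearMap.ker ((d t (t + 1)).app E).hom →ₗ[R] N.obj E :=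
    (α E).toLinearMap ∘ₗ extOfCocycle R I (X E) t ∘ₗ κ E
  obtain ⟨i⟩ := nonempty_shortComplex_homology_iso (S := S) (N := N) (θ := θ)
    (fun E => (α E).surjective.comp ((extOfCocycle_surjective I (X E) t).comp (hκ E)))
    (fun E x => by
      refine (α E).map_eq_zero_iff.trans
        ((extOfCocycle_eq_zero_iff I (κ E x) ((t : ℤ) - 1) (by omega)).trans ?_)
      constructor
      · rintro ⟨g, hg⟩
        refine ⟨(ranObjEquiv ζ E (I.cochainComplex.X ((t : ℤ) - 1))).symm g, ?_⟩
        apply (e E).injective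
        refine (ranObjEquiv_comp ζ _ _).trans ?_
        rw [LinearEquiv.apply_symm_apply]
        exact hg
      · rintro ⟨y, hy⟩
        refine ⟨ranObjEquiv ζ E (I.cochainComplex.X ((t : ℤ) - 1)) y, ?_⟩
        exact (ranObjEquiv_comp ζ _ _).symm.trans (congrArg (e E) hy))
    (fun {E E'} φ x y hxy => by
      refine Eq.trans ?_ (hα φ (extOfCocycle R I (X E) t (κ E x)))
      refine congrArg (α E') (Eq.trans ?_ (extOfCocycle_precomp I _ (κ E x)))
      refine congrArg (extOfCocycle R I (X E') t) (Subtype.ext ?_)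
      exact (congrArg (e E') hxy.symm).trans (ranObjEquiv_map ζ φ _))
  exact ⟨hS ≪≫ i⟩

/-- The Grothendieck spectral sequence for the composite of the right Kan extension along `ζ` with
the limit over `J`. -/
theorem exists_ran_spectralSequence (M : Cᵒᵖ ⥤ ModuleCat.{u} R) (N : ℕ → J ⥤ ModuleCat.{u} R)
    (α : ∀ t E, Ext (ζ ⋙ (freeCoyoneda R J).obj (.op E)) M t ≃ₗ[R] (N t).obj E)
    (hα : ∀ t {E E' : J} (φ : E ⟶ E') (e : Ext (ζ ⋙ (freeCoyoneda R J).obj (.op E)) M t),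
      α t E' ((Ext.mk₀ (Functor.whiskerLeft ζ ((freeCoyoneda R J).map φ.op))).comp e
        (zero_add t)) = ((N t).map φ).hom (α t E e)) :
    ∃ E : E₂CohomologicalSpectralSequenceNat (ModuleCat.{u} R),
      (∀ (hr : (2 : ℤ) ≤ 2) (s t : ℕ), Nonempty ((E.page 2 hr).X (s, t) ≅ higherLimit (N t) s)) ∧
      ConvergesTo E (fun n => catCohomology M n) := by
  let _ := HasDerivedCategory.standard (Cᵒᵖ ⥤ ModuleCat.{u} R)
  let _ := HasDerivedCategory.standard (J ⥤ ModuleCat.{u} R)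
  let I := InjectiveResolution.of M
  let K := ranComplex ζ I
  let X : J ⥤ ModuleCat.{u} R := (Functor.const J).obj (ModuleCat.of R R)
  have := isKInjective_cochainComplex I
  obtain ⟨E, hE, hE'⟩ := exists_hypercohomology_spectralSequence R X (DerivedCategory.Q.obj K)
    (fun n => catCohomology M n) (fun n => by
      -- Restriction along `ζ` sends the constant functor to the constant functor, so the adjunction
      -- identifies `Hom(R, Ran I)` with `Hom(R, I)`. Both complexes are K-injective, hence the
      -- abutment is the cohomology of `C`.
      obtain ⟨e⟩ := nonempty_hom_linearEquiv (R := R) X K (constModule R C) I.cochainComplex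
        (fun n => ranHomEquiv ζ X (I.cochainComplex.X n))
        (fun n m f => ranHomEquiv_comp ζ f _) n
      exact ⟨extEquivHom R I (constModule R C) n ≪≫ₗ e.symm⟩)
  refine ⟨E, fun hr s t => ?_, hE'⟩
  obtain ⟨e₁⟩ := hE hr s t
  obtain ⟨i⟩ := nonempty_ranComplex_homology_iso ζ I t (N t) (α t) (hα t)
  let j : (DerivedCategory.homologyFunctor _ (t : ℤ)).obj (DerivedCategory.Q.obj K) ≅ N t :=
    (DerivedCategory.homologyFunctorFactors _ (t : ℤ)).app K ≪≫ i
  obtain ⟨e₂⟩ := nonempty_ext_linearEquiv_higherLimit (N t) s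
  exact ⟨(e₁ ≪≫ₗ extLinearEquivOfIso R X j s ≪≫ₗ e₂).toModuleIso⟩

end Grothendieck

namespace FusionSystem

/-! ### The functor of central elements of order dividing `p`. -/

section CentralElements
variable {S : Type u} [Group S] {F : FusionSystem S}

/-- The subgroup of the elements of order dividing `p` in the center of `P`. -/
def centralElements (p : ℕ) (P : Subgroup S) : Subgroup S where
  carrier := {z | z ∈ P ∧ (∀ x ∈ P, x * z = z * x) ∧ z ^ p = 1}
  one_mem' := ⟨one_mem _, by simp, one_pow _⟩
  mul_mem' := by
    rintro a b ⟨ha, ha', hap⟩ ⟨hb, hb', hbp⟩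
    refine ⟨mul_mem ha hb, fun x hx => ?_, ?_⟩
    · rw [← mul_assoc, ha' x hx, mul_assoc, hb' x hx, mul_assoc]
    · have h : Commute a b := hb' a ha
      rw [h.mul_pow, hap, hbp, one_mul]
  inv_mem' := by
    rintro a ⟨ha, ha', hap⟩
    refine ⟨inv_mem ha, fun x hx => ?_, by rw [inv_pow, hap, inv_one]⟩
    have h : Commute x a := ha' x hx
    exact h.inv_right

theorem isElementaryAbelian_centralElements (p : ℕ) (P : Subgroup S) :
    IsElementaryAbelian p (centralElements p P) :=
  ⟨fun x hx _ hy => hy.2.1 x hx.1, fun _ hx => hx.2.2⟩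

theorem IsConj.refl (P : Subgroup S) : F.IsConj P P :=
  ⟨MonoidHom.id _, F.conj_mem _ 1 (by simp), Function.surjective_id⟩

theorem IsCentric.centralizer_le {P : Subgroup S} (hP : F.IsCentric P) :
    Subgroup.centralizer (P : Set S) ≤ P := hP P (IsConj.refl P)

/-- A centric subgroup is nontrivial, since the trivial subgroup is centralized by all of `S`. A
nontrivial finite `p`-group has a nontrivial center, which contains an element of order `p` by
Cauchy's theorem. -/
theorem centralElements_ne_bot [Finite S] [Nontrivial S] {p : ℕ} [Fact p.Prime]
    (hS : IsPGroup p S) {P : Subgroup S} (hP : F.IsCentric P) : centralElements p P ≠ ⊥ := by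
  have hbot : P ≠ ⊥ := by
    rintro rfl
    obtain ⟨x, hx⟩ := exists_ne (1 : S)
    refine hx (Subgroup.mem_bot.1 (hP.centralizer_le (Subgroup.mem_centralizer_iff.2 ?_)))
    intro y hy
    rw [Subgroup.mem_bot.1 hy, one_mul, mul_one]
  have hPp : IsPGroup p P := hS.to_subgroup P
  have : Nontrivial P := (Subgroup.nontrivial_iff_ne_bot P).2 hbot
  have : Nontrivial (Subgroup.center P) := hPp.center_nontrivial
  have hdvd : p ∣ Nat.card (Subgroup.center P) :=
    (hPp.to_subgroup _).card_eq_or_dvd.resolve_left Finite.one_lt_card.ne'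
  obtain ⟨z, hz⟩ := exists_prime_orderOf_dvd_card' p hdvd
  intro h
  have hmem : (((z : P) : S)) ∈ centralElements p P := by
    refine ⟨(z : P).2, fun x hx => ?_, ?_⟩
    · exact congrArg Subtype.val (Subgroup.mem_center_iff.1 z.2 ⟨x, hx⟩)
    · have := pow_orderOf_eq_one z
      rw [hz] at this
      exact congrArg (fun y : Subgroup.center P => ((y : P) : S)) this
  rw [h, Subgroup.mem_bot] at hmem
  have h1 : z = 1 := Subtype.ext (Subtype.ext hmem)
  rw [h1, orderOf_one] at hz
  exact (Fact.out : p.Prime).one_lt.ne hz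

/-- The map is `φ⁻¹` restricted to the central elements of `Q`, where `φ` is any representative of
`f`. One `k` serves all representatives. -/
theorem exists_centralElementsHom (p : ℕ) {P Q : F.CentricOrbitCategory} (f : P ⟶ Q) :
    ∃ k ∈ F.Mor (centralElements p Q.subgroup) (centralElements p P.subgroup),
      ∀ (φ : P.subgroup →* Q.subgroup) (hφ : φ ∈ F.Mor P.subgroup Q.subgroup),
        CentricOrbitCategory.mk φ hφ = f → ∀ z, (φ ⟨k z, (k z).2.1⟩ : S) = z := by
  obtain ⟨φ, hφ, rfl⟩ := CentricOrbitCategory.exists_rep f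
  let A : Subgroup S := (Q.subgroup.subtype.comp φ).range
  have hA : F.IsConj P.subgroup A := isConj_map hφ le_rfl A (fun s => Iff.rfl)
  -- Elements of `Z(Q)` centralize the image of `φ`. The image is conjugate to the centric subgroup
  -- `P`, so it contains its centralizer.
  have hle : centralElements p Q.subgroup ≤ A := by
    intro z hz
    refine P.property A hA (Subgroup.mem_centralizer_iff.2 ?_)
    rintro _ ⟨x, rfl⟩
    exact hz.2.1 _ (φ x).2
  obtain ⟨ψ, hψ, hψφ⟩ := exists_inverse hφ A (fun s => Iff.rfl)
  have hinj : ∀ x y : P.subgroup, (φ x : S) = φ y → x = y := fun x y h =>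
    F.injective hφ (Subtype.ext h)
  have hres : ∀ (a : S) (ha : a ∈ centralElements p Q.subgroup),
      (ψ ⟨a, hle ha⟩ : S) ∈ centralElements p P.subgroup := by
    intro a ha
    refine ⟨(ψ _).2, fun x hx => ?_, ?_⟩
    · refine congrArg Subtype.val (hinj (⟨x, hx⟩ * ψ ⟨a, hle ha⟩) (ψ ⟨a, hle ha⟩ * ⟨x, hx⟩) ?_)
      rw [map_mul, map_mul, Subgroup.coe_mul, Subgroup.coe_mul, hψφ]
      exact ha.2.1 _ (φ _).2
    · refine congrArg Subtype.val (hinj (ψ ⟨a, hle ha⟩ ^ p) 1 ?_)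
      rw [map_pow, map_one, Subgroup.coe_pow, hψφ]
      exact ha.2.2
  refine ⟨restrictHom ψ _ _ hle hres, mem_of_agree hψ hle _ (fun _ => rfl),
    fun φ' hφ' h z => ?_⟩
  -- Another representative differs from `φ` by conjugation with some `q` in `Q`, which fixes
  -- central elements of `Q`.
  obtain ⟨q, hq⟩ := (CentricOrbitCategory.mk_eq_iff hφ hφ').1 h.symm
  rw [hq]
  change (q : S) * (φ (ψ ⟨z, hle z.2⟩) : S) * (q : S)⁻¹ = z
  rw [hψφ]
  change (q : S) * z * (q : S)⁻¹ = z
  rw [z.2.2.1 q q.2, mul_inv_cancel_right]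

/-- The map on central elements of order `p` induced contravariantly by a morphism of the centric
orbit category. -/
noncomputable def centralElementsHom (p : ℕ) {P Q : F.CentricOrbitCategory} (f : P ⟶ Q) :
    centralElements p Q.subgroup →* centralElements p P.subgroup :=
  (exists_centralElementsHom p f).choose

theorem centralElementsHom_mem (p : ℕ) {P Q : F.CentricOrbitCategory} (f : P ⟶ Q) :
    centralElementsHom p f ∈ F.Mor _ _ := (exists_centralElementsHom p f).choose_spec.1

theorem apply_centralElementsHom (p : ℕ) {P Q : F.CentricOrbitCategory}
    (φ : P.subgroup →* Q.subgroup) (hφ : φ ∈ F.Mor P.subgroup Q.subgroup)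
    (z : centralElements p Q.subgroup) :
    (φ ⟨centralElementsHom p (CentricOrbitCategory.mk φ hφ) z, (centralElementsHom p _ z).2.1⟩ : S)
      = z := (exists_centralElementsHom p _).choose_spec.2 φ hφ rfl z

/-- Since `φ` is injective, an equation for the contravariant map, which is only known by its
existence, becomes an equation for `φ`. Functoriality is checked in this form. -/
theorem centralElementsHom_eq_iff (p : ℕ) {P Q : F.CentricOrbitCategory}
    (φ : P.subgroup →* Q.subgroup) (hφ : φ ∈ F.Mor P.subgroup Q.subgroup)
    (z : centralElements p Q.subgroup) (y : centralElements p P.subgroup) :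
    centralElementsHom p (CentricOrbitCategory.mk φ hφ) z = y ↔ (φ ⟨y, y.2.1⟩ : S) = z := by
  constructor
  · rintro rfl
    exact apply_centralElementsHom p φ hφ z
  · intro h
    have := F.injective hφ (Subtype.ext ((apply_centralElementsHom p φ hφ z).trans h.symm))
    exact Subtype.ext (Subtype.mk.inj this)

variable (F) in
/-- The functor that sends a centric subgroup to its central elements of order `p`. -/
noncomputable def centralElementsFunctor (p : ℕ) : F.CentricOrbitCategoryᵒᵖ ⥤ F.Obj where
  obj P := ⟨centralElements p P.unop.subgroup⟩
  map f := ⟨centralElementsHom p f.unop, centralElementsHom_mem p f.unop⟩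
  map_id P := by
    refine Subtype.ext (MonoidHom.ext fun z => ?_)
    exact (centralElementsHom_eq_iff p (P := P.unop) (Q := P.unop) (MonoidHom.id _)
      (F.conj_mem _ 1 (by simp)) z z).2 rfl
  map_comp {P Q T} f g := by
    refine Subtype.ext (MonoidHom.ext fun z => ?_)
    obtain ⟨φ, hφ, hf⟩ := CentricOrbitCategory.exists_rep f.unop
    obtain ⟨ψ, hψ, hg⟩ := CentricOrbitCategory.exists_rep g.unop
    change centralElementsHom p (g.unop ≫ f.unop) z =
      centralElementsHom p g.unop (centralElementsHom p f.unop z)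
    rw [← hf, ← hg, CentricOrbitCategory.mk_comp_mk, centralElementsHom_eq_iff]
    refine Eq.trans ?_ (apply_centralElementsHom p φ hφ z)
    exact congrArg (fun y => (φ y : S)) (Subtype.ext (apply_centralElementsHom p ψ hψ _))

end CentralElements

/-! ### Replacing the values by fully centralized conjugates. -/

section FullyCentralized
variable {S : Type u} [Group S] {F : FusionSystem S}

theorem exists_isConj_fullyCentralized [Finite S] (A : Subgroup S) :
    ∃ E, F.IsConj A E ∧ F.FullyCentralized E := by
  have : Nonempty {Q : Subgroup S // F.IsConj A Q} := ⟨⟨A, IsConj.refl A⟩⟩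
  obtain ⟨E, hE⟩ := Finite.exists_max (fun Q : {Q : Subgroup S // F.IsConj A Q} =>
    Nat.card (Subgroup.centralizer (Q.1 : Set S)))
  exact ⟨E, E.2, fun Q hQ => hE ⟨Q, E.2.trans hQ⟩⟩

theorem IsConj.nonempty_iso {P Q : Subgroup S} (h : F.IsConj P Q) :
    Nonempty ((⟨P⟩ : F.Obj) ≅ ⟨Q⟩) := by
  obtain ⟨φ, hφ, hs⟩ := h
  obtain ⟨ψ, hψ, h⟩ := exists_inverse hφ Q (fun s =>
    ⟨fun hs' => (hs ⟨s, hs'⟩).imp fun x hx => congrArg Subtype.val hx,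
      by rintro ⟨x, rfl⟩; exact (φ x).2⟩)
  refine ⟨⟨⟨φ, hφ⟩, ⟨ψ, hψ⟩, Subtype.ext (MonoidHom.ext fun x => ?_),
    Subtype.ext (MonoidHom.ext fun x => Subtype.ext (h x))⟩⟩
  exact F.injective hφ (Subtype.ext (h (φ x)))

theorem IsElementaryAbelian.of_isConj {p : ℕ} {P Q : Subgroup S} (hP : IsElementaryAbelian p P)
    (h : F.IsConj P Q) : IsElementaryAbelian p Q := by
  obtain ⟨φ, -, hs⟩ := h
  constructor
  · intro x hx y hy
    obtain ⟨a, ha⟩ := hs ⟨x, hx⟩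
    obtain ⟨b, hb⟩ := hs ⟨y, hy⟩
    have h1 : a * b = b * a := Subtype.ext (hP.1 a a.2 b b.2)
    have h2 := congrArg (fun z => (φ z : S)) h1
    simpa only [map_mul, ha, hb, Subgroup.coe_mul] using h2
  · intro x hx
    obtain ⟨a, ha⟩ := hs ⟨x, hx⟩
    have h1 : a ^ p = 1 := Subtype.ext (hP.2 a a.2)
    have h2 := congrArg (fun z => (φ z : S)) h1
    simpa only [map_pow, ha, map_one, Subgroup.coe_pow, Subgroup.coe_one] using h2

/-- The objects of `F^e` are fully centralized, which is not known for the central elements of a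
centric subgroup. A conjugate with centralizer of maximal order serves instead, and conjugation
preserves the other two conditions. -/
theorem exists_iso_elementaryAbelian [Finite S] {p : ℕ} {A : Subgroup S} (hA : A ≠ ⊥)
    (hA' : IsElementaryAbelian p A) :
    ∃ E : F.ElementaryAbelianCategory p, Nonempty ((⟨A⟩ : F.Obj) ≅ E.obj) := by
  obtain ⟨E, hE, hE'⟩ := exists_isConj_fullyCentralized (F := F) A
  refine ⟨⟨⟨E⟩, ?_, hA'.of_isConj hE, hE'⟩, hE.nonempty_iso⟩
  rintro (rfl : E = ⊥)
  obtain ⟨φ, hφ, -⟩ := hE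
  refine hA (Subgroup.eq_bot_iff_forall _ |>.2 fun x hx => ?_)
  have : (⟨x, hx⟩ : A) = 1 := F.injective hφ (Subsingleton.elim _ _)
  exact congrArg Subtype.val this

variable [Finite S] [Nontrivial S] {p : ℕ} [Fact p.Prime]

/-- A fully centralized subgroup conjugate to the central elements of order `p` of `P`. -/
noncomputable def centralObj (hS : IsPGroup p S) (P : F.CentricOrbitCategory) :
    F.ElementaryAbelianCategory p :=
  (exists_iso_elementaryAbelian (F := F) (centralElements_ne_bot hS P.property)
    (isElementaryAbelian_centralElements p P.subgroup)).choose

/-- The isomorphism of the central elements of order `p` with a fully centralized subgroup. -/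
noncomputable def centralIso (hS : IsPGroup p S) (P : F.CentricOrbitCategory) :
    (F.centralElementsFunctor p).obj (.op P) ≅ (centralObj hS P).obj :=
  (exists_iso_elementaryAbelian (F := F) (centralElements_ne_bot hS P.property)
    (isElementaryAbelian_centralElements p P.subgroup)).choose_spec.some

variable (F) in
/-- The functor `O^c(F)ᵒᵖ ⥤ F^e` that sends a centric subgroup to its central elements of order `p`,
up to isomorphism. -/
noncomputable def centralFunctor (hS : IsPGroup p S) :
    F.CentricOrbitCategoryᵒᵖ ⥤ F.ElementaryAbelianCategory p where
  obj P := centralObj hS P.unop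
  map {P Q} f := ObjectProperty.homMk ((centralIso hS P.unop).inv ≫
    (F.centralElementsFunctor p).map f ≫ (centralIso hS Q.unop).hom)
  map_id P := by
    apply ObjectProperty.hom_ext
    change _ ≫ _ ≫ _ = 𝟙 _
    rw [CategoryTheory.Functor.map_id]
    exact (congrArg _ (Category.id_comp _)).trans (Iso.inv_hom_id _)
  map_comp f g := by
    apply ObjectProperty.hom_ext
    change _ ≫ _ ≫ _ = (_ ≫ _ ≫ _) ≫ (_ ≫ _ ≫ _)
    simp only [Functor.map_comp, Category.assoc, Iso.hom_inv_id_assoc]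

/-- Morphisms to the values of `centralFunctor`. -/
noncomputable def toCentralFunctor (hS : IsPGroup p S) {E : F.ElementaryAbelianCategory p}
    {P : F.CentricOrbitCategory} (k : E.obj ⟶ (F.centralElementsFunctor p).obj (.op P)) :
    E ⟶ (F.centralFunctor hS).obj (.op P) :=
  ObjectProperty.homMk (k ≫ (centralIso hS P).hom)

theorem toCentralFunctor_surjective (hS : IsPGroup p S) {E : F.ElementaryAbelianCategory p}
    {P : F.CentricOrbitCategory} (x : E ⟶ (F.centralFunctor hS).obj (.op P)) :
    ∃ k, toCentralFunctor hS k = x := by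
  refine ⟨x.hom ≫ (centralIso hS P).inv, ObjectProperty.hom_ext _ ?_⟩
  exact (Category.assoc _ _ _).trans
    ((congrArg _ (Iso.inv_hom_id _)).trans (Category.comp_id _))

theorem toCentralFunctor_injective (hS : IsPGroup p S) {E : F.ElementaryAbelianCategory p}
    {P : F.CentricOrbitCategory} {k k' : E.obj ⟶ (F.centralElementsFunctor p).obj (.op P)}
    (h : toCentralFunctor hS k = toCentralFunctor hS k') : k = k' :=
  (cancel_mono (centralIso hS P).hom).1 (congrArg (·.hom) h)

theorem toCentralFunctor_map (hS : IsPGroup p S) {E : F.ElementaryAbelianCategory p}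
    {P Q : F.CentricOrbitCategory} (k : E.obj ⟶ (F.centralElementsFunctor p).obj (.op Q))
    (f : P ⟶ Q) :
    toCentralFunctor hS k ≫ (F.centralFunctor hS).map f.op =
      toCentralFunctor hS (k ≫ (F.centralElementsFunctor p).map f.op) := by
  apply ObjectProperty.hom_ext
  have h {D : Type u} [Category.{u} D] {X Y Y' Z Z' : D} (a : X ⟶ Y) (i : Y ≅ Y') (b : Y ⟶ Z)
    (c : Z ⟶ Z') : (a ≫ i.hom) ≫ i.inv ≫ b ≫ c = (a ≫ b) ≫ c := by simp
  exact h k (centralIso hS Q) ((F.centralElementsFunctor p).map f.op) (centralIso hS P).hom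

theorem comp_toCentralFunctor (hS : IsPGroup p S) {E E' : F.ElementaryAbelianCategory p}
    {P : F.CentricOrbitCategory} (k : E.obj ⟶ (F.centralElementsFunctor p).obj (.op P))
    (φ : E' ⟶ E) : φ ≫ toCentralFunctor hS k = toCentralFunctor hS (φ.hom ≫ k) :=
  ObjectProperty.hom_ext _ (Category.assoc _ _ _).symm

end FullyCentralized

/-! ### Centric subgroups of centralizers as a universal family. -/

section UniversalFamily
variable {S : Type u} [Group S] {F : FusionSystem S} {p : ℕ}

/-- The inclusion of `E` into the central elements of order `p` of a `C_F(E)`-centric subgroup. -/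
noncomputable def toCentralElements (hF : F.IsSaturated p) (E : F.ElementaryAbelianCategory p)
    (P : CentralizerOrbit E) :
    E.obj ⟶ (F.centralElementsFunctor p).obj (.op ((centralizerInclusion hF E).obj P)) :=
  have h : E.subgroup ≤ centralElements p ((centralizerInclusion hF E).obj P).subgroup :=
    fun e he => ⟨Transport.mem_inclusion hF E P ⟨e, he⟩, by
      rintro _ ⟨x, -, rfl⟩
      exact (Subgroup.mem_centralizer_iff.1 x.2 e he).symm, E.property.2.1.2 e he⟩
  ⟨Subgroup.inclusion h, F.conj_mem _ 1 (fun x => by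
    rw [one_mul, inv_one, mul_one]; rfl)⟩

theorem comp_centralElementsFunctor_map_eq_iff {E : F.Obj} {P Q : F.CentricOrbitCategory}
    (k : E ⟶ (F.centralElementsFunctor p).obj (.op Q))
    (l : E ⟶ (F.centralElementsFunctor p).obj (.op P))
    (φ : P.subgroup →* Q.subgroup) (hφ : φ ∈ F.Mor P.subgroup Q.subgroup) :
    k ≫ (F.centralElementsFunctor p).map (CentricOrbitCategory.mk φ hφ).op = l ↔
      ∀ e : E.subgroup, (φ ⟨(l.1 e : S), (l.1 e).2.1⟩ : S) = (k.1 e : S) := by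
  constructor
  · rintro rfl e
    exact apply_centralElementsHom p φ hφ (k.1 e)
  · intro h
    refine Subtype.ext (MonoidHom.ext fun e => ?_)
    exact (centralElementsHom_eq_iff p φ hφ (k.1 e) (l.1 e)).2 (h e)

/-- A morphism of `C_F(E)` extends to one that is the identity on `E`. As `E` lies in every
`C_F(E)`-centric subgroup, the morphism itself fixes `E` pointwise. -/
theorem toCentralElements_naturality (hF : F.IsSaturated p) (E : F.ElementaryAbelianCategory p)
    {P Q : CentralizerOrbit E} (g : P ⟶ Q) :
    toCentralElements hF E Q ≫
      (F.centralElementsFunctor p).map ((centralizerInclusion hF E).map g).op =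
      toCentralElements hF E P := by
  obtain ⟨φ, hφ, rfl⟩ := CentricOrbitCategory.exists_rep g
  refine (comp_centralElementsFunctor_map_eq_iff (P := (centralizerInclusion hF E).obj P)
    (Q := (centralizerInclusion hF E).obj Q) _ _ _ (mapHom_subtype_mem _ _ φ hφ)).2 fun e => ?_
  obtain ⟨ψ, -, h1, h2⟩ := hφ
  obtain ⟨x, hx, hxe⟩ := Transport.mem_inclusion hF E P e
  have h3 := mapHom_apply (Subgroup.subtype _) (Subgroup.subtype_injective
    (Subgroup.centralizer (E.subgroup : Set S))) φ ⟨x, hx⟩ ⟨x, hx, rfl⟩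
  refine Eq.trans ?_ (h1 e e.2)
  refine Eq.trans ?_ (h3.trans ((h2 ⟨x, hx⟩).symm.trans ?_))
  · exact congrArg (fun z => ((mapHom (Subgroup.subtype _) (Subgroup.subtype_injective _) φ z :
      Q.subgroup.map (Subgroup.subtype _)) : S)) (Subtype.ext hxe.symm)
  · exact congrArg (fun z => (ψ z : S)) (Subtype.ext hxe)

/-- The universal map is an isomorphism of `P` with a subgroup of `C_S(E)` which extends `x⁻¹`. Any
other map `f'` with associated element `x` also carries `x(e)` to `e`, so it differs from the
universal one by a morphism that fixes `E`, that is, by a morphism of `C_F(E)`. -/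
theorem exists_universal_toCentralElements (hF : F.IsSaturated p)
    (E : F.ElementaryAbelianCategory p) {P : F.CentricOrbitCategory}
    (x : E.obj ⟶ (F.centralElementsFunctor p).obj (.op P)) :
    ∃ (w : CentralizerOrbit E) (f : P ⟶ (centralizerInclusion hF E).obj w),
      toCentralElements hF E w ≫ (F.centralElementsFunctor p).map f.op = x ∧
      ∀ (w' : CentralizerOrbit E) (f' : P ⟶ (centralizerInclusion hF E).obj w'),
        toCentralElements hF E w' ≫ (F.centralElementsFunctor p).map f'.op = x →
        ∃! g : w ⟶ w', f ≫ (centralizerInclusion hF E).map g = f' := by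
  let A : Subgroup S := ((centralElements p P.subgroup).subtype.comp x.1).range
  obtain ⟨β, hβ, hβ'⟩ := exists_inverse x.2 A (fun s => Iff.rfl)
  have hmA : ∀ e : E.subgroup, (x.1 e : S) ∈ A := fun e => ⟨e, rfl⟩
  have hβx : ∀ e (h : (x.1 e : S) ∈ A), β ⟨_, h⟩ = e := fun e h =>
    F.injective x.2 (Subtype.ext (hβ' _))
  -- Receptivity of `E` extends `x⁻¹ : A → E` to `C_S(A)`; this group contains `P` because `A` is
  -- central in `P`.
  obtain ⟨ψ, hψ, hψβ⟩ := exists_extension hF E.property.2.2 E.le_centralizer hβ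
    (fun e => ⟨_, hβx e (hmA e)⟩)
  have hPA : P.subgroup ≤ Subgroup.centralizer (A : Set S) := by
    intro y hy
    refine Subgroup.mem_centralizer_iff.2 ?_
    rintro _ ⟨e, rfl⟩
    exact ((x.1 e).2.2.1 y hy).symm
  let W : Subgroup (Subgroup.centralizer (E.subgroup : Set S)) :=
    (ψ.comp (Subgroup.inclusion hPA)).range
  have hres : ∀ (a : S) (ha : a ∈ P.subgroup),
      (ψ ⟨a, hPA ha⟩ : S) ∈ W.map (Subgroup.subtype _) :=
    fun a ha => ⟨_, ⟨⟨a, ha⟩, rfl⟩, rfl⟩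
  let χ : P.subgroup →* W.map (Subgroup.subtype _) := restrictHom ψ _ _ hPA hres
  have hχ : χ ∈ F.Mor _ _ := mem_of_agree hψ hPA _ (fun _ => rfl)
  have hχs : Function.Surjective χ := by
    rintro ⟨_, _, ⟨y, rfl⟩, rfl⟩
    exact ⟨y, rfl⟩
  -- The image of `P` is `F`-conjugate to `P`, hence `F`-centric, and this implies centric in
  -- `C_F(E)`.
  have hW : (F.centralizer E.subgroup).IsCentric W :=
    isCentric_of_map_subtype (P.property.of_isConj ⟨χ, hχ, hχs⟩)
  let w : CentralizerOrbit E := ⟨⟨⟨W⟩⟩, hW⟩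
  let f : P ⟶ (centralizerInclusion hF E).obj w :=
    CentricOrbitCategory.mk (Q := (centralizerInclusion hF E).obj w) χ hχ
  have hχx : ∀ e : E.subgroup, (χ ⟨x.1 e, (x.1 e).2.1⟩ : S) = e := fun e =>
    (hψβ ⟨_, hmA e⟩ (hPA (x.1 e).2.1)).trans (congrArg Subtype.val (hβx e _))
  have hf : IsIso f := CentricOrbitCategory.isIso_mk
    (Q := (centralizerInclusion hF E).obj w) χ hχ hχs
  refine ⟨w, f, (comp_centralElementsFunctor_map_eq_iff
    (Q := (centralizerInclusion hF E).obj w) _ x χ hχ).2 hχx, fun w' f' hf' => ?_⟩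
  obtain ⟨φ', hφ', rfl⟩ := CentricOrbitCategory.exists_rep f'
  have hφx := (comp_centralElementsFunctor_map_eq_iff _ x φ' hφ').1 hf'
  obtain ⟨ω, hω, hω'⟩ := exists_inverse hχ (W.map (Subgroup.subtype _)) (fun s =>
    ⟨fun hs => (hχs ⟨s, hs⟩).imp fun y hy => congrArg Subtype.val hy, by
      rintro ⟨y, rfl⟩; exact (χ y).2⟩)
  have hωχ : ∀ y, ω (χ y) = y := fun y => F.injective hχ (Subtype.ext (hω' _))
  -- The composite of `χ⁻¹` with `φ'` sends `e` to `x(e)` and back to `e`, so it belongs to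
  -- `C_F(E)`. Uniqueness follows below, since `f` is an isomorphism and the inclusion of orbit
  -- categories is faithful.
  obtain ⟨g, hg⟩ := exists_lift hF (P := w) (Q := w') (φ'.comp ω) (F.comp_mem hω hφ')
    (fun e he => by
      have h4 : (⟨e, he⟩ : W.map (Subgroup.subtype _)) = χ ⟨x.1 e, (x.1 e).2.1⟩ :=
        Subtype.ext (hχx e).symm
      refine Eq.trans ?_ (hφx e)
      change (φ' (ω ⟨e, he⟩) : S) = _
      rw [h4, hωχ])
  have hfg : f ≫ (centralizerInclusion hF E).map g = CentricOrbitCategory.mk φ' hφ' := by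
    rw [hg]
    refine (CentricOrbitCategory.mk_comp_mk (Q := (centralizerInclusion hF E).obj w) hχ
      (F.comp_mem hω hφ')).trans ?_
    congr 1
    ext y
    exact congrArg (fun z => (φ' z : S)) (hωχ y)
  refine ⟨g, hfg, fun g' hg' => ?_⟩
  apply (centralizerInclusion hF E).map_injective
  exact (cancel_epi f).1 (hg'.trans hfg.symm)

variable [Finite S] [Nontrivial S] [Fact p.Prime]

/-- The inclusions of `E` into the centers of the `C_F(E)`-centric subgroups. -/
noncomputable def universalFamily (hS : IsPGroup p S) (hF : F.IsSaturated p)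
    (E : F.ElementaryAbelianCategory p) :
    UniversalFamily (F.centralFunctor hS) (centralizerInclusion hF E) E where
  map w := toCentralFunctor hS (toCentralElements hF E w)
  naturality g := by rw [toCentralFunctor_map, toCentralElements_naturality]
  exists_universal x := by
    obtain ⟨k, rfl⟩ := toCentralFunctor_surjective hS x
    obtain ⟨w, f, hf, h⟩ := exists_universal_toCentralElements hF E k
    refine ⟨w, f, by rw [toCentralFunctor_map, hf], fun w' f' hf' => h w' f' ?_⟩
    rw [toCentralFunctor_map] at hf'
    exact toCentralFunctor_injective hS hf'

/-- The comparison isomorphism of a transport extends `φ⁻¹`. This is the compatibility that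
`extMap_naturality` requires. -/
theorem universalFamily_transport (hS : IsPGroup p S) (hF : F.IsSaturated p)
    {E E' : F.ElementaryAbelianCategory p} {φ : E ⟶ E'} (T : Transport hF φ)
    (w : CentralizerOrbit E') :
    (universalFamily hS hF E).map (T.functor.obj w) ≫
      (F.centralFunctor hS).map (T.comparison.app w).op =
      φ ≫ (universalFamily hS hF E').map w := by
  change toCentralFunctor hS _ ≫ _ = φ ≫ toCentralFunctor hS _
  obtain ⟨g, hg, h1, -, h3⟩ := T.spec w
  rw [h1, comp_toCentralFunctor]
  refine (toCentralFunctor_map hS _ _).trans (congrArg (toCentralFunctor hS) ?_)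
  exact (comp_centralElementsFunctor_map_eq_iff (P := (centralizerInclusion hF E').obj w)
    (Q := (centralizerInclusion hF E).obj (T.functor.obj w)) _ _ g hg).2 (fun e => h3 e _)

end UniversalFamily
end FusionSystem

/-! ### The centralizer spectral sequence. -/

theorem theorem1p2 {S : Type u} [Group S] [Finite S] [Nontrivial S] (p : ℕ) [Fact p.Prime]
    (hS : IsPGroup p S) (F : FusionSystem S) (hF : F.IsSaturated p)
    {R : Type u} [CommRing R] (M : F.CentricOrbitCategoryᵒᵖ ⥤ ModuleCat.{u} R) :
    ∃ E : E₂CohomologicalSpectralSequenceNat (ModuleCat.{u} R),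
      (∀ s t : ℕ, Nonempty
        ((E.page 2).X (s, t) ≅ higherLimit (FusionSystem.centralizerCohomology hF M t) s)) ∧
      ConvergesTo E (fun n => catCohomology M n) := by
  obtain ⟨E, hE, hE'⟩ := exists_ran_spectralSequence (F.centralFunctor hS) M
    (FusionSystem.centralizerCohomology hF M)
    (fun t E => LinearEquiv.ofBijective
      ((FusionSystem.universalFamily hS hF E).extMap R M t)
      ((FusionSystem.universalFamily hS hF E).extMap_bijective M t))
    (fun t E E' φ e => by
      obtain ⟨T⟩ := FusionSystem.Transport.nonempty hF φ
      -- The induced map is independent of the transport, so the one at hand can replace the choice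
      -- made in the definition.
      rw [FusionSystem.centralizerCohomology_map hF M t φ T]
      exact (FusionSystem.universalFamily hS hF E).extMap_naturality
        (FusionSystem.universalFamily hS hF E') φ T.functor T.comparison
        (FusionSystem.universalFamily_transport hS hF T) M t e)
  exact ⟨E, hE le_rfl, hE'⟩
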